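/- **Setting.** The input consists of $n\ge 2$ arbitrary items $x_1,\dots,x_n$, each a polynomial $x_i(\lambda)=b_i\lambda+c_i$ of degree at most one in a real parameter $\lambda$ (equal slopes, identical items and coinciding crossings are allowed). $B$ is a decision problem on $\lambda\in\mathbb R$ which is true for all $\lambda<\lambda^*$ and false for all $\lambda>\lambda^*$, and whose answer at $\lambda$ depends only on the order of the numbers $x_1(\lambda),\dots,x_n(\lambda)$ (the problem is "driven by sorting"). The optimization problem is to find $\lambda^*$. The algorithm has access to $\lambda^*$ only through a decision algorithm $\mathcal C$, which for a given $\lambda$ tells in time at most $C(n)$ whether $\lambda<\lambda^*$, $\lambda=\lambda^*$ or $\lambda>\lambda^*$. If $b_i\neq b_j$, the comparison of $x_i(\lambda^*)$ with $x_j(\lambda^*)$ is a comparison of $\lambda^*$ with the root $\lambda_{ij}$ of $x_i-x_j$. A comparison is *resolved* when its outcome follows from the answers of $\mathcal C$ obtained so far (or when it does not depend on $\lambda$). **Boxsort.** The items are sorted at $\lambda=\lambda^*$ by boxsort. A recursive call on $m$ items with $m<\log_2 n$ compares all pairs of its items. Any other call marks $\lfloor\sqrt m\rfloor$ of its items, chosen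 uniformly at random and independently of the other calls; it sorts the marked items by comparing all pairs of them; when all these comparisons are resolved, it routes every unmarked item through the perfectly balanced binary search tree of the marked items; when the last item has arrived, the unmarked items are split into $\lfloor\sqrt m\rfloor+1$ boxes and the call recurses on all boxes simultaneously. **Weights.** A comparison becomes active as soon as the comparisons on which it depends are resolved, and stays active until it is resolved. The initial comparisons of the top-level call have weight $1$. In a call on $m$ items whose initial comparisons (between marked items, or in the base case) have weight $w$, the first routing comparison of each unmarked item has weight $w/(2m^2)$; a resolved routing comparison passes half of its weight to the next routing comparison of the same item; and the initial comparisons of the subproblems get weight $w/(4m^{4.5})$. (These are the values given by the rule that a resolved comparison of weight $w$ which activates $m$ comparisons gives $w/2m$ to each, when synchronizing binary trees of virtual comparisons of height $\log m$ are placed before and after the routing.) **Turns.** In every turn the algorithm finds the weighted median $r$ of the roots of the active comparisons by a linear-time selection algorithm, calls $\mathcal C$ on $r$, stops with the answer $r$ if $r=\lambda^*$, and otherwise resolves all comparisons whose outcome is now known and activates the comparisons that depend on them. Running time is the number of elementary steps of a real RAM, including the time spent in $\mathcal C$. **Theorem.** For every such input and every outcome of the random choices, the algorithm finds $\lambda^*$.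 Moreover, there are absolute constants $K,b>0$ such that for every $n\ge 2$ and every such input, with probability at least $1-\exp(-(\log n)^b)$, the algorithm makes at most $K\log n$ calls to $\mathcal C$ and runs in time at most $K\,(n\log n+\log n\cdot C(n))$. -/

import Mathlib

/-!  Step counting.  A value of `Timed α` is a result together with the number of elementary steps
(unit-cost operations of a real RAM) spent on producing it.  Steps are charged by `tick`; a pass
over a list is charged its length, constant factors per element being immaterial. -/

structure Timed (α : Type) where
  val : α
  steps : ℕ

instance : Monad Timed where
  pure a := ⟨a, 0⟩
  bind s f := ⟨(f s.val).val, s.steps + (f s.val).steps⟩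

def tick (k : ℕ) : Timed Unit := ⟨(), k⟩

/-- Run `f` on every entry of a list and concatenate the resulting lists. -/
def collect {α β : Type} (f : α → Timed (List β)) : List α → Timed (List β)
  | [] => pure []
  | a :: l => do
    let r ← f a
    let rs ← collect f l
    tick (r.length + 1)
    pure (r ++ rs)

/-!  Weighted median in linear time, by the median-of-medians method. -/

/-- Cut a list into consecutive groups of five (the last one may be shorter). -/
def groupsOfFive : List ℝ → List (List ℝ)
  | a :: b :: c :: d :: e :: l => [a, b, c, d, e] :: groupsOfFive l
  | [] => []
  | l => [l]

/-- The middle entry of a (nonempty) group of at most five numbers. -/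
noncomputable def groupMedian (g : List ℝ) : ℝ :=
  (g.insertionSort (· ≤ ·)).getD (g.length / 2) 0

/-- Weighted selection in a list of pairs (value, weight): the least value `r` of the list for
which the values `≤ r` have total weight at least `target`.  The first argument bounds the
recursion depth; the length of the list is enough. -/
noncomputable def weightedSelect : ℕ → ℝ → List (ℝ × ℝ) → Timed ℝ
  | _, _, [] => pure 0
  | _, _, [a] => do
    tick 1
    pure a.1
  | 0, _, _ => pure 0
  | f + 1, target, l => do
    tick l.length
    let medians := (groupsOfFive (l.map Prod.fst)).map groupMedian
    let p ← weightedSelect f ((medians.length : ℝ) / 2) (medians.map fun r => (r, 1))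
    tick l.length
    let below := l.filter fun a => a.1 < p
    let above := l.filter fun a => p < a.1
    let weightBelow := (below.map Prod.snd).sum
    let weightUpTo := ((l.filter fun a => a.1 ≤ p).map Prod.snd).sum
    if target ≤ weightBelow then
      weightedSelect f target below
    else if target ≤ weightUpTo then
      pure p
    else
      weightedSelect f (target - weightUpTo) above

/-- The weighted median of a list of pairs (value, weight). -/
noncomputable def weightedMedian (l : List (ℝ × ℝ)) : Timed ℝ := do
  tick l.length
  weightedSelect l.length ((l.map Prod.snd).sum / 2) l

/-!  The items to be sorted, and what the answers of the decision algorithm say about them. -/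

/-- An item `λ ↦ slope * λ + intercept` depending on the parameter `λ`. -/
structure Item where
  slope : ℝ
  intercept : ℝ

def Item.eval (p : Item) (lam : ℝ) : ℝ := p.slope * lam + p.intercept

/-- The parameter value at which two items with different slopes are equal. -/
noncomputable def Item.root (p q : Item) : ℝ :=
  (q.intercept - p.intercept) / (p.slope - q.slope)

/-- The optimum is known to lie strictly between `lo` and `hi`. -/
structure Window where
  lo : EReal
  hi : EReal

section Search

variable {n : ℕ} (x : Fin n → Item)

/-- The comparison of items `i` and `j` is resolved: it does not depend on the parameter, or its
root is known to lie on one side of the optimum. -/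
def Window.Resolved (W : Window) (i j : Fin n) : Prop :=
  (x i).slope = (x j).slope ∨
    (((x i).root (x j) : ℝ) : EReal) ≤ W.lo ∨ W.hi ≤ (((x i).root (x j) : ℝ) : EReal)

/-- The outcome "`i` comes before `j`" of a resolved comparison; identical items are ordered by
their indices. -/
def Window.Before (W : Window) (i j : Fin n) : Prop :=
  if (x i).slope = (x j).slope then
    (x i).intercept < (x j).intercept ∨ ((x i).intercept = (x j).intercept ∧ i < j)
  else if (((x i).root (x j) : ℝ) : EReal) ≤ W.lo then (x i).slope < (x j).slope
  else (x j).slope < (x i).slope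

/-- All unordered pairs of entries of a list. -/
def allPairs : List (Fin n) → List (Fin n × Fin n)
  | [] => []
  | a :: l => l.map (fun b => (a, b)) ++ allPairs l

open Classical in
/-- The comparisons of a list that are not resolved. -/
noncomputable def unresolved (W : Window) (ps : List (Fin n × Fin n)) :
    Timed (List (Fin n × Fin n)) := do
  tick (ps.length + 1)
  pure (ps.filter fun p => ¬ W.Resolved x p.1 p.2)

/-!  Routing trees and active calls of boxsort. -/

/-- A binary search tree of marked items; its leaves are the numbers of the boxes. -/
inductive RoutingTree (n : ℕ) where
  | leaf (box : ℕ)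
  | node (left : RoutingTree n) (pivot : Fin n) (right : RoutingTree n)

/-- The perfectly balanced search tree on a sorted list, with boxes numbered from `first` on. -/
def balancedTree (first : ℕ) (l : List (Fin n)) : RoutingTree n :=
  match h : l.drop (l.length / 2) with
  | [] => .leaf first
  | p :: r =>
    .node (balancedTree first (l.take (l.length / 2))) p
      (balancedTree (first + l.length / 2 + 1) r)
termination_by l.length
decreasing_by
  all_goals
    have h1 := congrArg List.length h
    simp at h1 ⊢
    omega

/-- An active routing comparison: `item` against `pivot`, with its weight and the two subtrees in
one of which the routing goes on. -/
structure Probe (n : ℕ) where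
  item : Fin n
  weight : ℝ
  left : RoutingTree n
  pivot : Fin n
  right : RoutingTree n

/-- A recursive call of boxsort that has active comparisons.

* `base w pending`: base case, sorting by comparing all pairs; `pending` are the active
  comparisons, each of weight `w`.
* `sorting w items marked pending`: the marked items are being sorted by comparing all pairs;
  `pending` are the active comparisons, each of weight `w`.
* `routing w size numMarked pending settled`: the unmarked items are being routed through the tree
  of the marked ones; `settled` are the unmarked items whose box is known, with that box. -/
inductive Call (n : ℕ) where
  | base (w : ℝ) (pending : List (Fin n × Fin n))
  | sorting (w : ℝ) (items marked : List (Fin n)) (pending : List (Fin n × Fin n))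
  | routing (w : ℝ) (size numMarked : ℕ) (pending : List (Probe n)) (settled : List (Fin n × ℕ))

/-- The active comparisons of a call, as pairs (root, weight). -/
noncomputable def Call.active : Call n → List (ℝ × ℝ)
  | .base w pending => pending.map fun p => ((x p.1).root (x p.2), w)
  | .sorting w _ _ pending => pending.map fun p => ((x p.1).root (x p.2), w)
  | .routing _ _ _ pending _ => pending.map fun p => ((x p.item).root (x p.pivot), p.weight)

/-!  Weights. -/

/-- The weight rule: a resolved comparison of weight `w` that makes `m` comparisons active gives
the weight `w / (2 * m)` to each of them. -/
noncomputable def share (w m : ℝ) : ℝ := w / (2 * m)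

/-- Weight `w / (2 * m ^ 2)` of the first routing comparisons in a call of size `m` whose initial
comparisons have weight `w`: a virtual binary tree of height `log m` turns `w` into `w / m`, and
its root shares its weight among `m` comparisons. -/
noncomputable def routingWeight (w m : ℝ) : ℝ := share (w / m) m

/-- Weight `w / (4 * m ^ 4.5)` of the initial comparisons in the subproblems of such a call: a path
of length `log √m` in the routing tree, a virtual binary tree of height `log m`, and again
sharing among `m` comparisons. -/
noncomputable def boxWeight (w m : ℝ) : ℝ := share (routingWeight w m / √m / m) m

/-!  The simulation. -/

open Classical in
/-- Route item `i` down a tree, starting with weight `w`, as long as the comparisons met are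
resolved.  A resolved routing comparison activates one comparison, which gets half its weight. -/
noncomputable def walk (W : Window) (i : Fin n) : RoutingTree n → ℝ → Timed (ℕ ⊕ Probe n)
  | .leaf c, _ => do
    tick 1
    pure (.inl c)
  | .node l p r, w => do
    tick 1
    if W.Resolved x i p then
      if W.Before x i p then walk W i l (share w 1) else walk W i r (share w 1)
    else
      pure (.inr ⟨i, w, l, p, r⟩)

/-- Route several items; the result lists the active comparisons and the settled items. -/
noncomputable def walkAll (W : Window) :
    List (Fin n × RoutingTree n × ℝ) → Timed (List (Probe n) × List (Fin n × ℕ))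
  | [] => pure ([], [])
  | (i, t, w) :: l => do
    let r ← walk x W i t w
    let rs ← walkAll W l
    tick 1
    match r with
    | .inl c => pure (rs.1, (i, c) :: rs.2)
    | .inr p => pure (p :: rs.1, rs.2)

/-- Continue the routing phase of a call.  When the last item is settled, the unmarked items are
split into boxes (by one distribution pass), and `recurse` is started on each box. -/
noncomputable def route (W : Window) (recurse : ℝ → List (Fin n) → Timed (List (Call n)))
    (w : ℝ) (size numMarked : ℕ) (todo : List (Fin n × RoutingTree n × ℝ))
    (settled : List (Fin n × ℕ)) : Timed (List (Call n)) := do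
  tick 1
  let r ← walkAll x W todo
  tick r.2.length
  let settled := r.2 ++ settled
  if r.1.isEmpty then
    tick (size + numMarked + 1)
    let boxes := (List.range (numMarked + 1)).map fun c =>
      (settled.filter fun s => s.2 = c).map Prod.fst
    collect (recurse (boxWeight w size)) boxes
  else
    pure [.routing w size numMarked r.1 settled]

open Classical in
/-- Start the routing phase of a call, all comparisons between marked items being resolved. -/
noncomputable def startRouting (W : Window)
    (recurse : ℝ → List (Fin n) → Timed (List (Call n)))
    (w : ℝ) (items marked : List (Fin n)) : Timed (List (Call n)) := do
  tick (2 * marked.length ^ 2 + items.length + 1)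
  let tree := balancedTree 0 (marked.insertionSort (W.Before x))
  let todo := (items.filter fun i => i ∉ marked).map fun i =>
    (i, tree, routingWeight w items.length)
  route x W recurse w items.length marked.length todo []

/-- The random choices: for every set `S` of items on which boxsort may be called, the set of
`⌊√|S|⌋` items of `S` to be marked. -/
abbrev Marking (n : ℕ) : Type :=
  (S : Finset (Fin n)) → ↥(S.powersetCard (Nat.sqrt S.card))

/-- Start boxsort on a list of items whose initial comparisons get weight `w`; the result lists the
calls with active comparisons.  Comparisons that are already resolved when they become active
take effect at once.  The natural number bounds the recursion depth; the number of items is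
enough, because every box is smaller than the list it comes from. -/
noncomputable def spawn (mark : Marking n) (W : Window) :
    ℕ → ℝ → List (Fin n) → Timed (List (Call n))
  | 0, _, _ => do
    tick 1
    pure []
  | f + 1, w, items => do
    tick (items.length + 1)
    if (items.length : ℝ) < Real.logb 2 n then
      let pending ← unresolved x W (allPairs items)
      if pending.isEmpty then pure [] else pure [.base w pending]
    else
      let marked := items.filter fun i => i ∈ (mark items.toFinset).1
      let pending ← unresolved x W (allPairs marked)
      if pending.isEmpty then
        startRouting x W (spawn mark W f) w items marked
      else
        pure [.sorting w items marked pending]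

/-- Resolve all comparisons of a call that a new window resolves, and activate their successors. -/
noncomputable def Call.advance (mark : Marking n) (W : Window) : Call n → Timed (List (Call n))
  | .base w pending => do
    let pending' ← unresolved x W pending
    if pending'.isEmpty then pure [] else pure [.base w pending']
  | .sorting w items marked pending => do
    let pending' ← unresolved x W pending
    if pending'.isEmpty then
      startRouting x W (spawn x mark W items.length) w items marked
    else
      pure [.sorting w items marked pending']
  | .routing w size numMarked pending settled =>
    route x W (spawn x mark W size) w size numMarked
      (pending.map fun p => (p.item, .node p.left p.pivot p.right, p.weight)) settled

/-- Result of a search: the optimum, if it was found, and the number of calls to the decision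
algorithm. -/
structure Outcome where
  answer : Option ℝ
  queries : ℕ

/-- The turns of the search: find the weighted median of the roots of the active comparisons, pass
it to the decision algorithm, and resolve all comparisons whose outcome follows.  `decideAt r`
tells whether `r` is less than, equal to, or greater than the optimum. -/
noncomputable def turns (decideAt : ℝ → Timed Ordering) (mark : Marking n) :
    ℕ → Window → List (Call n) → Timed Outcome
  | 0, _, _ => pure ⟨none, 0⟩
  | f + 1, W, calls => do
    let act := calls.flatMap (Call.active x)
    tick (calls.length + act.length + 1)
    if act.isEmpty then
      pure ⟨none, 0⟩
    else
      let r ← weightedMedian act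
      let ans ← decideAt r
      match ans with
      | .eq => pure ⟨some r, 1⟩
      | .lt =>
        let W' : Window := ⟨(r : EReal), W.hi⟩
        let calls' ← collect (Call.advance x mark W') calls
        let out ← turns decideAt mark f W' calls'
        pure ⟨out.answer, out.queries + 1⟩
      | .gt =>
        let W' : Window := ⟨W.lo, (r : EReal)⟩
        let calls' ← collect (Call.advance x mark W') calls
        let out ← turns decideAt mark f W' calls'
        pure ⟨out.answer, out.queries + 1⟩

/-- The boxsort-driven parametric search.  Every turn resolves a new pair of items, so that `n * n`
turns are always enough. -/
noncomputable def parametricSearch (decideAt : ℝ → Timed Ordering) (mark : Marking n) :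
    Timed Outcome := do
  let W : Window := ⟨⊥, ⊤⟩
  tick (n + 1)
  let calls ← spawn x mark W n 1 (List.finRange n)
  turns x decideAt mark (n * n) W calls

/-- `B` is a decision problem on the real parameter that is monotone with optimum `opt`, and that
is driven by sorting: its answer depends only on the order of the items at that parameter. -/
structure IsSortingProblem (B : ℝ → Prop) (opt : ℝ) : Prop where
  true_below : ∀ lam, lam < opt → B lam
  false_above : ∀ lam, opt < lam → ¬ B lam
  order_decides : ∀ lam mu : ℝ,
    (∀ i j, (x i).eval lam < (x j).eval lam ↔ (x i).eval mu < (x j).eval mu) → (B lam ↔ B mu)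

/-- `decideAt` is a decision algorithm for the optimum `opt` with running time at most `c`. -/
structure IsDecisionAlgorithm (decideAt : ℝ → Timed Ordering) (opt : ℝ) (c : ℕ) : Prop where
  correct : ∀ lam, (decideAt lam).val = cmp lam opt
  time_le : ∀ lam, (decideAt lam).steps ≤ c

open Classical in
/-- Probability of an event when all random choices are uniform and independent. -/
noncomputable def markingProb (n : ℕ) (E : Marking n → Prop) : ℝ :=
  ((Finset.univ.filter E).card : ℝ) / (Fintype.card (Marking n) : ℝ)

end Search

/-!
The search finds the optimum because the order of the items changes there.  The decision problem is
driven by sorting, so that two items with different slopes are equal at the optimum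
(`IsSortingProblem.conflict_univ`).  Their comparison is never resolved by a query at another
parameter, and their routing never separates them (`Conflict.exists_box`); hence there is an active
comparison until the optimum itself is queried.

*Queries.*  In every turn, half of the active weight is resolved, and a resolved comparison passes on
at most half of its weight, so that the active weight drops by a quarter
(`collect_advance_produces`).  Conversely an active comparison cannot be too light.  A call on `m`
items divides the weight by at most `m ^ 7`, so that a comparison of an item whose path in the
recursion goes through calls of sizes `m₁, m₂, …` has weight at least `1 / (m₁ * m₂ * ⋯) ^ 7`.  The
number of queries is therefore logarithmic as soon as the product of the sizes on every path
(`pathProduct`) is polynomial in `n`.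

*Time.*  Work on calls is paid by a potential (`spawnCost`) in which every item contributes the
logarithms of the sizes of the calls on its path, which is again `O(log n)` per item if the path
products are polynomial.  What remains is a pass over the active comparisons in every turn, including
the selection of the median in linear time (`weightedMedian_spec`).  Sorting and routing calls have
no more active comparisons than items, but base cases may have quadratically many in their size, so
the unresolved pairs in the base cases that have been reached must be counted (`basePairs`).

*Probability.*  Path products are polynomial with high probability, because a random sample of `√m`
items leaves boxes whose sizes are `O(√m)` in all moments (`expect_choose_card_box_le`), so that the
expected path product is polynomial (`expect_pathProduct_le`), and Markov's inequality applies.  For the base cases, fix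
a window.  Which pairs are resolved depends on the window alone, and if all comparisons needed for
sorting the marked items and for routing are resolved, then the boxes contain few unresolved pairs:
an unresolved pair inside a box, added to the marked items, can be recognized in the enlarged set
(`sum_unrelatedPairs_box_le`).  So a call that continues to its boxes has in expectation at most twice
as many unresolved pairs as items, and an exponential moment bound along the recursion
(`expect_exp_basePairs_le`) gives concentration.  The window of an actual run depends on the random
choices, but its endpoints are roots, so that there are only `O(n ^ 4)` windows, and a union bound
over all of them (`exists_whp_bounds`) makes the adaptive choice of the queries harmless.
-/

/-! ### Step counting and the weighted median -/

namespace Timed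

@[simp] lemma pure_val {α : Type} (a : α) : (pure a : Timed α).val = a := rfl
@[simp] lemma pure_steps {α : Type} (a : α) : (pure a : Timed α).steps = 0 := rfl
@[simp] lemma bind_val {α β : Type} (s : Timed α) (f : α → Timed β) :
    (s >>= f).val = (f s.val).val := rfl
@[simp] lemma bind_steps {α β : Type} (s : Timed α) (f : α → Timed β) :
    (s >>= f).steps = s.steps + (f s.val).steps := rfl
@[simp] lemma tick_steps (k : ℕ) : (tick k).steps = k := rfl

end Timed

lemma groupMedian_mem {g : List ℝ} (h : g ≠ []) : groupMedian g ∈ g := by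
  have hl : g.length / 2 < (g.insertionSort (· ≤ ·)).length := by
    rw [List.length_insertionSort]
    have := List.length_pos_iff.2 h
    omega
  rw [groupMedian, List.getD_eq_getElem _ _ hl]
  exact (List.perm_insertionSort (· ≤ ·) g).subset (List.getElem_mem hl)

/-- A group of five numbers has three entries on each weak side of its median. -/
lemma three_le_length_filter_of_groupMedian {g : List ℝ} (h : g.length = 5) (p : ℝ) :
    (groupMedian g ≤ p → 3 ≤ (g.filter fun a => a ≤ p).length) ∧
      (p ≤ groupMedian g → 3 ≤ (g.filter fun a => p ≤ a).length) := by
  have hperm := List.perm_insertionSort (· ≤ ·) g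
  have hs := List.pairwise_insertionSort (· ≤ ·) g
  unfold groupMedian
  rw [← (hperm.filter _).length_eq, ← (hperm.filter _).length_eq]
  rw [h]
  have hl : (g.insertionSort (· ≤ ·)).length = 5 := by rw [List.length_insertionSort, h]
  generalize g.insertionSort (· ≤ ·) = s at hs hl
  match s, hl with
  | [a, b, c, d, e], _ =>
    simp only [List.pairwise_cons, List.mem_cons, forall_eq_or_imp] at hs
    constructor
    · intro hc
      have hc' : c ≤ p := hc
      have ha : a ≤ p := hs.1.2.1.trans hc'
      have hb : b ≤ p := hs.2.1.1.trans hc'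
      simp [List.filter_cons, ha, hb, hc']
    · intro hc
      have hc' : p ≤ c := hc
      have hd : p ≤ d := hc'.trans hs.2.2.1.1
      have he : p ≤ e := hc'.trans hs.2.2.1.2.1
      simp only [List.filter_cons, hc', hd, he, decide_true, if_true, List.filter_nil]
      split_ifs <;> simp

lemma length_groupsOfFive : ∀ l : List ℝ, (groupsOfFive l).length = (l.length + 4) / 5
  | [] => by simp [groupsOfFive]
  | [_] => by simp [groupsOfFive]
  | [_, _] => by simp [groupsOfFive]
  | [_, _, _] => by simp [groupsOfFive]
  | [_, _, _, _] => by simp [groupsOfFive]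
  | a :: b :: c :: d :: e :: l => by
    simp only [groupsOfFive, List.length_cons, length_groupsOfFive l]
    omega

lemma length_filter_lt_add_le {α : Type} (f : α → ℝ) (p : ℝ) (l : List α) :
    (l.filter fun a => f a < p).length + (l.filter fun a => p ≤ f a).length = l.length := by
  induction l with
  | nil => rfl
  | cons a l ih =>
    rcases lt_or_ge (f a) p with h | h
    · rw [List.filter_cons_of_pos (by simpa using h), List.filter_cons_of_neg (by simpa using h),
        List.length_cons, List.length_cons]
      omega
    · rw [List.filter_cons_of_neg (by simpa using h), List.filter_cons_of_pos (by simpa using h),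
        List.length_cons, List.length_cons]
      omega

lemma length_filter_gt_add_le {α : Type} (f : α → ℝ) (p : ℝ) (l : List α) :
    (l.filter fun a => p < f a).length + (l.filter fun a => f a ≤ p).length = l.length := by
  have := length_filter_lt_add_le (fun a => - f a) (-p) l
  simpa using this

/-- The recurrence for the cost of selection: the median of `⌈m / 5⌉` group medians is selected
first, and then an entry among at most `7 m / 10 + 2`.  The cubic bound serves the small `m`,
where the two parts are not yet smaller than `m` by a constant factor. -/
lemma select_cost {m u t k : ℕ} (hm : 2 ≤ m) (hu : u ≤ 12544 * ((m + 4) / 5))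
    (hu' : u ≤ 4 * ((m + 4) / 5) ^ 3) (h1 : 10 * k ≤ 7 * m + 20) (h2 : k < m)
    (h3 : t ≤ 12544 * k) (h4 : t ≤ 4 * k ^ 3) :
    m + (u + (m + t)) ≤ 12544 * m ∧ m + (u + (m + t)) ≤ 4 * m ^ 3 := by
  by_cases h56 : 56 ≤ m
  · have hlin : m + (u + (m + t)) ≤ 12544 * m := by omega
    refine ⟨hlin, hlin.trans ?_⟩
    have : 56 ^ 2 ≤ m ^ 2 := Nat.pow_le_pow_left h56 2
    calc 12544 * m = 4 * (56 ^ 2 * m) := by ring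
      _ ≤ 4 * (m ^ 2 * m) := by gcongr
      _ = 4 * m ^ 3 := by ring
  · have hcub : m + (u + (m + t)) ≤ 4 * m ^ 3 := by
      obtain ⟨j, rfl⟩ : ∃ j, m = j + 1 := ⟨m - 1, by omega⟩
      have hk : k ^ 3 ≤ j ^ 3 := Nat.pow_le_pow_left (by omega) 3
      have hg : ((j + 1 + 4) / 5) ^ 3 ≤ j ^ 2 + 2 * j := by
        have hj : j < 56 := by omega
        have hj1 : 1 ≤ j := by omega
        clear * - hj hj1
        interval_cases j <;> norm_num
      have hexp : 4 * (j + 1) ^ 3 = 4 * j ^ 3 + 12 * j ^ 2 + 12 * j + 4 := by ring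
      rw [hexp]
      omega
    refine ⟨hcub.trans ?_, hcub⟩
    have : m ^ 2 ≤ 56 ^ 2 := Nat.pow_le_pow_left (by omega) 2
    calc 4 * m ^ 3 = 4 * (m ^ 2 * m) := by ring
      _ ≤ 4 * (56 ^ 2 * m) := by gcongr
      _ = 12544 * m := by ring

/-- The groups whose median lies weakly on one side of `p` contain, up to the short last group,
three times as many entries on that side. -/
lemma length_filter_medians_le (p : ℝ) : ∀ l : List ℝ,
    3 * (((groupsOfFive l).map groupMedian).filter fun a => a ≤ p).length
        ≤ (l.filter fun a => a ≤ p).length + 2 ∧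
      3 * (((groupsOfFive l).map groupMedian).filter fun a => p ≤ a).length
        ≤ (l.filter fun a => p ≤ a).length + 2
  | [] => by simp [groupsOfFive]
  | a :: b :: c :: d :: e :: l => by
    have ih := length_filter_medians_le p l
    have h5 := three_le_length_filter_of_groupMedian (g := [a, b, c, d, e]) rfl p
    have hsplit : a :: b :: c :: d :: e :: l = [a, b, c, d, e] ++ l := rfl
    rw [hsplit, List.filter_append, List.length_append, List.filter_append, List.length_append]
    have hg : groupsOfFive ([a, b, c, d, e] ++ l) = [a, b, c, d, e] :: groupsOfFive l := rfl
    rw [hg, List.map_cons]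
    constructor
    · by_cases hm : groupMedian [a, b, c, d, e] ≤ p
      · rw [List.filter_cons_of_pos (by simpa using hm), List.length_cons]
        have := h5.1 hm
        omega
      · rw [List.filter_cons_of_neg (by simpa using hm)]
        omega
    · by_cases hm : p ≤ groupMedian [a, b, c, d, e]
      · rw [List.filter_cons_of_pos (by simpa using hm), List.length_cons]
        have := h5.2 hm
        omega
      · rw [List.filter_cons_of_neg (by simpa using hm)]
        omega
  | [a] => shortGroup [a] (by simp) rfl
  | [a, b] => shortGroup [a, b] (by simp) rfl
  | [a, b, c] => shortGroup [a, b, c] (by simp) rfl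
  | [a, b, c, d] => shortGroup [a, b, c, d] (by simp) rfl
where
  shortGroup (l : List ℝ) (hl : l ≠ []) (hg : groupsOfFive l = [l]) :
      3 * (((groupsOfFive l).map groupMedian).filter fun a => a ≤ p).length
          ≤ (l.filter fun a => a ≤ p).length + 2 ∧
        3 * (((groupsOfFive l).map groupMedian).filter fun a => p ≤ a).length
          ≤ (l.filter fun a => p ≤ a).length + 2 := by
    have hm := groupMedian_mem hl
    rw [hg, List.map_cons, List.map_nil, List.filter_cons, List.filter_cons]
    constructor
    · split_ifs with h
      · have : 0 < (l.filter fun a => a ≤ p).length :=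
          List.length_pos_of_mem (List.mem_filter.2 ⟨hm, h⟩)
        simp only [List.filter_nil, List.length_cons, List.length_nil]
        omega
      · simp
    · split_ifs with h
      · have : 0 < (l.filter fun a => p ≤ a).length :=
          List.length_pos_of_mem (List.mem_filter.2 ⟨hm, h⟩)
        simp only [List.filter_nil, List.length_cons, List.length_nil]
        omega
      · simp

/-- The total weight of the pairs (value, weight) whose value satisfies `P`. -/
def weightOf (P : ℝ → Prop) [DecidablePred P] (l : List (ℝ × ℝ)) : ℝ :=
  ((l.filter fun a => P a.1).map Prod.snd).sum

lemma weightOf_cons (P : ℝ → Prop) [DecidablePred P] (a : ℝ × ℝ) (l : List (ℝ × ℝ)) :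
    weightOf P (a :: l) = (if P a.1 then a.2 else 0) + weightOf P l := by
  unfold weightOf
  rw [List.filter_cons]
  by_cases h : P a.1 <;> simp [h]

lemma weightOf_add_not (P : ℝ → Prop) [DecidablePred P] (l : List (ℝ × ℝ)) :
    weightOf P l + weightOf (fun r => ¬ P r) l = (l.map Prod.snd).sum := by
  induction l with
  | nil => simp [weightOf]
  | cons a l ih =>
    rw [weightOf_cons, weightOf_cons, List.map_cons, List.sum_cons, ← ih]
    by_cases h : P a.1 <;> simp [h] <;> ring

lemma weightOf_filter (P R : ℝ → Prop) [DecidablePred P] [DecidablePred R] (l : List (ℝ × ℝ)) :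
    weightOf P (l.filter fun a => R a.1) = weightOf (fun r => P r ∧ R r) l := by
  unfold weightOf
  rw [List.filter_filter]
  simp

lemma weightOf_congr {P R : ℝ → Prop} [DecidablePred P] [DecidablePred R] (h : ∀ r, P r ↔ R r)
    (l : List (ℝ × ℝ)) : weightOf P l = weightOf R l := by
  unfold weightOf
  simp [h]

lemma weightOf_or {P R : ℝ → Prop} [DecidablePred P] [DecidablePred R]
    (h : ∀ r, P r → ¬ R r) (l : List (ℝ × ℝ)) :
    weightOf (fun r => P r ∨ R r) l = weightOf P l + weightOf R l := by
  induction l with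
  | nil => simp [weightOf]
  | cons a l ih =>
    rw [weightOf_cons, weightOf_cons, weightOf_cons, ih]
    have := h a.1
    by_cases h1 : P a.1 <;> by_cases h2 : R a.1 <;> simp_all <;> ring

lemma weightOf_map_one (P : ℝ → Prop) [DecidablePred P] (l : List ℝ) :
    weightOf P (l.map fun r => (r, 1)) = ((l.filter fun r => P r).length : ℝ) := by
  induction l with
  | nil => simp [weightOf]
  | cons a l ih =>
    rw [List.map_cons, weightOf_cons, ih, List.filter_cons]
    by_cases h : P a <;> simp [h] ; ring

/-- Weighted selection returns the weighted quantile, and by the median-of-medians pivot rule it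
does so in linear time. -/
theorem weightedSelect_spec (f : ℕ) : ∀ (target : ℝ) (l : List (ℝ × ℝ)), l ≠ [] → l.length ≤ f →
    (∀ a ∈ l, 0 < a.2) → 0 < target → target ≤ (l.map Prod.snd).sum →
    (∃ a ∈ l, a.1 = (weightedSelect f target l).val) ∧
    target ≤ weightOf (fun r => r ≤ (weightedSelect f target l).val) l ∧
    weightOf (fun r => r < (weightedSelect f target l).val) l < target ∧
    (weightedSelect f target l).steps ≤ 12544 * l.length ∧
    (weightedSelect f target l).steps ≤ 4 * l.length ^ 3 := by
  induction f with
  | zero =>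
    intro target l hl hf
    exact absurd (List.length_eq_zero_iff.1 (Nat.le_zero.1 hf)) hl
  | succ f ih =>
    intro target l hl hf hw ht ht'
    match l, hl with
    | [a], _ =>
      simp only [weightedSelect, Timed.bind_val, Timed.pure_val, Timed.bind_steps, Timed.tick_steps,
        Timed.pure_steps]
      refine ⟨⟨a, by simp, rfl⟩, ?_, ?_, by simp, by simp⟩
      · simpa [weightOf] using ht'
      · simpa [weightOf] using ht
    | a :: b :: l', _ =>
      set l := a :: b :: l' with hldef
      have hm2 : 2 ≤ l.length := by simp [hldef]
      set md := (groupsOfFive (l.map Prod.fst)).map groupMedian with hmd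
      have hmdl : md.length = (l.length + 4) / 5 := by
        rw [hmd, List.length_map, length_groupsOfFive, List.length_map]
      have hmd0 : md ≠ [] := by
        intro h
        rw [h, List.length_nil] at hmdl
        omega
      have hmdpos : (0 : ℝ) < md.length := by
        exact_mod_cast List.length_pos_iff.2 hmd0
      obtain ⟨hp1, hp2, hp3, hp4, hp5⟩ := ih ((md.length : ℝ) / 2) (md.map fun r => (r, 1))
        (by simpa using hmd0) (by rw [List.length_map, hmdl]; omega) (by simp)
        (by positivity) (by simp [Function.comp_def])
      set sel := weightedSelect f ((md.length : ℝ) / 2) (md.map fun r => (r, 1)) with hsel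
      set p := sel.val with hp
      rw [List.length_map, hmdl] at hp4 hp5
      rw [weightOf_map_one] at hp2 hp3
      obtain ⟨hc1, hc2⟩ := length_filter_medians_le p (l.map Prod.fst)
      rw [← hmd] at hc1 hc2
      set below := l.filter fun a => a.1 < p with hbelow
      set above := l.filter fun a => p < a.1 with habove
      have hmdsplit := length_filter_lt_add_le (fun r => r) p md
      have hltl : below.length
          + ((l.map Prod.fst).filter fun r => p ≤ r).length = l.length := by
        rw [← length_filter_lt_add_le Prod.fst p l, List.filter_map, List.length_map]
        rfl
      have hgtl : above.length
          + ((l.map Prod.fst).filter fun r => r ≤ p).length = l.length := by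
        rw [← length_filter_gt_add_le Prod.fst p l, List.filter_map, List.length_map]
        rfl
      have hcnt1 : md.length ≤ 2 * (md.filter fun r => r ≤ p).length := by
        have : (md.length : ℝ) ≤ 2 * ((md.filter fun r => r ≤ p).length : ℝ) := by linarith
        exact_mod_cast this
      have hcnt2 : 2 * (md.filter fun r => r < p).length < md.length := by
        have : 2 * ((md.filter fun r => r < p).length : ℝ) < (md.length : ℝ) := by linarith
        exact_mod_cast this
      have hA : 10 * below.length ≤ 7 * l.length + 20 ∧ below.length < l.length := by
        constructor <;> omega
      have hB : 10 * above.length ≤ 7 * l.length + 20 ∧ above.length < l.length := by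
        constructor <;> omega
      have hple : weightOf (fun r => r ≤ p) l = weightOf (fun r => r < p) l
          + weightOf (fun r => r = p) l := by
        rw [← weightOf_or (fun r h1 h2 => by linarith)]
        exact weightOf_congr (fun r => le_iff_lt_or_eq) l
      have hwb : weightOf (fun r => r < p) l = (below.map Prod.snd).sum := rfl
      have hwu : weightOf (fun r => r ≤ p) l = ((l.filter fun a => a.1 ≤ p).map Prod.snd).sum := rfl
      have hwa : weightOf (fun r => ¬ r ≤ p) l = (above.map Prod.snd).sum := by
        rw [weightOf_congr (R := fun r => p < r) (fun r => not_le)]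
        rfl
      have htot := weightOf_add_not (fun r => r ≤ p) l
      have hcost := fun (t k : ℕ) => select_cost (t := t) (k := k) hm2 hp4 hp5
      have hrw : weightedSelect (f + 1) target l = (do
          tick l.length
          let p ← sel
          tick l.length
          if target ≤ ((l.filter fun a => a.1 < p).map Prod.snd).sum then
            weightedSelect f target (l.filter fun a => a.1 < p)
          else if target ≤ ((l.filter fun a => a.1 ≤ p).map Prod.snd).sum then
            pure p
          else
            weightedSelect f (target - ((l.filter fun a => a.1 ≤ p).map Prod.snd).sum)
              (l.filter fun a => p < a.1)) := by
        rw [hldef, hsel]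
        rfl
      rw [hrw]
      simp only [Timed.bind_val, Timed.bind_steps, Timed.tick_steps, ← hp, ← hbelow, ← habove]
      rw [← hwb, ← hwu]
      by_cases h1 : target ≤ weightOf (fun r => r < p) l
      · simp only [h1, if_true]
        have hb0 : below ≠ [] := by
          intro h
          rw [hwb, h] at h1
          simp at h1
          linarith
        obtain ⟨⟨q, hq1, hq2⟩, e2, e3, e4, e5⟩ := ih target below hb0 (by omega)
          (fun a ha => hw a (List.mem_of_mem_filter ha)) ht h1
        set r := (weightedSelect f target below).val with hr
        have hrp : r < p := by
          have := (List.mem_filter.1 hq1).2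
          rw [← hq2]
          simpa using this
        rw [hbelow, weightOf_filter (fun s => s ≤ r) (fun s => s < p)] at e2
        rw [hbelow, weightOf_filter (fun s => s < r) (fun s => s < p)] at e3
        rw [weightOf_congr (R := fun s => s ≤ r) (fun s => ⟨fun h => h.1, fun h => ⟨h, by linarith⟩⟩)]
          at e2
        rw [weightOf_congr (R := fun s => s < r) (fun s => ⟨fun h => h.1, fun h => ⟨h, by linarith⟩⟩)]
          at e3
        exact ⟨⟨q, List.mem_of_mem_filter hq1, hq2⟩, e2, e3, hcost _ _ hA.1 hA.2 e4 e5⟩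
      · simp only [h1, if_false]
        by_cases h2 : target ≤ weightOf (fun r => r ≤ p) l
        · simp only [h2, if_true, Timed.pure_val, Timed.pure_steps]
          refine ⟨?_, trivial, not_le.1 h1, hcost 0 0 (by omega) (by omega) (by omega) (by omega)⟩
          by_contra hno
          have : weightOf (fun r => r = p) l = 0 := by
            unfold weightOf
            rw [List.filter_eq_nil_iff.2]
            · rfl
            · intro a ha hap
              exact hno ⟨a, ha, by simpa using hap⟩
          linarith
        · simp only [h2, if_false]
          have ha0 : above ≠ [] := by
            intro h
            rw [h, List.map_nil, List.sum_nil] at hwa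
            linarith
          obtain ⟨⟨q, hq1, hq2⟩, e2, e3, e4, e5⟩ := ih (target - weightOf (fun r => r ≤ p) l) above
            ha0 (by omega) (fun a ha => hw a (List.mem_of_mem_filter ha)) (by linarith)
            (by linarith)
          set r := (weightedSelect f (target - weightOf (fun r => r ≤ p) l) above).val with hr
          have hrp : p < r := by
            have := (List.mem_filter.1 hq1).2
            rw [← hq2]
            simpa using this
          rw [habove, weightOf_filter (fun s => s ≤ r) (fun s => p < s)] at e2
          rw [habove, weightOf_filter (fun s => s < r) (fun s => p < s)] at e3
          have s1 : weightOf (fun s => s ≤ r) l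
              = weightOf (fun s => s ≤ p) l + weightOf (fun s => s ≤ r ∧ p < s) l := by
            rw [← weightOf_or (fun s h1 h2 => by linarith [h2.2])]
            refine weightOf_congr (fun s => ⟨fun h => ?_, fun h => ?_⟩) l
            · rcases le_or_gt s p with h' | h'
              · exact Or.inl h'
              · exact Or.inr ⟨h, h'⟩
            · rcases h with h | h
              · linarith
              · exact h.1
          have s2 : weightOf (fun s => s < r) l
              = weightOf (fun s => s ≤ p) l + weightOf (fun s => s < r ∧ p < s) l := by
            rw [← weightOf_or (fun s h1 h2 => by linarith [h2.2])]
            refine weightOf_congr (fun s => ⟨fun h => ?_, fun h => ?_⟩) l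
            · rcases le_or_gt s p with h' | h'
              · exact Or.inl h'
              · exact Or.inr ⟨h, h'⟩
            · rcases h with h | h
              · linarith
              · exact h.1
          exact ⟨⟨q, List.mem_of_mem_filter hq1, hq2⟩, by linarith, by linarith,
            hcost _ _ hB.1 hB.2 e4 e5⟩

/-- At least half of the weight lies weakly on each side of the weighted median, which is one of
the given values and is found in linear time. -/
theorem weightedMedian_spec {l : List (ℝ × ℝ)} (hl : l ≠ []) (hw : ∀ a ∈ l, 0 < a.2) :
    (∃ a ∈ l, a.1 = (weightedMedian l).val) ∧
    (l.map Prod.snd).sum / 2 ≤ weightOf (fun r => r ≤ (weightedMedian l).val) l ∧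
    (l.map Prod.snd).sum / 2 ≤ weightOf (fun r => (weightedMedian l).val ≤ r) l ∧
    (weightedMedian l).steps ≤ 12545 * l.length := by
  have hpos : 0 < (l.map Prod.snd).sum := by
    refine List.sum_pos _ (fun a ha => ?_) (by simpa using hl)
    obtain ⟨b, hb, rfl⟩ := List.mem_map.1 ha
    exact hw b hb
  obtain ⟨h1, h2, h3, h4, -⟩ := weightedSelect_spec l.length ((l.map Prod.snd).sum / 2) l hl le_rfl
    hw (by linarith) (by linarith)
  have hv : (weightedMedian l).val
      = (weightedSelect l.length ((l.map Prod.snd).sum / 2) l).val := rfl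
  have hs : (weightedMedian l).steps
      = l.length + (weightedSelect l.length ((l.map Prod.snd).sum / 2) l).steps := rfl
  rw [hv, hs]
  refine ⟨h1, h2, ?_, by omega⟩
  have := weightOf_add_not
    (fun r => r < (weightedSelect l.length ((l.map Prod.snd).sum / 2) l).val) l
  rw [weightOf_congr (fun r => not_lt)] at this
  linarith

/-! ### Boxes of a set of items cut by marked items -/

section Boxes

variable {n : ℕ} {κ : Type} [LinearOrder κ] (key : Fin n → κ)

/-- The number of the box of item `i`: how many marked items come before it. -/
def boxIndex (M : Finset (Fin n)) (i : Fin n) : ℕ := (M.filter fun p => key p < key i).card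

/-- The unmarked items of `S` in box number `c`. -/
def boxOf (S M : Finset (Fin n)) (c : ℕ) : Finset (Fin n) :=
  (S \ M).filter fun i => boxIndex key M i = c

/-- No marked item lies strictly between `i` and `p`. -/
def Adjacent (M : Finset (Fin n)) (i p : Fin n) : Prop :=
  ∀ q ∈ M, ¬ (key i < key q ∧ key q < key p) ∧ ¬ (key p < key q ∧ key q < key i)

variable {key}

lemma mem_boxOf {S M : Finset (Fin n)} {c : ℕ} {i : Fin n} :
    i ∈ boxOf key S M c ↔ i ∈ S ∧ i ∉ M ∧ boxIndex key M i = c := by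
  simp [boxOf, and_assoc]

lemma box_subset (S M : Finset (Fin n)) (c : ℕ) : boxOf key S M c ⊆ S := fun _ h =>
  (mem_boxOf.1 h).1

lemma boxIndex_le (M : Finset (Fin n)) (i : Fin n) : boxIndex key M i ≤ M.card :=
  Finset.card_filter_le _ _

lemma boxIndex_eq_iff {M : Finset (Fin n)} {i j : Fin n} :
    boxIndex key M i = boxIndex key M j ↔ ∀ p ∈ M, (key p < key i ↔ key p < key j) := by
  constructor
  · intro h
    have aux : ∀ a b : Fin n, key a ≤ key b → boxIndex key M a = boxIndex key M b →
        ∀ p ∈ M, (key p < key a ↔ key p < key b) := by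
      intro a b hab h p hp
      have hsub : (M.filter fun p => key p < key a) ⊆ M.filter fun p => key p < key b := by
        intro q hq
        rw [Finset.mem_filter] at hq ⊢
        exact ⟨hq.1, hq.2.trans_le hab⟩
      have := Finset.eq_of_subset_of_card_le hsub (le_of_eq h.symm)
      simpa [hp] using Finset.ext_iff.1 this p
    rcases le_total (key i) (key j) with hij | hij
    · exact aux i j hij h
    · exact fun p hp => (aux j i hij h.symm p hp).symm
  · intro h
    unfold boxIndex
    congr 1
    exact Finset.filter_congr h

lemma sum_card_box {S M : Finset (Fin n)} :
    ∑ c ∈ Finset.range (M.card + 1), (boxOf key S M c).card = (S \ M).card :=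
  (Finset.card_eq_sum_card_fiberwise fun i _ => by
    simpa [Nat.lt_succ_iff] using boxIndex_le M i).symm

lemma card_box_add_card_le {S M : Finset (Fin n)} (hM : M ⊆ S) (c : ℕ) :
    (boxOf key S M c).card + M.card ≤ S.card := by
  have h1 : (boxOf key S M c).card ≤ (S \ M).card := Finset.card_filter_le _ _
  have h2 := Finset.card_sdiff_add_card_eq_card hM
  omega

lemma disjoint_box {S M : Finset (Fin n)} {c d : ℕ} (h : c ≠ d) :
    Disjoint (boxOf key S M c) (boxOf key S M d) :=
  Finset.disjoint_left.2 fun _ h1 h2 => h ((mem_boxOf.1 h1).2.2.symm.trans (mem_boxOf.1 h2).2.2)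

/-- Summing over boxes a quantity weighted by their sizes is summing over unmarked items. -/
lemma sum_box_mul {S M : Finset (Fin n)} (f : Finset (Fin n) → ℝ) :
    ∑ c ∈ Finset.range (M.card + 1), (boxOf key S M c).card * f (boxOf key S M c)
      = ∑ e ∈ S \ M, f (boxOf key S M (boxIndex key M e)) := by
  rw [← Finset.sum_fiberwise_of_maps_to (s := S \ M) (t := Finset.range (M.card + 1))
    (g := boxIndex key M) (fun i _ => by simpa [Nat.lt_succ_iff] using boxIndex_le M i)]
  refine Finset.sum_congr rfl fun c _ => ?_
  rw [Finset.sum_congr rfl (g := fun _ => f (boxOf key S M c))]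
  · rw [Finset.sum_const, nsmul_eq_mul, boxOf]
  · intro i hi
    rw [(Finset.mem_filter.1 hi).2]

/-! ### Two counting lemmas for random marked sets -/

/-- Two subsets of a chain that are closed upwards in it and have the same size are equal. -/
lemma eq_of_card_eq_of_upper {κ : Type} [LinearOrder κ] {key : Fin n → κ}
    {U A A' : Finset (Fin n)} (hA : A ⊆ U) (hA' : A' ⊆ U) (hcard : A.card = A'.card)
    (h : ∀ a ∈ A, ∀ u ∈ U, key a < key u → u ∈ A) (h' : ∀ a ∈ A', ∀ u ∈ U, key a < key u → u ∈ A')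
    (hinj : Function.Injective key) : A = A' := by
  by_cases hs : A ⊆ A'
  · exact Finset.eq_of_subset_of_card_le hs hcard.ge
  · obtain ⟨a, ha, ha'⟩ := Finset.not_subset.1 hs
    refine (Finset.eq_of_subset_of_card_le (fun b hb => ?_) hcard.le).symm
    rcases lt_trichotomy (key a) (key b) with hab | hab | hab
    · exact h a ha b (hA' hb) hab
    · exact hinj hab ▸ ha
    · exact absurd (h' b hb a (hA ha) hab) ha'

/-- Moments of the size of the box of a given item `e`, for a random marked set `M` of size `s`:
a set `M` and `k` items `T` of the box of `e` are determined by `M ∪ T` and the number of items of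
`T` before `e`, because no item of `M` separates `e` from `T`. -/
lemma sum_choose_card_box_le (hinj : Function.Injective key) (S : Finset (Fin n)) (s k : ℕ)
    (e : Fin n) :
    ∑ M ∈ S.powersetCard s, (boxOf key S M (boxIndex key M e)).card.choose k
      ≤ (k + 1) * S.card.choose (s + k) := by
  set D := (S.powersetCard s).sigma fun M => (boxOf key S M (boxIndex key M e)).powersetCard k
    with hD
  have hcard : ∑ M ∈ S.powersetCard s, (boxOf key S M (boxIndex key M e)).card.choose k = D.card := by
    rw [hD, Finset.card_sigma]
    simp
  have htarget : (S.powersetCard (s + k) ×ˢ Finset.range (k + 1)).card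
      = (k + 1) * S.card.choose (s + k) := by
    rw [Finset.card_product, Finset.card_powersetCard, Finset.card_range, mul_comm]
  rw [hcard, ← htarget]
  have hmem : ∀ a ∈ D, a.1 ⊆ S ∧ a.1.card = s ∧ a.2 ⊆ boxOf key S a.1 (boxIndex key a.1 e) ∧
      a.2.card = k ∧ Disjoint a.1 a.2 := by
    intro a ha
    rw [hD, Finset.mem_sigma, Finset.mem_powersetCard, Finset.mem_powersetCard] at ha
    refine ⟨ha.1.1, ha.1.2, ha.2.1, ha.2.2, ?_⟩
    rw [Finset.disjoint_right]
    exact fun i hi => (mem_boxOf.1 (ha.2.1 hi)).2.1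
  -- the items of `T` on either side of `e` are the nearest ones of `M ∪ T`
  have hlow : ∀ a ∈ D, ∀ t ∈ a.2.filter (fun t => key t < key e),
      ∀ u ∈ (a.1 ∪ a.2).filter (fun t => key t < key e), key t < key u →
        u ∈ a.2.filter (fun t => key t < key e) := by
    intro a ha t ht u hu htu
    rw [Finset.mem_filter] at ht hu ⊢
    refine ⟨(Finset.mem_union.1 hu.1).resolve_left fun huM => ?_, hu.2⟩
    have h2 := (mem_boxOf.1 ((hmem a ha).2.2.1 ht.1)).2.2
    exact lt_asymm htu ((boxIndex_eq_iff.1 h2 u huM).2 hu.2)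
  have hhigh : ∀ a ∈ D, ∀ t ∈ a.2.filter (fun t => ¬ key t < key e),
      ∀ u ∈ (a.1 ∪ a.2).filter (fun t => ¬ key t < key e),
        OrderDual.toDual (key t) < OrderDual.toDual (key u) →
        u ∈ a.2.filter (fun t => ¬ key t < key e) := by
    intro a ha t ht u hu htu
    rw [Finset.mem_filter] at ht hu ⊢
    refine ⟨(Finset.mem_union.1 hu.1).resolve_left fun huM => ?_, hu.2⟩
    have h2 := (mem_boxOf.1 ((hmem a ha).2.2.1 ht.1)).2.2
    exact hu.2 ((boxIndex_eq_iff.1 h2 u huM).1 htu)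
  refine Finset.card_le_card_of_injOn
    (fun a => (a.1 ∪ a.2, (a.2.filter fun t => key t < key e).card)) ?_ ?_
  · intro a ha
    obtain ⟨h1, h2, h3, h4, h5⟩ := hmem a ha
    simp only [Finset.coe_product, Set.mem_prod, Finset.mem_coe, Finset.mem_powersetCard,
      Finset.mem_range]
    refine ⟨⟨Finset.union_subset h1 (h3.trans (box_subset _ _ _)), ?_⟩, ?_⟩
    · rw [Finset.card_union_of_disjoint h5, h2, h4]
    · rw [Nat.lt_succ_iff, ← h4]
      exact Finset.card_filter_le _ _
  · intro a ha b hb hab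
    simp only [Prod.mk.injEq] at hab
    obtain ⟨hU, hc⟩ := hab
    obtain ⟨-, -, -, hak, had⟩ := hmem a ha
    obtain ⟨-, -, -, hbk, hbd⟩ := hmem b hb
    have e1 : a.2.filter (fun t => key t < key e) = b.2.filter (fun t => key t < key e) := by
      refine eq_of_card_eq_of_upper (key := key)
        (U := (a.1 ∪ a.2).filter (fun t => key t < key e)) ?_ ?_ hc (hlow a ha) ?_ hinj
      · exact Finset.filter_subset_filter _ Finset.subset_union_right
      · rw [hU]
        exact Finset.filter_subset_filter _ Finset.subset_union_right
      · rw [hU]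
        exact hlow b hb
    have hc' : (a.2.filter fun t => ¬ key t < key e).card
        = (b.2.filter fun t => ¬ key t < key e).card := by
      have h1 := Finset.card_filter_add_card_filter_not (s := a.2) (fun t => key t < key e)
      have h2 := Finset.card_filter_add_card_filter_not (s := b.2) (fun t => key t < key e)
      omega
    have e2 : a.2.filter (fun t => ¬ key t < key e) = b.2.filter (fun t => ¬ key t < key e) := by
      refine eq_of_card_eq_of_upper (key := fun i => OrderDual.toDual (key i))
        (U := (a.1 ∪ a.2).filter (fun t => ¬ key t < key e)) ?_ ?_ hc' (hhigh a ha) ?_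
        (OrderDual.toDual.injective.comp hinj)
      · exact Finset.filter_subset_filter _ Finset.subset_union_right
      · rw [hU]
        exact Finset.filter_subset_filter _ Finset.subset_union_right
      · rw [hU]
        exact hhigh b hb
    have hT : a.2 = b.2 := by
      rw [← Finset.filter_union_filter_not_eq (fun t => key t < key e) a.2,
        ← Finset.filter_union_filter_not_eq (fun t => key t < key e) b.2, e1, e2]
    have hM : a.1 = b.1 := by
      rw [← Finset.union_sdiff_cancel_right had, ← Finset.union_sdiff_cancel_right hbd, hU, hT]
    exact Sigma.ext hM (heq_of_eq hT)

variable (key)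

open Classical in
/-- The ordered pairs of distinct items of `S` that are not related by `res` ("resolved"). -/
noncomputable def unrelatedPairs (res : Fin n → Fin n → Prop) (S : Finset (Fin n)) :
    Finset (Fin n × Fin n) :=
  (S ×ˢ S).filter fun p => p.1 ≠ p.2 ∧ ¬ res p.1 p.2

/-- All comparisons needed to sort the marked items `M` of `S` and to find the boxes of the other
items are resolved. -/
def RoutingDone (res : Fin n → Fin n → Prop) (S M : Finset (Fin n)) : Prop :=
  (∀ p ∈ M, ∀ q ∈ M, p ≠ q → res p q) ∧ ∀ i ∈ S \ M, ∀ p ∈ M, Adjacent key M i p → res i p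

variable {key}

open Classical in
lemma card_unrelatedPairs_le (res : Fin n → Fin n → Prop) (S : Finset (Fin n)) :
    (unrelatedPairs res S).card ≤ S.card ^ 2 := by
  rw [sq, ← Finset.card_product, unrelatedPairs]
  exact Finset.card_filter_le _ _

open Classical in
/-- For a random marked set, the unresolved pairs inside boxes are few on the event that the
routing is done: adding such a pair to the marked set makes it the only unresolved pair of marked
items with no marked item in between, so that it can be recovered. -/
lemma sum_unrelatedPairs_box_le (res : Fin n → Fin n → Prop)
    (hsymm : ∀ i j, res i j → res j i) (S : Finset (Fin n)) (s : ℕ) :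
    ∑ M ∈ S.powersetCard s, (if RoutingDone key res S M then
        ∑ c ∈ Finset.range (s + 1), (unrelatedPairs res (boxOf key S M c)).card else 0)
      ≤ 2 * S.card.choose (s + 2) := by
  set D := ((S.powersetCard s).filter fun M => RoutingDone key res S M).sigma fun M =>
    (Finset.range (s + 1)).biUnion fun c => unrelatedPairs res (boxOf key S M c) with hD
  have hpair : ∀ (M : Finset (Fin n)) (c : ℕ) (p : Fin n × Fin n),
      p ∈ unrelatedPairs res (boxOf key S M c) → p.1 ∈ boxOf key S M c ∧ p.2 ∈ boxOf key S M c ∧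
        p.1 ≠ p.2 ∧ ¬ res p.1 p.2 := by
    intro M c p hp
    simpa [unrelatedPairs, and_assoc] using hp
  have hcard : ∑ M ∈ S.powersetCard s, (if RoutingDone key res S M then
        ∑ c ∈ Finset.range (s + 1), (unrelatedPairs res (boxOf key S M c)).card else 0)
      = D.card := by
    rw [hD, Finset.card_sigma, Finset.sum_filter]
    refine Finset.sum_congr rfl fun M _ => ?_
    split_ifs with h
    · rw [Finset.card_biUnion]
      intro c _ d _ hcd
      rw [Function.onFun, Finset.disjoint_left]
      intro p hp hp'
      exact Finset.disjoint_left.1 (disjoint_box hcd) (hpair M c p hp).1 (hpair M d p hp').1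
    · rfl
  have htarget : (S.powersetCard (s + 2) ×ˢ (Finset.univ : Finset Bool)).card
      = 2 * S.card.choose (s + 2) := by
    rw [Finset.card_product, Finset.card_powersetCard, mul_comm]
    rfl
  rw [hcard, ← htarget]
  have hmem : ∀ a ∈ D, (a.1 ⊆ S ∧ a.1.card = s) ∧ RoutingDone key res S a.1 ∧
      (a.2.1 ∈ S ∧ a.2.1 ∉ a.1) ∧ (a.2.2 ∈ S ∧ a.2.2 ∉ a.1) ∧
      boxIndex key a.1 a.2.1 = boxIndex key a.1 a.2.2 ∧ a.2.1 ≠ a.2.2 ∧ ¬ res a.2.1 a.2.2 := by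
    intro a ha
    rw [hD, Finset.mem_sigma, Finset.mem_filter, Finset.mem_powersetCard, Finset.mem_biUnion] at ha
    obtain ⟨⟨h1, h2⟩, c, -, h3⟩ := ha
    obtain ⟨h3, h4, h5, h6⟩ := hpair _ _ _ h3
    rw [mem_boxOf] at h3 h4
    exact ⟨h1, h2, ⟨h3.1, h3.2.1⟩, ⟨h4.1, h4.2.1⟩, h3.2.2.trans h4.2.2.symm, h5, h6⟩
  -- an item of the added pair cannot be marked in another decomposition of the same set
  have hkey : ∀ a ∈ D, ∀ b ∈ D, a.1 ∪ {a.2.1, a.2.2} = b.1 ∪ {b.2.1, b.2.2} →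
      ∀ e f : Fin n, (e = a.2.1 ∧ f = a.2.2 ∨ e = a.2.2 ∧ f = a.2.1) → e ∉ b.1 := by
    intro a ha b hb hU e f hef heb
    obtain ⟨-, -, ⟨hS1, hM1⟩, ⟨hS2, hM2⟩, hidx, hne, hres⟩ := hmem a ha
    obtain ⟨-, ⟨hb1, hb2⟩, -⟩ := hmem b hb
    have hne' : e ≠ f := by
      rcases hef with ⟨rfl, rfl⟩ | ⟨rfl, rfl⟩
      · exact hne
      · exact hne.symm
    have hres' : ¬ res e f ∧ ¬ res f e := by
      rcases hef with ⟨rfl, rfl⟩ | ⟨rfl, rfl⟩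
      · exact ⟨hres, fun h => hres (hsymm _ _ h)⟩
      · exact ⟨fun h => hres (hsymm _ _ h), hres⟩
    have hfS : f ∈ S := by
      rcases hef with ⟨rfl, rfl⟩ | ⟨rfl, rfl⟩ <;> assumption
    have hidx' : boxIndex key a.1 e = boxIndex key a.1 f := by
      rcases hef with ⟨rfl, rfl⟩ | ⟨rfl, rfl⟩
      · exact hidx
      · exact hidx.symm
    by_cases hfb : f ∈ b.1
    · exact hres'.1 (hb1 e heb f hfb hne')
    · refine hres'.2 (hb2 f (Finset.mem_sdiff.2 ⟨hfS, hfb⟩) e heb fun q hq => ?_)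
      have hqU : q ∈ a.1 ∪ {a.2.1, a.2.2} := by
        rw [hU]
        exact Finset.mem_union_left _ hq
      have hq3 : q ∈ a.1 ∨ q = e ∨ q = f := by
        rcases hef with ⟨rfl, rfl⟩ | ⟨rfl, rfl⟩ <;>
          simp only [Finset.mem_union, Finset.mem_insert, Finset.mem_singleton] at hqU <;> tauto
      rcases hq3 with hqa | rfl | rfl
      · have := boxIndex_eq_iff.1 hidx' q hqa
        constructor
        · rintro ⟨h1, h2⟩
          exact lt_asymm h1 (this.1 h2)
        · rintro ⟨h1, h2⟩
          exact lt_asymm h1 (this.2 h2)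
      · exact ⟨fun h => lt_irrefl _ h.2, fun h => lt_irrefl _ h.1⟩
      · exact absurd hq hfb
  refine Finset.card_le_card_of_injOn
    (fun a => (a.1 ∪ {a.2.1, a.2.2}, decide (a.2.1 < a.2.2))) ?_ ?_
  · intro a ha
    obtain ⟨⟨h1, h2⟩, -, ⟨hS1, hM1⟩, ⟨hS2, hM2⟩, -, hne, -⟩ := hmem a ha
    simp only [Finset.coe_product, Set.mem_prod, Finset.mem_coe, Finset.mem_powersetCard,
      Finset.mem_univ, and_true]
    refine ⟨Finset.union_subset h1 ?_, ?_⟩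
    · intro i hi
      rcases Finset.mem_insert.1 hi with rfl | hi
      · exact hS1
      · exact Finset.mem_singleton.1 hi ▸ hS2
    · rw [Finset.card_union_of_disjoint, h2, Finset.card_pair hne]
      rw [Finset.disjoint_right]
      intro i hi
      rcases Finset.mem_insert.1 hi with rfl | hi
      · exact hM1
      · exact Finset.mem_singleton.1 hi ▸ hM2
  · intro a ha b hb hab
    simp only [Prod.mk.injEq, decide_eq_decide] at hab
    obtain ⟨hU, hord⟩ := hab
    obtain ⟨-, -, ⟨-, ha1⟩, ⟨-, ha2⟩, -, hna, -⟩ := hmem a ha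
    obtain ⟨-, -, ⟨-, hb1⟩, ⟨-, hb2⟩, -, hnb, -⟩ := hmem b hb
    have k1 := hkey a ha b hb hU _ _ (Or.inl ⟨rfl, rfl⟩)
    have k2 := hkey a ha b hb hU _ _ (Or.inr ⟨rfl, rfl⟩)
    have m1 : a.2.1 ∈ b.1 ∪ {b.2.1, b.2.2} := by rw [← hU]; simp
    have m2 : a.2.2 ∈ b.1 ∪ {b.2.1, b.2.2} := by rw [← hU]; simp
    simp only [Finset.mem_union, k1, k2, false_or, Finset.mem_insert, Finset.mem_singleton]
      at m1 m2
    have hpe : a.2 = b.2 := by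
      rcases m1 with m1 | m1 <;> rcases m2 with m2 | m2
      · exact absurd (m1.trans m2.symm) hna
      · exact Prod.ext m1 m2
      · rw [m1, m2] at hord
        rcases lt_trichotomy b.2.1 b.2.2 with h | h | h
        · exact absurd (hord.2 h) (lt_asymm h)
        · exact absurd h hnb
        · exact absurd (hord.1 h) (lt_asymm h)
      · exact absurd (m1.trans m2.symm) hna
    have hMe : ∀ c : (_ : Finset (Fin n)) × (Fin n × Fin n), c.2.1 ∉ c.1 → c.2.2 ∉ c.1 →
        c.1 = (c.1 ∪ {c.2.1, c.2.2}) \ {c.2.1, c.2.2} := by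
      intro c h1 h2
      refine (Finset.union_sdiff_cancel_right ?_).symm
      rw [Finset.disjoint_right]
      intro i hi
      rcases Finset.mem_insert.1 hi with rfl | hi
      · exact h1
      · exact Finset.mem_singleton.1 hi ▸ h2
    have hM : a.1 = b.1 := by
      rw [hMe a ha1 ha2, hMe b hb1 hb2, hU, hpe]
    exact Sigma.ext hM (heq_of_eq hpe)

end Boxes

/-! ### Independent random markings -/

section Markings

open Finset
open scoped BigOperators

variable {n : ℕ}

lemma Marking.subset (mark : Marking n) (S : Finset (Fin n)) : (mark S).1 ⊆ S :=
  (mem_powersetCard.1 (mark S).2).1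

lemma Marking.card (mark : Marking n) (S : Finset (Fin n)) : (mark S).1.card = Nat.sqrt S.card :=
  (mem_powersetCard.1 (mark S).2).2

instance (S : Finset (Fin n)) : Nonempty ↥(S.powersetCard (Nat.sqrt S.card)) :=
  (powersetCard_nonempty.2 (Nat.sqrt_le_self _)).to_subtype

/-- Redrawing the marked set of a single `S` independently does not change the distribution. -/
lemma expect_update (S : Finset (Fin n)) (F : Marking n → ℝ) :
    𝔼 m : Marking n, F m
      = 𝔼 M : ↥(S.powersetCard (Nat.sqrt S.card)), 𝔼 m : Marking n, F (Function.update m S M) := by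
  have h1 : 𝔼 m : Marking n, F m
      = 𝔼 p : Marking n × ↥(S.powersetCard (Nat.sqrt S.card)), F p.1 := by
    rw [← univ_product_univ, expect_product]
    exact expect_congr rfl fun m _ => (Fintype.expect_const _).symm
  have h2 : 𝔼 M : ↥(S.powersetCard (Nat.sqrt S.card)), 𝔼 m : Marking n, F (Function.update m S M)
      = 𝔼 p : Marking n × ↥(S.powersetCard (Nat.sqrt S.card)), F (Function.update p.1 S p.2) := by
    rw [← univ_product_univ, expect_product, expect_comm]
  rw [h1, h2]
  -- exchanging the new marked set with the old one
  let swap : Marking n × ↥(S.powersetCard (Nat.sqrt S.card)) →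
      Marking n × ↥(S.powersetCard (Nat.sqrt S.card)) :=
    fun p => (Function.update p.1 S p.2, p.1 S)
  have hinv : ∀ p, swap (swap p) = p := by
    intro p
    simp [swap]
  exact (Fintype.expect_equiv ⟨swap, swap, hinv, hinv⟩ _ _ fun p => rfl).symm

lemma expect_choice (S : Finset (Fin n)) (s : ℕ) (g : Finset (Fin n) → ℝ) :
    𝔼 M : ↥(S.powersetCard s), g M.1 = (∑ M ∈ S.powersetCard s, g M) / (S.card.choose s) := by
  rw [Fintype.expect_eq_sum_div_card, Fintype.card_coe, card_powersetCard]
  congr 1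
  exact sum_coe_sort (S.powersetCard s) g

open Classical in
/-- Functions of disjoint sets of random choices are independent. -/
lemma expect_mul_of_dependsOn {A : Set (Finset (Fin n))} {f g : Marking n → ℝ}
    (hf : DependsOn f A) (hg : DependsOn g Aᶜ) :
    𝔼 m : Marking n, f m * g m = (𝔼 m : Marking n, f m) * 𝔼 m : Marking n, g m := by
  -- exchanging the choices in `A` between two independent markings
  let mix : Marking n × Marking n → Marking n := fun p S => if S ∈ A then p.1 S else p.2 S
  have hinv : ∀ p : Marking n × Marking n, (mix (mix p, mix p.swap), mix (mix p.swap, mix p)) = p := by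
    intro p
    refine Prod.ext (funext fun S => ?_) (funext fun S => ?_) <;>
      by_cases h : S ∈ A <;> simp [mix, h]
  have h1 : 𝔼 m : Marking n, f m * g m = 𝔼 p : Marking n × Marking n, f p.1 * g p.1 := by
    rw [← univ_product_univ, expect_product]
    exact expect_congr rfl fun m _ => (Fintype.expect_const _).symm
  have h2 : (𝔼 m : Marking n, f m) * 𝔼 m : Marking n, g m
      = 𝔼 p : Marking n × Marking n, f p.1 * g p.2 := by
    rw [← univ_product_univ, expect_product, expect_mul_expect]
  rw [h1, h2]
  refine (Fintype.expect_equiv ⟨fun p => (mix p, mix p.swap), fun p => (mix p, mix p.swap),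
    hinv, hinv⟩ _ _ fun p => ?_).symm
  have e1 : f (mix p) = f p.1 := hf fun S hS => by simp [mix, hS]
  have e2 : g (mix p) = g p.2 := hg fun S hS => by simp [mix, show S ∉ A from hS]
  simp only [Equiv.coe_fn_mk, e1, e2]

lemma expect_prod_of_dependsOn (I : Finset ℕ) (A : ℕ → Set (Finset (Fin n)))
    (hA : ∀ c d, c ≠ d → Disjoint (A c) (A d)) (f : ℕ → Marking n → ℝ)
    (hf : ∀ c ∈ I, DependsOn (f c) (A c)) :
    𝔼 m : Marking n, ∏ c ∈ I, f c m = ∏ c ∈ I, 𝔼 m : Marking n, f c m := by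
  induction I using Finset.induction_on with
  | empty => simp
  | insert c I hc ih =>
    have hdep : DependsOn (fun m => ∏ d ∈ I, f d m) (A c)ᶜ := by
      intro m m' h
      refine prod_congr rfl fun d hd => hf d (mem_insert_of_mem hd) fun S hS => h S ?_
      exact Set.disjoint_left.1 (hA d c (fun h => hc (h ▸ hd))) hS
    rw [prod_insert hc, ← ih fun d hd => hf d (mem_insert_of_mem hd),
      ← expect_mul_of_dependsOn (hf c (mem_insert_self c I)) hdep]
    exact expect_congr rfl fun m _ => prod_insert hc

lemma DependsOn.update_eq {A : Set (Finset (Fin n))} {β : Type} {f : Marking n → β}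
    (hf : DependsOn f A) {S : Finset (Fin n)} (hS : S ∉ A) (m : Marking n)
    (M : ↥(S.powersetCard (Nat.sqrt S.card))) : f (Function.update m S M) = f m := by
  refine hf fun T hT => Function.update_of_ne ?_ _ _
  rintro rfl
  exact hS hT

open Classical in
lemma markingProb_eq_expect (E : Marking n → Prop) :
    markingProb n E = 𝔼 m : Marking n, if E m then (1 : ℝ) else 0 := by
  rw [markingProb, Fintype.expect_eq_sum_div_card]
  congr 1
  rw [sum_boole]

lemma markingProb_mono {E E' : Marking n → Prop} (h : ∀ m, E m → E' m) :
    markingProb n E ≤ markingProb n E' := by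
  unfold markingProb
  gcongr
  exact h _

open Classical in
lemma markingProb_or_le (E E' : Marking n → Prop) :
    markingProb n (fun m => E m ∨ E' m) ≤ markingProb n E + markingProb n E' := by
  rw [markingProb_eq_expect, markingProb_eq_expect, markingProb_eq_expect,
    ← expect_add_distrib]
  refine expect_le_expect fun m _ => ?_
  by_cases h1 : E m <;> by_cases h2 : E' m <;> simp [h1, h2]

open Classical in
lemma markingProb_exists_le {ι : Type} (I : Finset ι) (E : ι → Marking n → Prop) :
    markingProb n (fun m => ∃ i ∈ I, E i m) ≤ ∑ i ∈ I, markingProb n (E i) := by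
  induction I using Finset.induction_on with
  | empty => simp [markingProb]
  | insert i I hi ih =>
    rw [sum_insert hi]
    refine le_trans (markingProb_mono (E' := fun m => E i m ∨ ∃ j ∈ I, E j m) fun m => ?_)
      ((markingProb_or_le _ _).trans (by gcongr))
    simp

open Classical in
lemma one_sub_markingProb_not_le (E : Marking n → Prop) :
    1 - markingProb n (fun m => ¬ E m) ≤ markingProb n E := by
  have h1 : markingProb n (fun m => E m ∨ ¬ E m) = 1 := by
    rw [markingProb_eq_expect]
    exact (expect_congr rfl fun m _ => if_pos (Classical.em (E m))).trans (Fintype.expect_const _)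
  have := markingProb_or_le E (fun m => ¬ E m)
  linarith

open Classical in
/-- Markov's inequality. -/
lemma markingProb_le_of_expect_le {E : Marking n → Prop} {f : Marking n → ℝ} {a b : ℝ} (ha : 0 < a)
    (hf : ∀ m, 0 ≤ f m) (hE : ∀ m, E m → a ≤ f m) (hb : 𝔼 m : Marking n, f m ≤ b) :
    markingProb n E ≤ b / a := by
  rw [le_div_iff₀ ha, markingProb_eq_expect, expect_mul]
  refine (expect_le_expect fun m _ => ?_).trans hb
  split_ifs with h
  · simpa using hE m h
  · simpa using hf m

/-! ### The product of the call sizes along the path of an item -/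

lemma choose_sqrt_add_le (m k : ℕ) :
    (m.choose (Nat.sqrt m + k) : ℝ) ≤ m.choose (Nat.sqrt m) * √m ^ k := by
  induction k with
  | zero => simp
  | succ k ih =>
    set s := Nat.sqrt m
    have h1 : m.choose (s + k + 1) * (s + k + 1) ≤ m.choose (s + k) * m := by
      rw [Nat.choose_succ_right_eq]
      exact Nat.mul_le_mul_left _ (Nat.sub_le _ _)
    have h2 : (m.choose (s + k + 1) : ℝ) * (s + k + 1) ≤ m.choose (s + k) * m := by
      exact_mod_cast h1
    have h3 : √(m : ℝ) ≤ s + 1 := Real.sqrt_le_iff.2 ⟨by positivity, by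
      rw [sq]; exact_mod_cast (Nat.lt_succ_sqrt m).le⟩
    have h4 : (m.choose (s + k + 1) : ℝ) * √m ≤ m.choose (s + k) * m :=
      le_trans (by gcongr; linarith [Nat.cast_nonneg (α := ℝ) k]) h2
    have h5 : (m.choose (s + k + 1) : ℝ) ≤ m.choose (s + k) * √m := by
      rcases Nat.eq_zero_or_pos m with h0 | h0
      · simp [h0, s]
      · have hpos : 0 < √(m : ℝ) := Real.sqrt_pos.2 (by exact_mod_cast h0)
        rw [← mul_le_mul_iff_of_pos_right hpos, mul_assoc, Real.mul_self_sqrt (Nat.cast_nonneg m)]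
        exact h4
    calc (m.choose (s + (k + 1)) : ℝ) ≤ m.choose (s + k) * √m := h5
      _ ≤ m.choose s * √m ^ k * √m := by gcongr
      _ = m.choose s * √m ^ (k + 1) := by ring

variable {κ : Type} [LinearOrder κ] {key : Fin n → κ}

lemma expect_choose_card_box_le (hinj : Function.Injective key) (S : Finset (Fin n)) (k : ℕ)
    (e : Fin n) :
    𝔼 M : ↥(S.powersetCard (Nat.sqrt S.card)),
      ((boxOf key S M.1 (boxIndex key M.1 e)).card.choose k : ℝ) ≤ (k + 1) * √S.card ^ k := by
  rw [expect_choice S _ fun M => ((boxOf key S M (boxIndex key M e)).card.choose k : ℝ)]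
  have hpos : (0 : ℝ) < S.card.choose (Nat.sqrt S.card) := by
    exact_mod_cast Nat.choose_pos (Nat.sqrt_le_self _)
  rw [div_le_iff₀ hpos]
  have h1 : ((∑ M ∈ S.powersetCard (Nat.sqrt S.card),
      (boxOf key S M (boxIndex key M e)).card.choose k : ℕ) : ℝ)
        ≤ ((k + 1) * S.card.choose (Nat.sqrt S.card + k) : ℕ) := by
    exact_mod_cast sum_choose_card_box_le hinj S (Nat.sqrt S.card) k e
  push_cast at h1
  refine h1.trans ?_
  have := choose_sqrt_add_le S.card k
  calc ((k : ℝ) + 1) * S.card.choose (Nat.sqrt S.card + k)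
      ≤ (k + 1) * (S.card.choose (Nat.sqrt S.card) * √S.card ^ k) := by gcongr
    _ = _ := by ring

lemma card_box_marking_lt (mark : Marking n) {S : Finset (Fin n)} (hS : S.Nonempty) (c : ℕ) :
    (boxOf key S (mark S).1 c).card < S.card := by
  have h1 := card_box_add_card_le (key := key) (mark.subset S) c
  have h2 : 0 < (mark S).1.card := by
    rw [mark.card]
    exact Nat.sqrt_pos.2 hS.card_pos
  omega

variable (key)

/-- The product of the sizes of the calls on the path of item `e` in the recursion that starts with
the call on `S`; the path ends with the call in which `e` is marked. -/
def pathProduct (mark : Marking n) (e : Fin n) (S : Finset (Fin n)) : ℕ :=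
  if _h : e ∈ S \ (mark S).1 then
    S.card * pathProduct mark e (boxOf key S (mark S).1 (boxIndex key (mark S).1 e))
  else S.card
termination_by S.card
decreasing_by exact card_box_marking_lt mark ⟨e, (mem_sdiff.1 _h).1⟩ _

variable {key}

lemma mem_box_self {S M : Finset (Fin n)} {e : Fin n} (h : e ∈ S \ M) :
    e ∈ boxOf key S M (boxIndex key M e) :=
  mem_boxOf.2 ⟨(mem_sdiff.1 h).1, (mem_sdiff.1 h).2, rfl⟩

lemma pathProduct_of_mem {mark : Marking n} {e : Fin n} {S : Finset (Fin n)}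
    (h : e ∈ S \ (mark S).1) : pathProduct key mark e S
      = S.card * pathProduct key mark e (boxOf key S (mark S).1 (boxIndex key (mark S).1 e)) := by
  rw [pathProduct, dif_pos h]

lemma pathProduct_of_notMem {mark : Marking n} {e : Fin n} {S : Finset (Fin n)}
    (h : e ∉ S \ (mark S).1) : pathProduct key mark e S = S.card := by
  rw [pathProduct, dif_neg h]

lemma pathProduct_of_mem_box {mark : Marking n} {e : Fin n} {S : Finset (Fin n)} {c : ℕ}
    (h : e ∈ boxOf key S (mark S).1 c) :
    pathProduct key mark e S = S.card * pathProduct key mark e (boxOf key S (mark S).1 c) := by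
  obtain ⟨h1, h2, h3⟩ := mem_boxOf.1 h
  rw [pathProduct_of_mem (mem_sdiff.2 ⟨h1, h2⟩), h3]

lemma card_le_pathProduct (mark : Marking n) (e : Fin n) (S : Finset (Fin n)) (he : e ∈ S) :
    S.card ≤ pathProduct key mark e S := by
  induction hm : S.card using Nat.strong_induction_on generalizing S with
  | _ m ih =>
    by_cases h : e ∈ S \ (mark S).1
    · rw [pathProduct_of_mem h, ← hm]
      refine Nat.le_mul_of_pos_right _ ?_
      have hb := mem_box_self (key := key) h
      exact (card_pos.2 ⟨e, hb⟩).trans_le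
        (ih _ (hm ▸ card_box_marking_lt mark ⟨e, he⟩ _) _ hb rfl)
    · rw [pathProduct_of_notMem h, hm]

lemma pathProduct_le_factorial (mark : Marking n) (e : Fin n) (S : Finset (Fin n)) (he : e ∈ S) :
    pathProduct key mark e S ≤ S.card.factorial := by
  induction hm : S.card using Nat.strong_induction_on generalizing S with
  | _ m ih =>
    by_cases h : e ∈ S \ (mark S).1
    · have hb := mem_box_self (key := key) h
      have hlt := card_box_marking_lt (key := key) mark ⟨e, he⟩ (boxIndex key (mark S).1 e)
      have := ih _ (hm ▸ hlt) _ hb rfl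
      obtain ⟨j, rfl⟩ : ∃ j, m = j + 1 := ⟨m - 1, by omega⟩
      rw [pathProduct_of_mem h, Nat.factorial_succ]
      exact Nat.mul_le_mul hm.le (this.trans (Nat.factorial_le (by omega)))
    · rw [pathProduct_of_notMem h, hm]
      exact Nat.self_le_factorial m

lemma dependsOn_pathProduct (e : Fin n) (S : Finset (Fin n)) :
    DependsOn (fun mark => pathProduct key mark e S) {T | T ⊆ S ∧ T.Nonempty} := by
  induction hm : S.card using Nat.strong_induction_on generalizing S with
  | _ m ih =>
    intro m1 m2 h
    simp only
    by_cases he : e ∈ S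
    · have hS : m1 S = m2 S := h S ⟨subset_rfl, ⟨e, he⟩⟩
      by_cases h' : e ∈ S \ (m1 S).1
      · rw [pathProduct_of_mem h', pathProduct_of_mem (mark := m2) (hS ▸ h'), ← hS]
        congr 1
        refine ih _ (hm ▸ card_box_marking_lt m1 ⟨e, he⟩ _) _ rfl fun T hT => h T ?_
        exact ⟨hT.1.trans (box_subset _ _ _), hT.2⟩
      · rw [pathProduct_of_notMem h', pathProduct_of_notMem (mark := m2) (hS ▸ h')]
    · rw [pathProduct_of_notMem (fun h => he (mem_sdiff.1 h).1),
        pathProduct_of_notMem (fun h => he (mem_sdiff.1 h).1)]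

lemma mul_le_one_add_choose_four {m : ℕ} (hm : 200 ≤ m) :
    (m : ℝ) * (1 + 5 * (m : ℝ) ^ 2) ≤ 1 + m.choose 4 := by
  obtain ⟨j, rfl⟩ : ∃ j, m = j + 4 := ⟨m - 4, by omega⟩
  have h1 : ((j + 4).choose 4 : ℝ) * 24 = (j + 4) * (j + 3) * (j + 2) * (j + 1) := by
    have : (j + 4).descFactorial 4 = Nat.factorial 4 * (j + 4).choose 4 :=
      Nat.descFactorial_eq_factorial_mul_choose _ _
    have h2 : (j + 4).descFactorial 4 = (j + 4) * (j + 3) * (j + 2) * (j + 1) := by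
      simp [Nat.descFactorial]
      ring
    rw [h2] at this
    have h3 : (((j + 4) * (j + 3) * (j + 2) * (j + 1) : ℕ) : ℝ)
        = ((Nat.factorial 4 * (j + 4).choose 4 : ℕ) : ℝ) := by rw [this]
    push_cast [Nat.factorial] at h3
    linarith
  have hj : (196 : ℝ) ≤ j := by
    have : 196 ≤ j := by omega
    exact_mod_cast this
  push_cast
  obtain ⟨t, ht, hjt⟩ : ∃ t : ℝ, 0 ≤ t ∧ (j : ℝ) = 196 + t := ⟨j - 196, by linarith, by ring⟩
  have h5 : (1 + 5 * (j + 4 : ℝ) ^ 2) * 24 ≤ (j + 3) * (j + 2) * (j + 1) := by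
    rw [hjt]
    have h2 := pow_nonneg ht 2
    have h3 := pow_nonneg ht 3
    ring_nf
    linarith
  have h6 := mul_le_mul_of_nonneg_left h5 (show (0 : ℝ) ≤ j + 4 by linarith)
  linarith

/-- In expectation a box has size about `√m`, with fourth moment of order `m ^ 2`; hence the fourth
power of the size of the box wins against the additional factor `m` of every call. -/
lemma expect_pathProduct_le (hinj : Function.Injective key) (e : Fin n) (S : Finset (Fin n))
    (he : e ∈ S) {A : ℝ} (hA : (Nat.factorial 200 : ℝ) ≤ A) :
    𝔼 mark : Marking n, (pathProduct key mark e S : ℝ) ≤ A * (1 + S.card.choose 4) := by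
  have hA1 : 1 ≤ A := (Nat.one_le_cast.2 (Nat.factorial_pos 200)).trans hA
  induction hm : S.card using Nat.strong_induction_on generalizing S with
  | _ m ih =>
    by_cases hsmall : m < 200
    · refine (expect_le_expect (g := fun _ => A) fun mark _ => ?_).trans ?_
      · exact (Nat.cast_le.2 ((pathProduct_le_factorial (key := key) mark e S he).trans
          (Nat.factorial_le (hm.trans_le hsmall.le)))).trans hA
      · rw [Fintype.expect_const]
        have : (0 : ℝ) ≤ m.choose 4 := Nat.cast_nonneg _
        nlinarith
    · rw [expect_update S]
      have hstep : ∀ M : ↥(S.powersetCard (Nat.sqrt S.card)),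
          𝔼 mark : Marking n, (pathProduct key (Function.update mark S M) e S : ℝ)
            ≤ m * A * (1 + ((boxOf key S M.1 (boxIndex key M.1 e)).card.choose 4 : ℝ)) := by
        intro M
        by_cases heM : e ∈ S \ M.1
        · have hlt := card_box_marking_lt (key := key)
            (Function.update (Classical.arbitrary (Marking n)) S M) ⟨e, he⟩ (boxIndex key M.1 e)
          rw [Function.update_self] at hlt
          replace hlt := hlt.trans_eq hm
          have hb := ih _ hlt _ (mem_box_self heM) rfl
          have heq : ∀ mark : Marking n, (pathProduct key (Function.update mark S M) e S : ℝ)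
              = m * pathProduct key mark e (boxOf key S M.1 (boxIndex key M.1 e)) := by
            intro mark
            have h1 : pathProduct key (Function.update mark S M) e S
                = S.card * pathProduct key (Function.update mark S M) e
                  (boxOf key S M.1 (boxIndex key M.1 e)) := by
              rw [pathProduct_of_mem (by rwa [Function.update_self]), Function.update_self]
            have h2 := (dependsOn_pathProduct (key := key) e
              (boxOf key S M.1 (boxIndex key M.1 e))).update_eq (S := S)
              (fun h => by have := card_le_card h.1; omega) mark M
            have hmr : (S.card : ℝ) = m := by exact_mod_cast hm
            rw [h1, h2, Nat.cast_mul, hmr]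
          rw [expect_congr rfl fun mark _ => heq mark, ← mul_expect, mul_assoc]
          gcongr
        · have heq : ∀ mark : Marking n, (pathProduct key (Function.update mark S M) e S : ℝ)
              = m := by
            intro mark
            rw [pathProduct_of_notMem (by rwa [Function.update_self]), hm]
          rw [expect_congr rfl fun mark _ => heq mark, Fintype.expect_const, mul_assoc]
          have : (0 : ℝ) ≤ ((boxOf key S M.1 (boxIndex key M.1 e)).card.choose 4 : ℝ) :=
            Nat.cast_nonneg _
          exact le_mul_of_one_le_right (Nat.cast_nonneg m) (by nlinarith)
      refine (expect_le_expect fun M _ => hstep M).trans ?_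
      rw [← mul_expect, expect_add_distrib, Fintype.expect_const]
      have h4 := expect_choose_card_box_le hinj S 4 e
      have hsq : √(S.card : ℝ) ^ 4 = (m : ℝ) ^ 2 := by
        rw [hm, show (4 : ℕ) = 2 * 2 by norm_num, pow_mul, Real.sq_sqrt (Nat.cast_nonneg m)]
      rw [hsq] at h4
      push_cast at h4
      have h5 := mul_le_one_add_choose_four (not_lt.1 hsmall)
      calc (m : ℝ) * A * (1 + 𝔼 M : ↥(S.powersetCard (Nat.sqrt S.card)),
            ((boxOf key S M.1 (boxIndex key M.1 e)).card.choose 4 : ℝ))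
          ≤ m * A * (1 + 5 * (m : ℝ) ^ 2) := by gcongr; linarith
        _ = A * (m * (1 + 5 * (m : ℝ) ^ 2)) := by ring
        _ ≤ A * (1 + m.choose 4) := by gcongr

end Markings

/-! ### Unresolved comparisons of base cases at a fixed window -/

section BasePairs

open Finset
open scoped BigOperators

variable {n : ℕ} {κ : Type} [LinearOrder κ] (key : Fin n → κ) (res : Fin n → Fin n → Prop) (L : ℕ)

open Classical in
/-- The number of unresolved ordered pairs in the base cases (calls on fewer than `L` items) that
the recursion from `S` reaches through calls whose routing is done. -/
noncomputable def basePairs (mark : Marking n) (S : Finset (Fin n)) : ℕ :=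
  if _h : L ≤ S.card ∧ S.Nonempty then
    if RoutingDone key res S (mark S).1 then
      ∑ c ∈ range ((mark S).1.card + 1), basePairs mark (boxOf key S (mark S).1 c)
    else 0
  else (unrelatedPairs res S).card
termination_by S.card
decreasing_by exact card_box_marking_lt mark _h.2 _

variable {key res L}

lemma basePairs_of_base {mark : Marking n} {S : Finset (Fin n)} (h : S.card < L) :
    basePairs key res L mark S = (unrelatedPairs res S).card := by
  rw [basePairs, dif_neg fun h' => not_le.2 h h'.1]

lemma basePairs_of_routingDone {mark : Marking n} {S : Finset (Fin n)} (h : L ≤ S.card)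
    (hS : S.Nonempty) (hd : RoutingDone key res S (mark S).1) :
    basePairs key res L mark S
      = ∑ c ∈ range ((mark S).1.card + 1), basePairs key res L mark (boxOf key S (mark S).1 c) := by
  rw [basePairs, dif_pos ⟨h, hS⟩, if_pos hd]

lemma basePairs_of_not_routingDone {mark : Marking n} {S : Finset (Fin n)} (h : L ≤ S.card)
    (hS : S.Nonempty) (hd : ¬ RoutingDone key res S (mark S).1) :
    basePairs key res L mark S = 0 := by
  rw [basePairs, dif_pos ⟨h, hS⟩, if_neg hd]

lemma basePairs_of_not_nonempty {mark : Marking n} {S : Finset (Fin n)} (hS : ¬ S.Nonempty) :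
    basePairs key res L mark S = 0 := by
  rw [basePairs, dif_neg fun h' => hS h'.2, not_nonempty_iff_eq_empty.1 hS]
  simp [unrelatedPairs]

lemma sum_card_box_le (mark : Marking n) (S : Finset (Fin n)) :
    ∑ c ∈ range ((mark S).1.card + 1), (boxOf key S (mark S).1 c).card ≤ S.card := by
  rw [sum_card_box]
  exact card_le_card sdiff_subset

lemma basePairs_le_sq (mark : Marking n) (S : Finset (Fin n)) :
    basePairs key res L mark S ≤ S.card ^ 2 := by
  induction hm : S.card using Nat.strong_induction_on generalizing S with
  | _ m ih =>
    by_cases hS : S.Nonempty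
    · by_cases hL : S.card < L
      · rw [basePairs_of_base hL, ← hm]
        exact card_unrelatedPairs_le res S
      · by_cases hd : RoutingDone key res S (mark S).1
        · rw [basePairs_of_routingDone (not_lt.1 hL) hS hd]
          have h1 := sum_card_box_le (key := key) mark S
          calc ∑ c ∈ range ((mark S).1.card + 1),
                basePairs key res L mark (boxOf key S (mark S).1 c)
              ≤ ∑ c ∈ range ((mark S).1.card + 1), m * (boxOf key S (mark S).1 c).card := by
                refine sum_le_sum fun c _ => ?_
                have hlt := (card_box_marking_lt (key := key) mark hS c).trans_eq hm
                refine (ih _ hlt _ rfl).trans ?_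
                rw [sq]
                exact Nat.mul_le_mul_right _ hlt.le
            _ = m * ∑ c ∈ range ((mark S).1.card + 1), (boxOf key S (mark S).1 c).card := by
                rw [mul_sum]
            _ ≤ m * m := Nat.mul_le_mul_left _ (h1.trans hm.le)
            _ = m ^ 2 := (sq m).symm
        · rw [basePairs_of_not_routingDone (not_lt.1 hL) hS hd]
          exact Nat.zero_le _
    · rw [basePairs_of_not_nonempty hS]
      exact Nat.zero_le _

lemma dependsOn_basePairs (S : Finset (Fin n)) :
    DependsOn (fun mark => basePairs key res L mark S) {T | T ⊆ S ∧ T.Nonempty} := by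
  induction hm : S.card using Nat.strong_induction_on generalizing S with
  | _ m ih =>
    intro m1 m2 h
    change basePairs key res L m1 S = basePairs key res L m2 S
    by_cases hne : S.Nonempty
    · have hS : m1 S = m2 S := h S ⟨subset_rfl, hne⟩
      by_cases hL : S.card < L
      · rw [basePairs_of_base hL, basePairs_of_base hL]
      · by_cases hd : RoutingDone key res S (m1 S).1
        · rw [basePairs_of_routingDone (not_lt.1 hL) hne hd,
            basePairs_of_routingDone (mark := m2) (not_lt.1 hL) hne (hS ▸ hd), ← hS]
          refine sum_congr rfl fun c _ => ?_
          refine ih _ ((card_box_marking_lt m1 hne _).trans_eq hm) _ rfl fun T hT => h T ?_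
          exact ⟨hT.1.trans (box_subset _ _ _), hT.2⟩
        · rw [basePairs_of_not_routingDone (not_lt.1 hL) hne hd,
            basePairs_of_not_routingDone (mark := m2) (not_lt.1 hL) hne (hS ▸ hd)]
    · rw [basePairs_of_not_nonempty hne, basePairs_of_not_nonempty hne]

open Classical in
/-- One step of the recursion for exponential moments: the boxes are independent of each other. -/
lemma expect_exp_basePairs_update_le {θ : ℝ} (S : Finset (Fin n)) (hL : L ≤ S.card)
    (hS : S.Nonempty) (M : ↥(S.powersetCard (Nat.sqrt S.card))) (g : ℕ → ℝ)
    (hg : ∀ c ∈ range (M.1.card + 1),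
      𝔼 mark : Marking n, Real.exp (θ * basePairs key res L mark (boxOf key S M.1 c))
        ≤ Real.exp (θ * g c)) :
    𝔼 mark : Marking n, Real.exp (θ * basePairs key res L (Function.update mark S M) S)
      ≤ Real.exp (θ * if RoutingDone key res S M.1 then ∑ c ∈ range (M.1.card + 1), g c else 0) := by
  split_ifs with hd
  · have hlt : ∀ c, (boxOf key S M.1 c).card < S.card := by
      intro c
      have := card_box_marking_lt (key := key)
        (Function.update (Classical.arbitrary (Marking n)) S M) hS c
      rwa [Function.update_self] at this
    have heq : ∀ mark : Marking n,
        Real.exp (θ * basePairs key res L (Function.update mark S M) S)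
          = ∏ c ∈ range (M.1.card + 1),
            Real.exp (θ * basePairs key res L mark (boxOf key S M.1 c)) := by
      intro mark
      rw [basePairs_of_routingDone hL hS (by rwa [Function.update_self]), Function.update_self,
        ← Real.exp_sum, ← mul_sum, ← Nat.cast_sum]
      congr 3
      refine sum_congr rfl fun c _ => ?_
      exact (dependsOn_basePairs (key := key) (res := res) (L := L)
        (boxOf key S M.1 c)).update_eq (S := S)
        (fun h => absurd (card_le_card h.1) (not_le.2 (hlt c))) mark M
    rw [expect_congr rfl fun mark _ => heq mark, expect_prod_of_dependsOn (range (M.1.card + 1))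
      (fun c => {T | T ⊆ boxOf key S M.1 c ∧ T.Nonempty})]
    · rw [mul_sum, Real.exp_sum]
      refine prod_le_prod (fun c _ => expect_nonneg fun m _ => (Real.exp_pos _).le) hg
    · intro c d hcd
      rw [Set.disjoint_left]
      rintro T ⟨h1, e, he⟩ ⟨h2, -⟩
      exact disjoint_left.1 (disjoint_box hcd) (h1 he) (h2 he)
    · intro c _ m1 m2 h
      change Real.exp _ = Real.exp _
      rw [show basePairs key res L m1 (boxOf key S M.1 c)
        = basePairs key res L m2 (boxOf key S M.1 c) from dependsOn_basePairs _ h]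
  · have heq : ∀ mark : Marking n,
        Real.exp (θ * basePairs key res L (Function.update mark S M) S) = 1 := by
      intro mark
      rw [basePairs_of_not_routingDone hL hS (by rwa [Function.update_self])]
      simp
    rw [expect_congr rfl fun mark _ => heq mark, Fintype.expect_const]
    simp

/-- The potential that bounds the exponential moments.  The two terms lose a constant fraction from
a call on `m` items to its boxes, of size about `√m`, for `m` between `L` and `L ^ 2` and between
`L ^ 2` and `L ^ 4`. -/
noncomputable def basePotential (L b : ℝ) : ℝ := 36 * (b ^ 2 / (b + L) + b ^ 2 / (b + L ^ 2))

lemma basePotential_nonneg {L b : ℝ} (hL : 0 ≤ L) (hb : 0 ≤ b) : 0 ≤ basePotential L b := by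
  unfold basePotential
  positivity

lemma basePotential_le {L b : ℝ} (hL : 0 < L) (hb : 0 ≤ b) : basePotential L b ≤ 72 * b := by
  have aux : ∀ c : ℝ, 0 < c → b ^ 2 / (b + c) ≤ b := by
    intro c hc
    rw [div_le_iff₀ (by linarith)]
    nlinarith
  have h1 := aux L hL
  have h2 := aux (L ^ 2) (by positivity)
  unfold basePotential
  linarith

lemma div_add_le_tangent {b β c : ℝ} (hb : 0 ≤ b) (hβ : 0 ≤ β) (hc : 0 < c) :
    b / (b + c) ≤ β / (β + c) + (b - β) * (c / (β + c) ^ 2) := by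
  have h1 : 0 < b + c := by linarith
  have h2 : 0 < β + c := by linarith
  have : β / (β + c) + (b - β) * (c / (β + c) ^ 2) - b / (b + c)
      = c * (b - β) ^ 2 / ((β + c) ^ 2 * (b + c)) := by
    field_simp
    ring
  have h3 : 0 ≤ c * (b - β) ^ 2 / ((β + c) ^ 2 * (b + c)) := by positivity
  linarith

lemma expect_sum_box_sq_div_le (hinj : Function.Injective key) (S : Finset (Fin n)) {c : ℝ}
    (hc : 0 < c) :
    𝔼 M : ↥(S.powersetCard (Nat.sqrt S.card)), ∑ d ∈ range (M.1.card + 1),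
      ((boxOf key S M.1 d).card : ℝ) ^ 2 / ((boxOf key S M.1 d).card + c)
      ≤ S.card * (2 * √S.card / (2 * √S.card + c)) := by
  set β := 2 * √(S.card : ℝ) with hβ
  have hβ0 : 0 ≤ β := by positivity
  have hpt : ∀ M : ↥(S.powersetCard (Nat.sqrt S.card)), ∑ d ∈ range (M.1.card + 1),
      ((boxOf key S M.1 d).card : ℝ) ^ 2 / ((boxOf key S M.1 d).card + c)
      ≤ ∑ e ∈ S, (β / (β + c)
        + (((boxOf key S M.1 (boxIndex key M.1 e)).card : ℝ) - β) * (c / (β + c) ^ 2)) := by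
    intro M
    have h1 := sum_box_mul (key := key) (S := S) (M := M.1) fun T => (T.card : ℝ) / (T.card + c)
    have h2 : ∑ d ∈ range (M.1.card + 1),
        ((boxOf key S M.1 d).card : ℝ) ^ 2 / ((boxOf key S M.1 d).card + c)
        = ∑ d ∈ range (M.1.card + 1), ((boxOf key S M.1 d).card : ℝ)
          * ((boxOf key S M.1 d).card / ((boxOf key S M.1 d).card + c)) :=
      sum_congr rfl fun d _ => by rw [sq, mul_div_assoc]
    rw [h2, h1]
    refine (sum_le_sum_of_subset_of_nonneg sdiff_subset fun e _ _ => by positivity).trans ?_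
    exact sum_le_sum fun e _ => div_add_le_tangent (Nat.cast_nonneg _) hβ0 hc
  refine (expect_le_expect fun M _ => hpt M).trans ?_
  rw [expect_sum_comm]
  have he : ∀ e ∈ S, 𝔼 M : ↥(S.powersetCard (Nat.sqrt S.card)), (β / (β + c)
        + (((boxOf key S M.1 (boxIndex key M.1 e)).card : ℝ) - β) * (c / (β + c) ^ 2))
        ≤ β / (β + c) := by
    intro e _
    have h1 := expect_choose_card_box_le hinj S 1 e
    simp only [Nat.choose_one_right, pow_one, Nat.cast_one] at h1
    rw [expect_add_distrib, Fintype.expect_const, ← expect_mul, expect_sub_distrib,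
      Fintype.expect_const]
    have h2 : 0 ≤ c / (β + c) ^ 2 := by positivity
    have h3 : 𝔼 M : ↥(S.powersetCard (Nat.sqrt S.card)),
        ((boxOf key S M.1 (boxIndex key M.1 e)).card : ℝ) - β ≤ 0 := by
      rw [hβ]
      linarith
    nlinarith
  refine (sum_le_sum he).trans ?_
  rw [sum_const, nsmul_eq_mul]

lemma expect_sum_basePotential_le (hinj : Function.Injective key) (S : Finset (Fin n)) {c : ℝ}
    (hc : 0 < c) :
    𝔼 M : ↥(S.powersetCard (Nat.sqrt S.card)), ∑ d ∈ range (M.1.card + 1),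
      basePotential c (boxOf key S M.1 d).card
      ≤ 36 * (S.card * (2 * √S.card / (2 * √S.card + c))
        + S.card * (2 * √S.card / (2 * √S.card + c ^ 2))) := by
  have h1 := expect_sum_box_sq_div_le hinj S hc
  have h2 := expect_sum_box_sq_div_le hinj S (pow_pos hc 2)
  have h3 : ∀ M : ↥(S.powersetCard (Nat.sqrt S.card)), ∑ d ∈ range (M.1.card + 1),
      basePotential c (boxOf key S M.1 d).card = 36 * (∑ d ∈ range (M.1.card + 1),
        ((boxOf key S M.1 d).card : ℝ) ^ 2 / ((boxOf key S M.1 d).card + c)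
        + ∑ d ∈ range (M.1.card + 1),
        ((boxOf key S M.1 d).card : ℝ) ^ 2 / ((boxOf key S M.1 d).card + c ^ 2)) := by
    intro M
    rw [← sum_add_distrib, mul_sum]
    rfl
  rw [expect_congr rfl fun M _ => h3 M, ← mul_expect, expect_add_distrib]
  linarith

open Classical in
lemma expect_unrelatedPairs_box_le (hsymm : ∀ i j, res i j → res j i) (S : Finset (Fin n)) :
    𝔼 M : ↥(S.powersetCard (Nat.sqrt S.card)), (if RoutingDone key res S M.1 then
        ∑ c ∈ range (M.1.card + 1), ((unrelatedPairs res (boxOf key S M.1 c)).card : ℝ) else 0)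
      ≤ 2 * S.card := by
  set s := Nat.sqrt S.card with hs
  have hcongr : ∀ M : ↥(S.powersetCard s), (if RoutingDone key res S M.1 then
        ∑ c ∈ range (M.1.card + 1), ((unrelatedPairs res (boxOf key S M.1 c)).card : ℝ) else 0)
      = ((if RoutingDone key res S M.1 then
        ∑ c ∈ range (s + 1), (unrelatedPairs res (boxOf key S M.1 c)).card else 0 : ℕ) : ℝ) := by
    intro M
    rw [(mem_powersetCard.1 M.2).2]
    split_ifs <;> simp
  rw [expect_congr rfl fun M _ => hcongr M, expect_choice S s fun M =>
    ((if RoutingDone key res S M then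
        ∑ c ∈ range (s + 1), (unrelatedPairs res (boxOf key S M c)).card else 0 : ℕ) : ℝ)]
  have hpos : (0 : ℝ) < S.card.choose s := by
    exact_mod_cast Nat.choose_pos (Nat.sqrt_le_self _)
  rw [div_le_iff₀ hpos, ← Nat.cast_sum]
  have h1 : ((∑ M ∈ S.powersetCard s, (if RoutingDone key res S M then
        ∑ c ∈ range (s + 1), (unrelatedPairs res (boxOf key S M c)).card else 0) : ℕ) : ℝ)
      ≤ (2 * S.card.choose (s + 2) : ℕ) :=
    Nat.cast_le.2 (sum_unrelatedPairs_box_le res hsymm S s)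
  refine h1.trans ?_
  have h2 := choose_sqrt_add_le S.card 2
  rw [Real.sq_sqrt (Nat.cast_nonneg _), ← hs] at h2
  push_cast
  linarith

/-- The loss of the potential pays for the unresolved pairs of the base cases among the boxes. -/
lemma basePotential_step {r L N : ℝ} (hL : 16 ≤ L) (hr : L ≤ r ^ 2) (hr0 : 0 ≤ r)
    (hN1 : N ≤ 2 * r ^ 2) (hN2 : N ≤ (r + 1) * L ^ 2) :
    N + r + 36 * (r ^ 2 * (2 * r / (2 * r + L)) + r ^ 2 * (2 * r / (2 * r + L ^ 2)))
      ≤ basePotential L (r ^ 2) := by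
  have hr4 : 4 ≤ r := by nlinarith
  have hrpos : 0 < r := by linarith
  have gain : ∀ c : ℝ, 0 < c → r ^ 2 * (2 * r / (2 * r + c)) ≤ (r ^ 2) ^ 2 / (r ^ 2 + c) ∧
      (c ≤ r ^ 2 → r ^ 2 * (2 * r / (2 * r + c)) + r ^ 2 / 4 * (c / (2 * r + c))
        ≤ (r ^ 2) ^ 2 / (r ^ 2 + c)) := by
    intro c hc
    have h1 : 0 < 2 * r + c := by linarith
    have h2 : 0 < r ^ 2 + c := by positivity
    have h3 : (r ^ 2) ^ 2 / (r ^ 2 + c) - r ^ 2 * (2 * r / (2 * r + c))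
        = r ^ 2 * (c / (2 * r + c)) * ((r ^ 2 - 2 * r) / (r ^ 2 + c)) := by
      field_simp
      ring
    have h4 : 0 ≤ r ^ 2 * (c / (2 * r + c)) := by positivity
    constructor
    · have h5 : 0 ≤ (r ^ 2 - 2 * r) / (r ^ 2 + c) := div_nonneg (by nlinarith) h2.le
      have := mul_nonneg h4 h5
      linarith
    · intro hcr
      have h5 : 1 / 4 ≤ (r ^ 2 - 2 * r) / (r ^ 2 + c) := by
        rw [le_div_iff₀ h2]
        nlinarith
      have := mul_le_mul_of_nonneg_left h5 h4
      linarith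
  have hL2 : 0 < L ^ 2 := by positivity
  unfold basePotential
  by_cases h1 : r ≤ L
  · have g1 := (gain L (by linarith)).2 hr
    have g2 := (gain (L ^ 2) hL2).1
    have h3 : 1 / 3 ≤ L / (2 * r + L) := by
      rw [le_div_iff₀ (by linarith)]
      linarith
    have h4 : r ^ 2 / 4 * (1 / 3) ≤ r ^ 2 / 4 * (L / (2 * r + L)) := by gcongr
    nlinarith
  · have g1 := (gain L (by linarith)).1
    have g2 := (gain (L ^ 2) hL2).2 (by nlinarith)
    by_cases h2 : r ≤ L ^ 2
    · have h3 : 1 / 3 ≤ L ^ 2 / (2 * r + L ^ 2) := by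
        rw [le_div_iff₀ (by linarith)]
        linarith
      have h4 : r ^ 2 / 4 * (1 / 3) ≤ r ^ 2 / 4 * (L ^ 2 / (2 * r + L ^ 2)) := by gcongr
      nlinarith
    · have h3 : L ^ 2 / (3 * r) ≤ L ^ 2 / (2 * r + L ^ 2) := by
        gcongr
        linarith
      have h4 : r ^ 2 / 4 * (L ^ 2 / (3 * r)) ≤ r ^ 2 / 4 * (L ^ 2 / (2 * r + L ^ 2)) := by gcongr
      have h5 : r ^ 2 / 4 * (L ^ 2 / (3 * r)) = r * L ^ 2 / 12 := by
        field_simp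
        ring
      have h6 : 4 * L ^ 2 ≤ r * L ^ 2 := by gcongr
      have h7 : 256 * r ≤ L ^ 2 * r := by
        gcongr
        nlinarith
      nlinarith

lemma exp_mul_le_of_small {θ x X δ : ℝ} (hθ : 0 ≤ θ) (hx : 0 ≤ x) (hX : x ≤ X) (h1 : θ * X ≤ 1)
    (h2 : θ * X ^ 2 ≤ δ) : Real.exp (θ * x) ≤ 1 + θ * x + θ * δ := by
  have h0 : 0 ≤ θ * x := mul_nonneg hθ hx
  have h3 : θ * x ≤ 1 := (mul_le_mul_of_nonneg_left hX hθ).trans h1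
  have h4 := Real.abs_exp_sub_one_sub_id_le (x := θ * x) (by rwa [abs_of_nonneg h0])
  have h5 := (abs_le.1 h4).2
  have h6 : (θ * x) ^ 2 ≤ θ * δ := by
    calc (θ * x) ^ 2 = θ * (θ * x ^ 2) := by ring
      _ ≤ θ * (θ * X ^ 2) := by gcongr
      _ ≤ θ * δ := by gcongr
  linarith

set_option maxHeartbeats 400000 in
open Classical in
/-- Exponential moments of the number of unresolved pairs in base cases, for calls that are not too
large. -/
theorem expect_exp_basePairs_le (hinj : Function.Injective key)
    (hsymm : ∀ i j, res i j → res j i) (hL : 16 ≤ L) {θ : ℝ} (hθ0 : 0 ≤ θ) (B : ℕ)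
    (hθ : θ * (L + 72) ^ 2 * (B * √B) ≤ 1) (S : Finset (Fin n)) (hLS : L ≤ S.card)
    (hSB : S.card ≤ B) :
    𝔼 mark : Marking n, Real.exp (θ * basePairs key res L mark S)
      ≤ Real.exp (θ * basePotential L S.card) := by
  induction hm : S.card using Nat.strong_induction_on generalizing S with
  | _ m ih =>
    have hS : S.Nonempty := card_pos.1 (by omega)
    have hLr : (16 : ℝ) ≤ L := by exact_mod_cast hL
    have hL0 : (0 : ℝ) < L := by linarith
    have hmr : (S.card : ℝ) = m := by exact_mod_cast hm
    have hm1 : (1 : ℝ) ≤ m := by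
      rw [← hmr]
      exact_mod_cast hS.card_pos
    have hmpos : (0 : ℝ) < m := by linarith
    obtain ⟨N, hN⟩ : ∃ N : ↥(S.powersetCard (Nat.sqrt S.card)) → ℝ, N = fun M =>
      if RoutingDone key res S M.1 then ∑ c ∈ range (M.1.card + 1),
        (if (boxOf key S M.1 c).card < L then
          ((unrelatedPairs res (boxOf key S M.1 c)).card : ℝ) else 0) else 0 := ⟨_, rfl⟩
    obtain ⟨P, hP⟩ : ∃ P : ↥(S.powersetCard (Nat.sqrt S.card)) → ℝ, P = fun M =>
      ∑ c ∈ range (M.1.card + 1), basePotential L (boxOf key S M.1 c).card := ⟨_, rfl⟩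
    have hP0 : ∀ M, 0 ≤ P M := by
      intro M
      rw [hP]
      exact sum_nonneg fun c _ => basePotential_nonneg hL0.le (Nat.cast_nonneg _)
    have hN0 : ∀ M, 0 ≤ N M := by
      intro M
      simp only [hN]
      split_ifs
      · exact sum_nonneg fun c _ => by split_ifs <;> positivity
      · exact le_rfl
    have hsumbox : ∀ M : ↥(S.powersetCard (Nat.sqrt S.card)),
        ∑ c ∈ range (M.1.card + 1), ((boxOf key S M.1 c).card : ℝ) ≤ m := by
      intro M
      rw [← hmr, ← Nat.cast_sum, sum_card_box]
      exact_mod_cast card_le_card sdiff_subset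
    have hunrel : ∀ T : Finset (Fin n), T.card < L →
        ((unrelatedPairs res T).card : ℝ) ≤ L * T.card ∧
        ((unrelatedPairs res T).card : ℝ) ≤ (L : ℝ) ^ 2 := by
      intro T hT
      have h1 : ((unrelatedPairs res T).card : ℝ) ≤ (T.card : ℝ) ^ 2 := by
        exact_mod_cast card_unrelatedPairs_le res T
      have h2 : (T.card : ℝ) ≤ L := by exact_mod_cast hT.le
      have h3 : (0 : ℝ) ≤ T.card := Nat.cast_nonneg _
      exact ⟨by nlinarith, by nlinarith⟩
    -- bounds for `N`
    have hNm : ∀ M, N M ≤ L * m := by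
      intro M
      simp only [hN]
      split_ifs
      · refine le_trans (sum_le_sum (g := fun c => (L : ℝ) * (boxOf key S M.1 c).card)
          fun c _ => ?_) ?_
        · split_ifs with h
          · exact (hunrel _ h).1
          · positivity
        · rw [← mul_sum]
          gcongr
          exact hsumbox M
      · positivity
    have hNs : ∀ M, N M ≤ (√m + 1) * L ^ 2 := by
      intro M
      simp only [hN]
      split_ifs
      · refine le_trans (sum_le_sum (g := fun _ => (L : ℝ) ^ 2) fun c _ => ?_) ?_
        · split_ifs with h
          · exact (hunrel _ h).2
          · positivity
        · rw [sum_const, card_range, nsmul_eq_mul, (mem_powersetCard.1 M.2).2]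
          push_cast
          gcongr
          rw [← hmr]
          exact Real.nat_sqrt_le_real_sqrt
      · positivity
    have hPm : ∀ M, P M ≤ 72 * m := by
      intro M
      rw [hP]
      refine (sum_le_sum fun c _ => basePotential_le hL0 (Nat.cast_nonneg _)).trans ?_
      rw [← mul_sum]
      have := hsumbox M
      gcongr
    have hinner : ∀ M, 𝔼 mark : Marking n,
        Real.exp (θ * basePairs key res L (Function.update mark S M) S)
          ≤ Real.exp (θ * (N M + P M)) := by
      intro M
      refine (expect_exp_basePairs_update_le S hLS hS M (fun c =>
        (if (boxOf key S M.1 c).card < L then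
          ((unrelatedPairs res (boxOf key S M.1 c)).card : ℝ) else 0)
          + basePotential L (boxOf key S M.1 c).card) fun c _ => ?_).trans ?_
      · by_cases h : (boxOf key S M.1 c).card < L
        · rw [if_pos h, expect_congr rfl fun mark _ => by rw [basePairs_of_base h],
            Fintype.expect_const]
          have := basePotential_nonneg hL0.le (Nat.cast_nonneg (boxOf key S M.1 c).card)
          gcongr
          linarith
        · rw [if_neg h, zero_add]
          have hlt : (boxOf key S M.1 c).card < S.card := by
            have := card_box_marking_lt (key := key)
              (Function.update (Classical.arbitrary (Marking n)) S M) hS c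
            rwa [Function.update_self] at this
          exact ih _ (hlt.trans_eq hm) _ (not_lt.1 h) (hlt.le.trans hSB) rfl
      · gcongr
        simp only [hN, hP]
        split_ifs
        · rw [sum_add_distrib]
        · exact add_nonneg le_rfl (sum_nonneg fun c _ =>
            basePotential_nonneg hL0.le (Nat.cast_nonneg _))
    -- the exponent is small, so that the exponential is close to linear
    have hsmall : θ * (m * (L + 72)) ^ 2 ≤ √m := by
      have hmB : (m : ℝ) ≤ B := by exact_mod_cast hm ▸ hSB
      have h1 : (m : ℝ) * √m ≤ B * √B := by gcongr
      have h2 : θ * (L + 72) ^ 2 * (m * √m) ≤ 1 := le_trans (by gcongr) hθ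
      have h3 : √(m : ℝ) * √m = m := Real.mul_self_sqrt hmpos.le
      calc θ * (m * (L + 72)) ^ 2 = θ * (L + 72) ^ 2 * (m * (√m * √m)) := by rw [h3]; ring
        _ = θ * (L + 72) ^ 2 * (m * √m) * √m := by ring
        _ ≤ 1 * √m := by gcongr
        _ = √m := one_mul _
    have hx1 : θ * (m * (L + 72)) ≤ 1 := by
      have h1 : √(m : ℝ) ≤ m * (L + 72) := by
        have h2 : √(m : ℝ) ≤ m := Real.sqrt_le_iff.2 ⟨hmpos.le, by nlinarith⟩
        nlinarith
      have h2 : 0 < (m : ℝ) * (L + 72) := by positivity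
      by_contra h
      have := mul_lt_mul_of_pos_right (not_le.1 h) h2
      nlinarith
    have hexp : ∀ M, Real.exp (θ * (N M + P M)) ≤ 1 + θ * (N M + P M) + θ * √m := by
      intro M
      have h1 : N M + P M ≤ m * (L + 72) := by
        have := hNm M
        have := hPm M
        linarith
      exact exp_mul_le_of_small hθ0 (add_nonneg (hN0 M) (hP0 M)) h1 hx1 hsmall
    rw [expect_update S]
    refine (expect_le_expect fun M _ => (hinner M).trans (hexp M)).trans ?_
    rw [expect_add_distrib, expect_add_distrib, Fintype.expect_const, Fintype.expect_const,
      ← mul_expect, expect_add_distrib]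
    set EN := 𝔼 M, N M with hEN
    set EP := 𝔼 M, P M with hEP
    have hEN1 : EN ≤ 2 * m := by
      rw [← hmr]
      refine le_trans (expect_le_expect fun M _ => ?_) (expect_unrelatedPairs_box_le (key := key)
        hsymm S)
      simp only [hN]
      split_ifs
      · exact sum_le_sum fun c _ => by split_ifs <;> simp
      · exact le_rfl
    have hEN2 : EN ≤ (√m + 1) * L ^ 2 :=
      (expect_le_expect fun M _ => hNs M).trans (Fintype.expect_const _).le
    have hEP1 : EP ≤ 36 * (m * (2 * √m / (2 * √m + L)) + m * (2 * √m / (2 * √m + L ^ 2))) := by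
      rw [← hmr, hEP, hP]
      exact expect_sum_basePotential_le hinj S hL0
    have hstep := basePotential_step (r := √m) (N := EN) hLr
      (by rw [Real.sq_sqrt hmpos.le]; exact_mod_cast hm ▸ hLS) (Real.sqrt_nonneg _)
      (by rwa [Real.sq_sqrt hmpos.le]) hEN2
    rw [Real.sq_sqrt hmpos.le] at hstep
    calc 1 + θ * (EN + EP) + θ * √m ≤ θ * basePotential L m + 1 := by
          have : θ * (EN + EP + √m) ≤ θ * basePotential L m := by
            gcongr
            linarith
          linarith
      _ ≤ Real.exp (θ * basePotential L m) := Real.add_one_le_exp _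

end BasePairs

/-! ### The random choices are good with high probability -/

section HighProbability

open Finset Filter
open scoped BigOperators

variable {n : ℕ} {κ : Type} [LinearOrder κ] {key : Fin n → κ} {res : Fin n → Fin n → Prop} {L : ℕ}

open Classical in
lemma markingProb_basePairs_le (hinj : Function.Injective key)
    (hsymm : ∀ i j, res i j → res j i) (hL : 16 ≤ L) {θ : ℝ} (hθ0 : 0 ≤ θ) (B : ℕ)
    (hθ : θ * (L + 72) ^ 2 * (B * √B) ≤ 1) (S : Finset (Fin n)) (hLS : L ≤ S.card)
    (hbig : (√S.card + 1) * (L : ℝ) ^ 2 ≤ S.card) :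
    markingProb n (fun mark => (∀ c, (boxOf key S (mark S).1 c).card ≤ B) ∧
      74 * S.card ≤ basePairs key res L mark S) ≤ Real.exp (-(θ * S.card)) := by
  have hS : S.Nonempty := card_pos.1 (by omega)
  have hL0 : (0 : ℝ) < L := by
    have : 0 < L := by omega
    exact_mod_cast this
  have hab : Real.exp (-(θ * S.card))
      = Real.exp (θ * (73 * S.card)) / Real.exp (θ * (74 * S.card)) := by
    rw [← Real.exp_sub]
    congr 1
    ring
  rw [hab]
  refine markingProb_le_of_expect_le (f := fun mark =>
    if ∀ c, (boxOf key S (mark S).1 c).card ≤ B then Real.exp (θ * basePairs key res L mark S)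
    else 0) (Real.exp_pos _) (fun m => ?_) (fun m hm => ?_) ?_
  · split_ifs
    · exact (Real.exp_pos _).le
    · exact le_rfl
  · rw [if_pos hm.1]
    have : ((74 * S.card : ℕ) : ℝ) ≤ basePairs key res L m S := by exact_mod_cast hm.2
    push_cast at this
    gcongr
  · rw [expect_update S]
    refine (expect_le_expect (g := fun _ => Real.exp (θ * (73 * S.card))) fun M _ => ?_).trans
      (Fintype.expect_const _).le
    simp only [Function.update_self]
    split_ifs with hB
    · refine (expect_exp_basePairs_update_le S hLS hS M (fun c =>
        (L : ℝ) ^ 2 + 72 * (boxOf key S M.1 c).card) fun c _ => ?_).trans ?_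
      · by_cases h : (boxOf key S M.1 c).card < L
        · rw [expect_congr rfl fun mark _ => by rw [basePairs_of_base h], Fintype.expect_const]
          have h1 : ((unrelatedPairs res (boxOf key S M.1 c)).card : ℝ)
              ≤ ((boxOf key S M.1 c).card : ℝ) ^ 2 := by
            exact_mod_cast card_unrelatedPairs_le res _
          have h2 : ((boxOf key S M.1 c).card : ℝ) ≤ L := by exact_mod_cast h.le
          have h3 : (0 : ℝ) ≤ (boxOf key S M.1 c).card := Nat.cast_nonneg _
          gcongr
          nlinarith
        · refine (expect_exp_basePairs_le hinj hsymm hL hθ0 B hθ _ (not_lt.1 h) (hB c)).trans ?_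
          have h1 := basePotential_le hL0 (Nat.cast_nonneg (boxOf key S M.1 c).card)
          have h2 : 0 ≤ (L : ℝ) ^ 2 := by positivity
          gcongr
          linarith
      · gcongr
        split_ifs
        · rw [sum_add_distrib, sum_const, card_range, nsmul_eq_mul, ← mul_sum, ← Nat.cast_sum,
            sum_card_box, (mem_powersetCard.1 M.2).2]
          have h1 : (Nat.sqrt S.card : ℝ) ≤ √S.card := Real.nat_sqrt_le_real_sqrt
          have h2 : ((S \ M.1).card : ℝ) ≤ S.card := by exact_mod_cast card_le_card sdiff_subset
          have h3 : ((Nat.sqrt S.card + 1 : ℕ) : ℝ) * (L : ℝ) ^ 2 ≤ S.card := by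
            refine le_trans ?_ hbig
            push_cast
            gcongr
          linarith
        · positivity
    · rw [Fintype.expect_const]
      exact (Real.exp_pos _).le

lemma markingProb_card_box_gt_le (hinj : Function.Injective key) (S : Finset (Fin n)) {B k : ℕ}
    (hkB : k ≤ B) :
    markingProb n (fun mark => ¬ ∀ c, (boxOf key S (mark S).1 c).card ≤ B)
      ≤ S.card * ((k + 1) * √S.card ^ k / B.choose k) := by
  refine (markingProb_mono (E' := fun mark => ∃ e ∈ S,
    B.choose k ≤ (boxOf key S (mark S).1 (boxIndex key (mark S).1 e)).card.choose k) ?_).trans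
    ((markingProb_exists_le S _).trans ?_)
  · intro mark h
    obtain ⟨c, hc⟩ := not_forall.1 h
    obtain ⟨e, he⟩ := card_pos.1 ((Nat.zero_le B).trans_lt (not_le.1 hc))
    obtain ⟨h1, -, h3⟩ := mem_boxOf.1 he
    refine ⟨e, h1, ?_⟩
    rw [h3]
    exact Nat.choose_le_choose k (not_le.1 hc).le
  · rw [← nsmul_eq_mul, ← sum_const]
    refine sum_le_sum fun e _ => ?_
    refine markingProb_le_of_expect_le (f := fun mark =>
      ((boxOf key S (mark S).1 (boxIndex key (mark S).1 e)).card.choose k : ℝ))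
      (by exact_mod_cast Nat.choose_pos hkB) (fun m => Nat.cast_nonneg _)
      (fun m hm => by exact_mod_cast hm) ?_
    rw [expect_update S]
    simp only [Function.update_self, Fintype.expect_const]
    exact expect_choose_card_box_le hinj S k e

lemma markingProb_pathProduct_le (hinj : Function.Injective key) (S : Finset (Fin n)) {A T : ℝ}
    (hA : (Nat.factorial 200 : ℝ) ≤ A) (hT : 0 < T) :
    markingProb n (fun mark => ∃ e ∈ S, T ≤ pathProduct key mark e S)
      ≤ S.card * (A * (1 + S.card.choose 4) / T) := by
  refine (markingProb_exists_le S _).trans ?_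
  rw [← nsmul_eq_mul, ← sum_const]
  refine sum_le_sum fun e he => ?_
  exact markingProb_le_of_expect_le hT (fun m => Nat.cast_nonneg _) (fun m hm => hm)
    (expect_pathProduct_le hinj e S he hA)

lemma clog_two_le {n : ℕ} (hn : 2 ≤ n) : (Nat.clog 2 n : ℝ) ≤ 2 * Real.log n + 1 := by
  have h1 : 2 ^ (Nat.clog 2 n - 1) < n := Nat.pow_pred_clog_lt_self (by norm_num) (by omega)
  have h2 : ((Nat.clog 2 n - 1 : ℕ) : ℝ) * Real.log 2 ≤ Real.log n := by
    rw [← Real.log_pow]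
    exact Real.log_le_log (by positivity) (by exact_mod_cast h1.le)
  have h3 : (Nat.clog 2 n : ℝ) ≤ ((Nat.clog 2 n - 1 : ℕ) : ℝ) + 1 := by
    have : Nat.clog 2 n ≤ (Nat.clog 2 n - 1) + 1 := by omega
    exact_mod_cast this
  have h4 := Real.log_two_gt_d9
  have h5 : (0 : ℝ) ≤ ((Nat.clog 2 n - 1 : ℕ) : ℝ) := Nat.cast_nonneg _
  nlinarith

/-- The numerical conditions for large `n`: boxes of the top-level call have at most `n ^ (3 / 5)`
items, and the exponential moments are taken with parameter `8 * log n / n`. -/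
lemma eventually_parameters : ∀ᶠ n : ℕ in atTop,
    16 ≤ Nat.clog 2 n ∧ Nat.clog 2 n ≤ n ∧ 40 ≤ ⌊(n : ℝ) ^ (3 / 5 : ℝ)⌋₊ ∧
    8 * Real.log n / n * ((Nat.clog 2 n : ℝ) + 72) ^ 2 *
      ((⌊(n : ℝ) ^ (3 / 5 : ℝ)⌋₊ : ℝ) * √(⌊(n : ℝ) ^ (3 / 5 : ℝ)⌋₊ : ℝ)) ≤ 1 ∧
    (√(n : ℝ) + 1) * (Nat.clog 2 n : ℝ) ^ 2 ≤ n ∧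
    (n : ℝ) * ((((40 : ℕ) : ℝ) + 1) * √(n : ℝ) ^ 40 /
      (⌊(n : ℝ) ^ (3 / 5 : ℝ)⌋₊.choose 40 : ℝ)) ≤ 1 / (4 * n) ∧
    4 * (n : ℝ) ^ 4 * Real.exp (-(8 * Real.log n / n * n)) ≤ 1 / (4 * n) := by
  have hcast : Tendsto (fun n : ℕ => (n : ℝ)) atTop atTop := tendsto_natCast_atTop_atTop
  have hpow : Tendsto (fun n : ℕ => (n : ℝ) ^ (1 / 100 : ℝ)) atTop atTop :=
    (tendsto_rpow_atTop (by norm_num)).comp hcast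
  have hlog : ∀ᶠ n : ℕ in atTop, ‖Real.log n‖ ≤ 1 / 8 * ‖(n : ℝ) ^ (1 / 100 : ℝ)‖ :=
    hcast.eventually ((isLittleO_log_rpow_atTop (r := 1 / 100) (by norm_num)).def (by norm_num))
  obtain ⟨c, hc⟩ : ∃ c : ℝ, c = 41 * (2 ^ 40 * (Nat.factorial 40 : ℝ)) := ⟨_, rfl⟩
  filter_upwards [hlog, hpow.eventually_ge_atTop 200, hcast.eventually_ge_atTop (4 * c),
    eventually_gt_atTop (2 ^ 16), hcast.eventually_ge_atTop 1] with n h1 h2 h3 h4 hu1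
  set u : ℝ := (n : ℝ) with hu
  have hu0 : 0 < u := by linarith
  have hlog0 : 0 ≤ Real.log u := Real.log_nonneg hu1
  have hv0 : 0 ≤ u ^ (1 / 100 : ℝ) := by positivity
  rw [Real.norm_of_nonneg hlog0, Real.norm_of_nonneg hv0] at h1
  have hL := clog_two_le (n := n) (by omega)
  rw [← hu] at hL
  have hLv : (Nat.clog 2 n : ℝ) + 72 ≤ u ^ (1 / 100 : ℝ) := by linarith
  have hL0 : (0 : ℝ) ≤ Nat.clog 2 n := Nat.cast_nonneg _
  have hBle : (⌊u ^ (3 / 5 : ℝ)⌋₊ : ℝ) ≤ u ^ (3 / 5 : ℝ) := Nat.floor_le (by positivity)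
  have hBlt : u ^ (3 / 5 : ℝ) < (⌊u ^ (3 / 5 : ℝ)⌋₊ : ℝ) + 1 := Nat.lt_floor_add_one _
  have hB200 : 200 ≤ u ^ (3 / 5 : ℝ) :=
    h2.trans (Real.rpow_le_rpow_of_exponent_le hu1 (by norm_num))
  set B := ⌊u ^ (3 / 5 : ℝ)⌋₊ with hB
  have hB40 : 40 ≤ B := by
    have : (40 : ℝ) ≤ B := by linarith
    exact_mod_cast this
  refine ⟨?_, ?_, hB40, ?_, ?_, ?_, ?_⟩
  · have : 15 < Nat.clog 2 n := (Nat.lt_clog_iff_pow_lt (by norm_num)).2 (by omega)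
    omega
  · exact Nat.clog_le_of_le_pow Nat.lt_two_pow_self.le
  · have hsq : √(B : ℝ) ≤ u ^ (3 / 10 : ℝ) := by
      refine Real.sqrt_le_iff.2 ⟨by positivity, hBle.trans ?_⟩
      rw [← Real.rpow_natCast, ← Real.rpow_mul hu0.le]
      norm_num
    have h8 : 8 * Real.log u / u ≤ u ^ (1 / 100 : ℝ) * u ^ (-1 : ℝ) := by
      rw [Real.rpow_neg_one, div_eq_mul_inv]
      gcongr
      linarith
    calc 8 * Real.log u / u * ((Nat.clog 2 n : ℝ) + 72) ^ 2 * ((B : ℝ) * √(B : ℝ))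
        ≤ u ^ (1 / 100 : ℝ) * u ^ (-1 : ℝ) * (u ^ (1 / 100 : ℝ)) ^ 2
          * (u ^ (3 / 5 : ℝ) * u ^ (3 / 10 : ℝ)) := by gcongr
      _ = u ^ (-7 / 100 : ℝ) := by
          rw [← Real.rpow_natCast, ← Real.rpow_mul hu0.le, ← Real.rpow_add hu0,
            ← Real.rpow_add hu0, ← Real.rpow_add hu0, ← Real.rpow_add hu0]
          norm_num
      _ ≤ 1 := Real.rpow_le_one_of_one_le_of_nonpos hu1 (by norm_num)
  · have hs1 : √u + 1 ≤ u ^ (1 / 100 : ℝ) * u ^ (1 / 2 : ℝ) := by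
      rw [Real.sqrt_eq_rpow]
      have : 1 ≤ u ^ (1 / 2 : ℝ) := Real.one_le_rpow hu1 (by norm_num)
      nlinarith
    calc (√u + 1) * (Nat.clog 2 n : ℝ) ^ 2
        ≤ u ^ (1 / 100 : ℝ) * u ^ (1 / 2 : ℝ) * (u ^ (1 / 100 : ℝ)) ^ 2 := by
          gcongr
          linarith
      _ = u ^ (53 / 100 : ℝ) := by
          rw [← Real.rpow_natCast, ← Real.rpow_mul hu0.le, ← Real.rpow_add hu0,
            ← Real.rpow_add hu0]
          norm_num
      _ ≤ u ^ (1 : ℝ) := Real.rpow_le_rpow_of_exponent_le hu1 (by norm_num)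
      _ = u := Real.rpow_one u
  · have hchoose : ((B + 1 - 40 : ℕ) : ℝ) ^ 40 ≤ (Nat.factorial 40 : ℝ) * B.choose 40 := by
      have h := Nat.pow_le_choose (α := ℝ) 40 B
      rw [div_le_iff₀ (Nat.cast_pos.2 (Nat.factorial_pos 40))] at h
      linarith
    have hhalf : u ^ (3 / 5 : ℝ) / 2 ≤ ((B + 1 - 40 : ℕ) : ℝ) := by
      rw [Nat.cast_sub (by omega)]
      push_cast
      linarith
    have hpow24 : (u ^ (3 / 5 : ℝ)) ^ 40 = u ^ 24 := by
      rw [← Real.rpow_natCast, ← Real.rpow_mul hu0.le, ← Real.rpow_natCast u 24]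
      norm_num
    have hsqrt : √u ^ 40 = u ^ 20 := by
      rw [show (40 : ℕ) = 2 * 20 by norm_num, pow_mul, Real.sq_sqrt hu0.le]
    have hC0 : (0 : ℝ) < B.choose 40 := by exact_mod_cast Nat.choose_pos hB40
    have hlow : u ^ 24 ≤ 2 ^ 40 * (Nat.factorial 40 : ℝ) * B.choose 40 := by
      have : (u ^ (3 / 5 : ℝ) / 2) ^ 40 ≤ (Nat.factorial 40 : ℝ) * B.choose 40 :=
        (by gcongr : (u ^ (3 / 5 : ℝ) / 2) ^ 40 ≤ ((B + 1 - 40 : ℕ) : ℝ) ^ 40).trans hchoose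
      rw [div_pow, hpow24, div_le_iff₀ (by positivity)] at this
      linarith
    rw [hsqrt, ← mul_div_assoc, div_le_div_iff₀ hC0 (by positivity)]
    have h5 : 4 * c * u ^ 23 ≤ u ^ 24 := by
      calc 4 * c * u ^ 23 ≤ u * u ^ 23 := by gcongr
        _ = u ^ 24 := by ring
    have hc0 : 0 < c := by
      rw [hc]
      positivity
    have h6 : u ^ 22 ≤ u ^ 23 := pow_le_pow_right₀ hu1 (by norm_num)
    have h7 : 41 * (4 * u ^ 22) * c ≤ c * B.choose 40 := by
      calc 41 * (4 * u ^ 22) * c ≤ 41 * (4 * c * u ^ 23) := by nlinarith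
        _ ≤ 41 * u ^ 24 := by linarith
        _ ≤ 41 * (2 ^ 40 * (Nat.factorial 40 : ℝ) * B.choose 40) := by gcongr
        _ = c * B.choose 40 := by rw [hc]; ring
    have h8 : 41 * (4 * u ^ 22) ≤ (B.choose 40 : ℝ) := by nlinarith
    calc u * ((((40 : ℕ) : ℝ) + 1) * u ^ 20) * (4 * u) = 41 * (4 * u ^ 22) := by
          push_cast
          ring
      _ ≤ 1 * (B.choose 40 : ℝ) := by linarith
  · have h5 : Real.exp (-(8 * Real.log u / u * u)) = (u ^ 8)⁻¹ := by
      rw [div_mul_cancel₀ _ hu0.ne', Real.exp_neg, mul_comm, Real.exp_mul, Real.exp_log hu0]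
      norm_cast
    rw [h5, ← div_eq_mul_inv, div_le_div_iff₀ (by positivity) (by positivity)]
    have h16 : (16 : ℝ) ≤ u := by
      rw [hu]
      have : 16 ≤ n := by omega
      exact_mod_cast this
    calc 4 * u ^ 4 * (4 * u) = 16 * (u ^ 5 * 1) := by ring
      _ ≤ u * (u ^ 5 * u ^ 2) := by
          gcongr
          exact one_le_pow₀ hu1
      _ = 1 * u ^ 8 := by ring

/-- With probability at least `1 - 1 / n`, all path products are polynomial in `n`, and for all
resolution patterns of a given polynomial-size family, the number of unresolved pairs in reached
base cases is linear in `n`. -/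
theorem exists_whp_bounds : ∃ C K : ℕ, ∀ n : ℕ, 2 ≤ n → ∀ {κ : Type} [LinearOrder κ]
    {key : Fin n → κ}, Function.Injective key → ∀ {ι : Type} (I : Finset ι)
    (res : ι → Fin n → Fin n → Prop), (∀ a i j, res a i j → res a j i) → I.card ≤ 4 * n ^ 4 →
    1 - 1 / (n : ℝ) ≤ markingProb n fun mark =>
      (∀ e, pathProduct key mark e univ ≤ n ^ C) ∧
      ∀ a ∈ I, basePairs key (res a) (Nat.clog 2 n) mark univ ≤ K * n := by
  obtain ⟨N0, hN0⟩ := eventually_atTop.1 eventually_parameters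
  obtain ⟨A, hA⟩ : ∃ A : ℝ, A = (Nat.factorial 200 : ℝ) := ⟨_, rfl⟩
  have hA1 : 1 ≤ A := by
    rw [hA]
    exact Nat.one_le_cast.2 (Nat.factorial_pos 200)
  obtain ⟨j, hj⟩ := pow_unbounded_of_one_lt (8 * A) (one_lt_two : (1 : ℝ) < 2)
  refine ⟨6 + j, N0 + 74, ?_⟩
  intro n hn κ _ key hinj ι I res hsymm hI
  have hn2 : (2 : ℝ) ≤ n := by exact_mod_cast hn
  have hn0 : (0 : ℝ) < n := by linarith
  have hcard : (univ : Finset (Fin n)).card = n := by simp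
  have hpath : markingProb n (fun mark => ∃ e ∈ (univ : Finset (Fin n)),
      ((n ^ (6 + j) : ℕ) : ℝ) ≤ pathProduct key mark e univ) ≤ 1 / (4 * n) := by
    refine (markingProb_pathProduct_le hinj univ hA.ge
      (by positivity : (0 : ℝ) < ((n ^ (6 + j) : ℕ) : ℝ))).trans ?_
    rw [hcard, ← mul_div_assoc, div_le_div_iff₀ (by positivity) (by positivity)]
    have h1 : (n.choose 4 : ℝ) ≤ (n : ℝ) ^ 4 := by exact_mod_cast Nat.choose_le_pow n 4
    have h2 : (1 : ℝ) ≤ (n : ℝ) ^ 4 := one_le_pow₀ (by linarith)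
    have h3 : (2 : ℝ) ^ j ≤ (n : ℝ) ^ j := by gcongr
    push_cast
    calc (n : ℝ) * (A * (1 + n.choose 4)) * (4 * n)
        ≤ n * (A * (n ^ 4 + n ^ 4)) * (4 * n) := by gcongr
      _ = (8 * A) * (n : ℝ) ^ 6 := by ring
      _ ≤ (n : ℝ) ^ j * (n : ℝ) ^ 6 := by
          gcongr
          linarith
      _ = 1 * (n : ℝ) ^ (6 + j) := by ring
  have hmain : ∀ E : Marking n → Prop, (∀ mark, ¬ E mark → ∃ e ∈ (univ : Finset (Fin n)),
      ((n ^ (6 + j) : ℕ) : ℝ) ≤ pathProduct key mark e univ) → 1 - 1 / (n : ℝ) ≤ markingProb n E := by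
    intro E hE
    have h1 := one_sub_markingProb_not_le E
    have h2 := (markingProb_mono hE).trans hpath
    have h3 : 1 / (4 * (n : ℝ)) ≤ 1 / n := by
      gcongr
      linarith
    linarith
  by_cases hsmall : n < N0
  · -- for small `n` the second bound holds for trivial reasons
    refine hmain _ fun mark hm => ?_
    by_contra hno
    push Not at hno
    refine hm ⟨fun e => ?_, fun a _ => ?_⟩
    · exact_mod_cast (hno e (mem_univ e)).le
    · refine (basePairs_le_sq mark univ).trans ?_
      rw [hcard, sq]
      exact Nat.mul_le_mul_right _ (by omega)
  · obtain ⟨p1, p2, p3, p4, p5, p6, p7⟩ := hN0 n (not_lt.1 hsmall)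
    set L := Nat.clog 2 n
    set B := ⌊(n : ℝ) ^ (3 / 5 : ℝ)⌋₊
    have hθ0 : 0 ≤ 8 * Real.log n / n :=
      div_nonneg (mul_nonneg (by norm_num) (Real.log_nonneg (by linarith))) hn0.le
    have hbox : markingProb n (fun mark => ¬ ∀ c, (boxOf key univ (mark univ).1 c).card ≤ B)
        ≤ 1 / (4 * n) := by
      refine (markingProb_card_box_gt_le hinj univ p3).trans ?_
      rw [hcard]
      exact p6
    have hbase : markingProb n (fun mark => ∃ a ∈ I,
        (∀ c, (boxOf key univ (mark univ).1 c).card ≤ B) ∧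
          74 * (univ : Finset (Fin n)).card ≤ basePairs key (res a) L mark univ)
        ≤ 1 / (4 * n) := by
      refine (markingProb_exists_le I _).trans ?_
      refine (sum_le_sum fun a _ => markingProb_basePairs_le hinj (hsymm a) p1 hθ0 B p4 univ
        (by rw [hcard]; exact p2) (by rw [hcard]; exact p5)).trans ?_
      rw [sum_const, nsmul_eq_mul, hcard]
      refine le_trans ?_ p7
      gcongr
      exact_mod_cast hI
    have hbad : ∀ mark : Marking n, ¬ ((∀ e, pathProduct key mark e univ ≤ n ^ (6 + j)) ∧
        ∀ a ∈ I, basePairs key (res a) L mark univ ≤ (N0 + 74) * n) →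
        (∃ e ∈ (univ : Finset (Fin n)),
          ((n ^ (6 + j) : ℕ) : ℝ) ≤ pathProduct key mark e univ) ∨
        ((¬ ∀ c, (boxOf key univ (mark univ).1 c).card ≤ B) ∨ ∃ a ∈ I,
          (∀ c, (boxOf key univ (mark univ).1 c).card ≤ B) ∧
            74 * (univ : Finset (Fin n)).card ≤ basePairs key (res a) L mark univ) := by
      intro mark hm
      by_contra hno
      rw [not_or, not_or, not_not] at hno
      obtain ⟨h1, h2, h3⟩ := hno
      push Not at h1 h3
      refine hm ⟨fun e => ?_, fun a ha => ?_⟩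
      · exact_mod_cast (h1 e (mem_univ e)).le
      · have := h3 a ha h2
        rw [hcard] at this
        exact this.le.trans (Nat.mul_le_mul_right _ (by omega))
    have h1 := one_sub_markingProb_not_le (fun mark : Marking n =>
      (∀ e, pathProduct key mark e univ ≤ n ^ (6 + j)) ∧
        ∀ a ∈ I, basePairs key (res a) L mark univ ≤ (N0 + 74) * n)
    have h2 := (markingProb_mono hbad).trans ((markingProb_or_le _ _).trans
      (add_le_add le_rfl (markingProb_or_le _ _)))
    have h3 : 1 / (n : ℝ) = 4 * (1 / (4 * n)) := by
      field_simp
    have h4 : 0 < 1 / (4 * (n : ℝ)) := by positivity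
    linarith

end HighProbability

/-! ### Windows and the order of the items at the optimum -/

section Order

variable {n : ℕ} (x : Fin n → Item) (opt : ℝ)

/-- The order in which boxsort sorts the items: by value at the optimum, ties being broken by
index. -/
def itemKey (i : Fin n) : ℝ ×ₗ Fin n := toLex ((x i).eval opt, i)

/-- The optimum lies strictly inside the window. -/
def Window.Contains (W : Window) : Prop := W.lo < (opt : EReal) ∧ (opt : EReal) < W.hi

/-- The first window lies inside the second one. -/
def Window.Within (W' W : Window) : Prop := W.lo ≤ W'.lo ∧ W'.hi ≤ W.hi

/-- Two items of `S` with different slopes are equal at the optimum. -/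
def Conflict (S : Finset (Fin n)) : Prop :=
  ∃ i ∈ S, ∃ j ∈ S, (x i).slope ≠ (x j).slope ∧ (x i).eval opt = (x j).eval opt

variable {x opt}

lemma itemKey_injective : Function.Injective (itemKey x opt) := fun i j h => by
  simpa [itemKey] using congrArg (fun a => (ofLex a).2) h

lemma itemKey_lt_iff {i j : Fin n} : itemKey x opt i < itemKey x opt j ↔
    (x i).eval opt < (x j).eval opt ∨ (x i).eval opt = (x j).eval opt ∧ i < j := by
  simp [itemKey, Prod.Lex.toLex_lt_toLex]

lemma Window.Within.refl (W : Window) : W.Within W := ⟨le_rfl, le_rfl⟩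

lemma Window.Within.trans {W W' W'' : Window} (h : W''.Within W') (h' : W'.Within W) :
    W''.Within W := ⟨h'.1.trans h.1, h.2.trans h'.2⟩

lemma Item.root_comm (p q : Item) : p.root q = q.root p := by
  unfold Item.root
  rw [← neg_sub p.intercept, ← neg_sub q.slope, neg_div_neg_eq]

lemma Item.eval_sub_eval {p q : Item} (h : p.slope ≠ q.slope) (lam : ℝ) :
    p.eval lam - q.eval lam = (p.slope - q.slope) * (lam - p.root q) := by
  have : p.slope - q.slope ≠ 0 := sub_ne_zero.2 h
  unfold Item.eval Item.root
  field_simp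
  ring

lemma Window.Resolved.symm {W : Window} {i j : Fin n} (h : W.Resolved x i j) :
    W.Resolved x j i := by
  unfold Window.Resolved at h ⊢
  rw [Item.root_comm (x j) (x i)]
  exact h.imp Eq.symm id

lemma Window.Resolved.mono {W W' : Window} (hW : W'.Within W) {i j : Fin n}
    (h : W.Resolved x i j) : W'.Resolved x i j :=
  h.imp id fun h => h.imp (fun h => h.trans hW.1) fun h => hW.2.trans h

lemma Window.Contains.not_resolved {W : Window} (hW : W.Contains opt) {i j : Fin n}
    (hs : (x i).slope ≠ (x j).slope) (he : (x i).eval opt = (x j).eval opt) :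
    ¬ W.Resolved x i j := by
  have hroot : (x i).root (x j) = opt := by
    have h1 := Item.eval_sub_eval hs opt
    rw [he, sub_self, eq_comm, mul_eq_zero] at h1
    linarith [h1.resolve_left (sub_ne_zero.2 hs)]
  rintro (h | h | h)
  · exact hs h
  · rw [hroot] at h
    exact not_lt.2 h hW.1
  · rw [hroot] at h
    exact not_lt.2 h hW.2

/-- The outcomes that follow from the answers of the decision algorithm are those of the fixed
order at the optimum. -/
lemma Window.Contains.before_iff {W : Window} (hW : W.Contains opt) {i j : Fin n}
    (h : W.Resolved x i j) : W.Before x i j ↔ itemKey x opt i < itemKey x opt j := by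
  rw [itemKey_lt_iff]
  unfold Window.Before
  split_ifs with h1 h2
  · have : ∀ a b : ℝ, (x i).slope * opt + a = (x j).slope * opt + b ↔ a = b := by
      intro a b
      rw [h1]
      exact add_right_inj _
    have h' : ∀ a b : ℝ, (x i).slope * opt + a < (x j).slope * opt + b ↔ a < b := by
      intro a b
      rw [h1]
      exact add_lt_add_iff_left _
    unfold Item.eval
    rw [this, h']
  · have hlt : (x i).root (x j) < opt := EReal.coe_lt_coe_iff.1 (h2.trans_lt hW.1)
    have he := Item.eval_sub_eval h1 opt
    have hp : 0 < opt - (x i).root (x j) := by linarith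
    constructor
    · intro hs
      left
      have := mul_neg_of_neg_of_pos (sub_neg.2 hs) hp
      linarith
    · intro hs
      by_contra hge
      have : 0 < (x i).slope - (x j).slope := sub_pos.2 (lt_of_le_of_ne (not_lt.1 hge) (Ne.symm h1))
      have := mul_pos this hp
      rcases hs with hs | hs
      · linarith
      · linarith [hs.1]
  · have h3 : W.hi ≤ (((x i).root (x j) : ℝ) : EReal) := (h.resolve_left h1).resolve_left h2
    have hlt : opt < (x i).root (x j) := EReal.coe_lt_coe_iff.1 (hW.2.trans_le h3)
    have he := Item.eval_sub_eval h1 opt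
    have hp : opt - (x i).root (x j) < 0 := by linarith
    constructor
    · intro hs
      left
      have := mul_neg_of_pos_of_neg (sub_pos.2 hs) hp
      linarith
    · intro hs
      by_contra hge
      have : (x i).slope - (x j).slope < 0 := sub_neg.2 (lt_of_le_of_ne (not_lt.1 hge) h1)
      have := mul_pos_of_neg_of_neg this hp
      rcases hs with hs | hs
      · linarith
      · linarith [hs.1]

open Filter Topology in
/-- Since the decision problem is driven by sorting, the order changes at the optimum: two items
with different slopes cross there. -/
lemma IsSortingProblem.conflict_univ {B : ℝ → Prop} (h : IsSortingProblem x B opt) :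
    Conflict x opt Finset.univ := by
  by_contra hno
  have hne : ∀ i j, (x i).slope ≠ (x j).slope → (x i).eval opt ≠ (x j).eval opt :=
    fun i j hs he => hno ⟨i, Finset.mem_univ i, j, Finset.mem_univ j, hs, he⟩
  have hcont : ∀ (i : Fin n) (s : ℝ),
      Tendsto (fun t : ℝ => (x i).eval (opt + s * t)) (𝓝[>] 0) (𝓝 ((x i).eval opt)) := by
    intro i s
    have hc : Continuous fun t : ℝ => (x i).eval (opt + s * t) := by
      unfold Item.eval
      fun_prop
    have := (hc.tendsto 0).mono_left (nhdsWithin_le_nhds (s := Set.Ioi 0))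
    simpa using this
  have hev : ∀ᶠ t : ℝ in 𝓝[>] 0, ∀ i j, ((x i).eval (opt + (-1) * t) < (x j).eval (opt + (-1) * t) ↔
      (x i).eval (opt + 1 * t) < (x j).eval (opt + 1 * t)) := by
    rw [eventually_all]
    intro i
    rw [eventually_all]
    intro j
    by_cases hs : (x i).slope = (x j).slope
    · refine Eventually.of_forall fun t => ?_
      unfold Item.eval
      rw [hs, add_lt_add_iff_left, add_lt_add_iff_left]
    · rcases lt_or_gt_of_ne (hne i j hs) with hlt | hlt
      · filter_upwards [(hcont i (-1)).eventually_lt (hcont j (-1)) hlt,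
          (hcont i 1).eventually_lt (hcont j 1) hlt] with t h1 h2
        exact ⟨fun _ => h2, fun _ => h1⟩
      · filter_upwards [(hcont j (-1)).eventually_lt (hcont i (-1)) hlt,
          (hcont j 1).eventually_lt (hcont i 1) hlt] with t h1 h2
        exact ⟨fun h => absurd h (lt_asymm h1), fun h => absurd h (lt_asymm h2)⟩
  obtain ⟨t, ht, ht0⟩ := (hev.and self_mem_nhdsWithin).exists
  have ht0' : (0 : ℝ) < t := ht0
  exact h.false_above (opt + 1 * t) (by linarith)
    ((h.order_decides _ _ ht).1 (h.true_below _ (by linarith)))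

/-- Items that are equal at the optimum and have different slopes cannot be told apart, so that a
call whose routing is done has them in a common box. -/
lemma Conflict.exists_box {W : Window} (hW : W.Contains opt) {S M : Finset (Fin n)}
    (h : Conflict x opt S) (hd : RoutingDone (itemKey x opt) (W.Resolved x) S M) :
    ∃ c < M.card + 1, Conflict x opt (boxOf (itemKey x opt) S M c) := by
  obtain ⟨i, hi, j, hj, hs, he⟩ := h
  -- no marked item has the common value
  have hM : ∀ p ∈ M, (x p).eval opt ≠ (x i).eval opt := by
    intro p hp hpe
    obtain ⟨k, hk, hks, hke⟩ : ∃ k ∈ S, (x k).slope ≠ (x p).slope ∧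
        (x k).eval opt = (x i).eval opt := by
      by_cases hip : (x i).slope = (x p).slope
      · exact ⟨j, hj, fun h => hs (hip.trans h.symm), he.symm⟩
      · exact ⟨i, hi, hip, rfl⟩
    by_cases hkM : k ∈ M
    · refine hW.not_resolved hks (hke.trans hpe.symm) (hd.1 k hkM p hp ?_)
      rintro rfl
      exact hks rfl
    · -- a marked item with the common value that is nearest to `k` in the order
      obtain ⟨q, hq, hqk, hadj⟩ : ∃ q ∈ M, (x q).eval opt = (x k).eval opt ∧
          Adjacent (itemKey x opt) M k q := by
        have hsand : ∀ a b c : Fin n, (x a).eval opt = (x c).eval opt →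
            itemKey x opt a < itemKey x opt b → itemKey x opt b < itemKey x opt c →
            (x b).eval opt = (x c).eval opt := by
          intro a b c hac h1 h2
          rw [itemKey_lt_iff] at h1 h2
          rcases h1 with h1 | h1 <;> rcases h2 with h2 | h2
          · linarith
          · exact h2.1
          · linarith [h1.1]
          · exact h2.1
        have hpk : (x p).eval opt = (x k).eval opt := hpe.trans hke.symm
        have hne : k ≠ p := fun h => hkM (h ▸ hp)
        rcases lt_or_gt_of_ne (itemKey_injective.ne hne : itemKey x opt k ≠ itemKey x opt p)
          with hkp | hkp
        · obtain ⟨q, hq, hmin⟩ := Finset.exists_min_image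
            (M.filter fun q => itemKey x opt k < itemKey x opt q) (itemKey x opt)
            ⟨p, Finset.mem_filter.2 ⟨hp, hkp⟩⟩
          rw [Finset.mem_filter] at hq
          refine ⟨q, hq.1, ?_, fun r hr => ⟨fun h => ?_, fun h => ?_⟩⟩
          · rcases eq_or_lt_of_le (hmin p (Finset.mem_filter.2 ⟨hp, hkp⟩)) with h | h
            · rw [itemKey_injective h, hpk]
            · exact (hsand k q p hpk.symm hq.2 h).trans hpk
          · exact absurd h.2 (not_lt.2 (hmin r (Finset.mem_filter.2 ⟨hr, h.1⟩)))
          · exact absurd (h.1.trans h.2) (lt_asymm hq.2)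
        · obtain ⟨q, hq, hmax⟩ := Finset.exists_max_image
            (M.filter fun q => itemKey x opt q < itemKey x opt k) (itemKey x opt)
            ⟨p, Finset.mem_filter.2 ⟨hp, hkp⟩⟩
          rw [Finset.mem_filter] at hq
          refine ⟨q, hq.1, ?_, fun r hr => ⟨fun h => ?_, fun h => ?_⟩⟩
          · rcases eq_or_lt_of_le (hmax p (Finset.mem_filter.2 ⟨hp, hkp⟩)) with h | h
            · rw [← itemKey_injective h, hpk]
            · exact hsand p q k hpk h hq.2
          · exact absurd (h.1.trans h.2) (lt_asymm hq.2)
          · exact absurd h.1 (not_lt.2 (hmax r (Finset.mem_filter.2 ⟨hr, h.2⟩)))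
      by_cases hqs : (x k).slope = (x q).slope
      · refine hW.not_resolved (i := q) (j := p) (fun h => hks (hqs.trans h))
          ((hqk.trans hke).trans hpe.symm) (hd.1 q hq p hp ?_)
        rintro rfl
        exact hks hqs
      · exact hW.not_resolved hqs hqk.symm (hd.2 k (Finset.mem_sdiff.2 ⟨hk, hkM⟩) q hq hadj)
  have hiM : i ∉ M := fun h => hM i h rfl
  have hjM : j ∉ M := fun h => hM j h he.symm
  refine ⟨boxIndex (itemKey x opt) M i, Nat.lt_succ_of_le (boxIndex_le M i), i,
    mem_boxOf.2 ⟨hi, hiM, rfl⟩, j, mem_boxOf.2 ⟨hj, hjM, ?_⟩, hs, he⟩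
  rw [boxIndex_eq_iff]
  intro p hp
  have := hM p hp
  rw [itemKey_lt_iff, itemKey_lt_iff, he]
  have h' : ¬ (x p).eval opt = (x j).eval opt := he ▸ this
  simp [h']

end Order

/-! ### Lists of pairs and sorting -/

section Lists

variable {n : ℕ}

lemma length_allPairs_le (l : List (Fin n)) : (allPairs l).length ≤ l.length ^ 2 := by
  induction l with
  | nil => simp [allPairs]
  | cons a l ih =>
    simp only [allPairs, List.length_append, List.length_map, List.length_cons]
    nlinarith

lemma mem_of_mem_allPairs {l : List (Fin n)} {p : Fin n × Fin n} (h : p ∈ allPairs l) :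
    p.1 ∈ l ∧ p.2 ∈ l := by
  induction l with
  | nil => simp [allPairs] at h
  | cons a l ih =>
    simp only [allPairs, List.mem_append, List.mem_map] at h
    rcases h with ⟨b, hb, rfl⟩ | h
    · exact ⟨List.mem_cons_self, List.mem_cons_of_mem _ hb⟩
    · exact ⟨List.mem_cons_of_mem _ (ih h).1, List.mem_cons_of_mem _ (ih h).2⟩

lemma ne_of_mem_allPairs {l : List (Fin n)} (hl : l.Nodup) {p : Fin n × Fin n}
    (h : p ∈ allPairs l) : p.1 ≠ p.2 := by
  induction l with
  | nil => simp [allPairs] at h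
  | cons a l ih =>
    rw [List.nodup_cons] at hl
    simp only [allPairs, List.mem_append, List.mem_map] at h
    rcases h with ⟨b, hb, rfl⟩ | h
    · intro hab
      exact hl.1 ((show a = b from hab) ▸ hb)
    · exact ih hl.2 h

lemma nodup_allPairs {l : List (Fin n)} (hl : l.Nodup) : (allPairs l).Nodup := by
  induction l with
  | nil => simp [allPairs]
  | cons a l ih =>
    rw [List.nodup_cons] at hl
    simp only [allPairs]
    refine List.Nodup.append (hl.2.map fun b c h => by simpa using h) (ih hl.2) ?_
    intro p hp hp'
    obtain ⟨b, -, rfl⟩ := List.mem_map.1 hp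
    exact hl.1 (mem_of_mem_allPairs hp').1

lemma mem_allPairs_or {l : List (Fin n)} {i j : Fin n} (hi : i ∈ l) (hj : j ∈ l) (hij : i ≠ j) :
    (i, j) ∈ allPairs l ∨ (j, i) ∈ allPairs l := by
  induction l with
  | nil => simp at hi
  | cons a l ih =>
    simp only [allPairs, List.mem_append, List.mem_map]
    rcases List.mem_cons.1 hi with rfl | hi'
    · rcases List.mem_cons.1 hj with rfl | hj'
      · exact absurd rfl hij
      · exact Or.inl (Or.inl ⟨j, hj', rfl⟩)
    · rcases List.mem_cons.1 hj with rfl | hj'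
      · exact Or.inr (Or.inl ⟨i, hi', rfl⟩)
      · exact (ih hi' hj').imp Or.inr Or.inr

/-- Sorting with a relation that agrees with the order of the keys on distinct entries. -/
lemma pairwise_insertionSort_of_agree {κ : Type} [LinearOrder κ] {key : Fin n → κ}
    (hinj : Function.Injective key) (r : Fin n → Fin n → Prop) [DecidableRel r] {l : List (Fin n)}
    (hl : l.Nodup) (h : ∀ a ∈ l, ∀ b ∈ l, a ≠ b → (r a b ↔ key a < key b)) :
    (l.insertionSort r).Pairwise fun a b => key a < key b := by
  have hins : ∀ (a : Fin n) (l : List (Fin n)), a ∉ l → (∀ b ∈ l, r a b ↔ key a < key b) →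
      l.Pairwise (fun a b => key a < key b) →
      (l.orderedInsert r a).Pairwise fun a b => key a < key b := by
    intro a l
    induction l with
    | nil => simp
    | cons b l ih =>
      intro ha hr hp
      rw [List.pairwise_cons] at hp
      rw [List.orderedInsert_cons]
      split_ifs with hab
      · have hab' := (hr b List.mem_cons_self).1 hab
        rw [List.pairwise_cons]
        refine ⟨fun c hc => ?_, List.pairwise_cons.2 hp⟩
        rcases List.mem_cons.1 hc with rfl | hc
        · exact hab'
        · exact hab'.trans (hp.1 c hc)
      · have hba : key b < key a := by
          rcases lt_trichotomy (key a) (key b) with h | h | h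
          · exact absurd ((hr b List.mem_cons_self).2 h) hab
          · exact absurd (hinj h) fun h => ha (h ▸ List.mem_cons_self)
          · exact h
        rw [List.pairwise_cons]
        refine ⟨fun c hc => ?_, ih (fun h => ha (List.mem_cons_of_mem _ h))
          (fun c hc => hr c (List.mem_cons_of_mem _ hc)) hp.2⟩
        rcases List.mem_orderedInsert r |>.1 hc with rfl | hc
        · exact hba
        · exact hp.1 c hc
  induction l with
  | nil => simp
  | cons a l ih =>
    rw [List.nodup_cons] at hl
    rw [List.insertionSort_cons]
    refine hins a _ (by simpa using hl.1) (fun b hb => ?_) (ih hl.2 fun a ha b hb =>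
      h a (List.mem_cons_of_mem _ ha) b (List.mem_cons_of_mem _ hb))
    have hb' : b ∈ l := by simpa using hb
    exact h a List.mem_cons_self b (List.mem_cons_of_mem _ hb') fun h => hl.1 (h ▸ hb')

end Lists

/-! ### Routing trees -/

section Trees

variable {n : ℕ} {κ : Type} [LinearOrder κ] (key : Fin n → κ)

/-- The marked items of a tree, from left to right. -/
def RoutingTree.elems : RoutingTree n → List (Fin n)
  | .leaf _ => []
  | .node l p r => l.elems ++ p :: r.elems

def RoutingTree.height : RoutingTree n → ℕ
  | .leaf _ => 0
  | .node l _ r => max l.height r.height + 1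

/-- The box in which a search for item `i` ends. -/
def RoutingTree.boxAt (i : Fin n) : RoutingTree n → ℕ
  | .leaf c => c
  | .node l p r => if key i < key p then l.boxAt i else r.boxAt i

variable {key}

lemma balancedTree_of_drop_nil {first : ℕ} {l : List (Fin n)} (h : l.drop (l.length / 2) = []) :
    balancedTree first l = .leaf first := by
  rw [balancedTree]
  split
  · rfl
  · rename_i h'
    rw [h] at h'
    cases h'

lemma balancedTree_of_drop_cons {first : ℕ} {l : List (Fin n)} {p : Fin n} {r : List (Fin n)}
    (h : l.drop (l.length / 2) = p :: r) : balancedTree first l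
      = .node (balancedTree first (l.take (l.length / 2))) p
        (balancedTree (first + l.length / 2 + 1) r) := by
  rw [balancedTree]
  split
  · rename_i h'
    rw [h] at h'
    cases h'
  · rename_i p' r' h'
    rw [h] at h'
    cases h'
    rfl

/-- The balanced search tree has the given items, numbers its boxes by the items before them, and
has logarithmic height. -/
lemma balancedTree_spec (l : List (Fin n)) : ∀ first : ℕ,
    (balancedTree first l).elems = l ∧
    (l ≠ [] → 2 ^ (balancedTree first l).height ≤ 2 * l.length) ∧
    (l.Pairwise (fun a b => key a < key b) → ∀ i ∉ l, Function.Injective key →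
      (balancedTree first l).boxAt key i = first + (l.filter fun p => key p < key i).length) := by
  induction hm : l.length using Nat.strong_induction_on generalizing l with
  | _ m ih =>
    intro first
    cases h : l.drop (l.length / 2) with
    | nil =>
      have hl : l = [] := by
        have := congrArg List.length h
        rw [List.length_drop, List.length_nil] at this
        exact List.length_eq_zero_iff.1 (by omega)
      rw [balancedTree_of_drop_nil h, hl]
      exact ⟨rfl, fun h => absurd rfl h, fun _ _ _ _ => rfl⟩
    | cons p r =>
      have hlen := congrArg List.length h
      rw [List.length_drop, List.length_cons] at hlen
      have hsplit : l = l.take (l.length / 2) ++ p :: r := by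
        rw [← h, List.take_append_drop]
      have htl : (l.take (l.length / 2)).length = l.length / 2 := by
        rw [List.length_take]
        omega
      obtain ⟨a1, a2, a3⟩ := ih _ (by rw [← hm, htl]; omega) (l.take (l.length / 2)) rfl first
      obtain ⟨b1, b2, b3⟩ := ih r.length (by omega) r rfl (first + l.length / 2 + 1)
      rw [balancedTree_of_drop_cons h]
      refine ⟨?_, fun _ => ?_, fun hp i hi hinj => ?_⟩
      · simp only [RoutingTree.elems]
        rw [a1, b1, ← hsplit]
      · simp only [RoutingTree.height]
        rw [pow_succ, mul_comm]
        refine Nat.mul_le_mul_left 2 ?_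
        have hleft : 2 ^ (balancedTree first (l.take (l.length / 2))).height ≤ m := by
          by_cases h0 : l.take (l.length / 2) = []
          · rw [balancedTree_of_drop_nil (by simp [h0])]
            simp only [RoutingTree.height]
            omega
          · have := a2 h0
            rw [htl] at this
            omega
        have hright : 2 ^ (balancedTree (first + l.length / 2 + 1) r).height ≤ m := by
          by_cases h0 : r = []
          · rw [balancedTree_of_drop_nil (by simp [h0])]
            simp only [RoutingTree.height]
            omega
          · have := b2 h0
            omega
        rcases le_total (balancedTree first (l.take (l.length / 2))).height
          (balancedTree (first + l.length / 2 + 1) r).height with hle | hle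
        · rwa [max_eq_right hle]
        · rwa [max_eq_left hle]
      · rw [hsplit, List.pairwise_append, List.pairwise_cons] at hp
        obtain ⟨hp1, ⟨hp2, hp3⟩, hp4⟩ := hp
        have hi' : i ∉ l.take (l.length / 2) ∧ i ≠ p ∧ i ∉ r := by
          rw [hsplit] at hi
          simpa [not_or] using hi
        simp only [RoutingTree.boxAt]
        rw [a3 hp1 i hi'.1 hinj, b3 hp3 i hi'.2.2 hinj]
        conv_rhs => rw [hsplit, List.filter_append, List.length_append]
        split_ifs with hip
        · have : ((p :: r).filter fun q => key q < key i) = [] := by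
            rw [List.filter_eq_nil_iff]
            intro q hq
            rcases List.mem_cons.1 hq with rfl | hq
            · simpa using hip.le
            · simpa using (hip.trans (hp2 q hq)).le
          rw [this, List.length_nil, add_zero]
        · have hpi : key p < key i := lt_of_le_of_ne (not_lt.1 hip) (hinj.ne hi'.2.1.symm)
          have : ((l.take (l.length / 2)).filter fun q => key q < key i)
              = l.take (l.length / 2) := by
            rw [List.filter_eq_self]
            intro q hq
            simpa using (hp4 q hq p List.mem_cons_self).trans hpi
          rw [this, htl, List.filter_cons_of_pos (by simpa using hpi), List.length_cons]
          omega

end Trees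

/-! ### Walking down a routing tree -/

section Walk

variable {n : ℕ} (x : Fin n → Item) (opt : ℝ)

/-- The state of the routing of item `i` through the tree of the marked items `M`: the search goes
on in the subtree `t` with weight `w`, and the comparisons of `i` with neighbouring marked items
outside `t` are resolved.  The last condition keeps the weight above `ω` along the whole path. -/
structure Routed (W : Window) (M : Finset (Fin n)) (ω : ℝ) (i : Fin n) (t : RoutingTree n)
    (w : ℝ) : Prop where
  sorted : t.elems.Pairwise fun a b => itemKey x opt a < itemKey x opt b
  subset : ∀ p ∈ t.elems, p ∈ M
  outside : ∀ p ∈ M, Adjacent (itemKey x opt) M i p → p ∈ t.elems ∨ W.Resolved x i p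
  boxAt_eq : t.boxAt (itemKey x opt) i = boxIndex (itemKey x opt) M i
  weight : ω * 2 ^ t.height ≤ 2 * w

/-- The comparison at the root of a tree, if there is one, is resolved. -/
def HeadResolved (W : Window) (i : Fin n) : RoutingTree n → Prop
  | .leaf _ => True
  | .node _ p _ => W.Resolved x i p

open Classical in
/-- The weight passed on from the comparison at the root of a tree: half of it if the comparison is
resolved. -/
noncomputable def passedWeight (W : Window) (a : Fin n × RoutingTree n × ℝ) : ℝ :=
  if HeadResolved x W a.1 a.2.1 then a.2.2 / 2 else a.2.2

/-- The subtree in which a probe goes on. -/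
def Probe.tree (p : Probe n) : RoutingTree n := .node p.left p.pivot p.right

variable {x opt}

lemma Routed.mono {W W' : Window} (hW : W'.Within W) {M : Finset (Fin n)} {ω : ℝ} {i : Fin n}
    {t : RoutingTree n} {w : ℝ} (h : Routed x opt W M ω i t w) : Routed x opt W' M ω i t w :=
  ⟨h.sorted, h.subset, fun p hp ha => (h.outside p hp ha).imp id fun h => h.mono hW, h.boxAt_eq,
    h.weight⟩

lemma Routed.left {W : Window} {M : Finset (Fin n)} {ω : ℝ} {i p : Fin n}
    {l r : RoutingTree n} {w : ℝ} (hω : 0 < ω) (h : Routed x opt W M ω i (.node l p r) w)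
    (hip : itemKey x opt i < itemKey x opt p) (hr : W.Resolved x i p) :
    Routed x opt W M ω i l (share w 1) := by
  have hs := h.sorted
  simp only [RoutingTree.elems, List.pairwise_append, List.pairwise_cons] at hs
  refine ⟨hs.1, fun q hq => h.subset q (by simp [RoutingTree.elems, hq]), fun q hq ha => ?_, ?_, ?_⟩
  · rcases h.outside q hq ha with hq' | hq'
    · simp only [RoutingTree.elems, List.mem_append, List.mem_cons] at hq'
      rcases hq' with hq' | rfl | hq'
      · exact Or.inl hq'
      · exact Or.inr hr
      · exact absurd ⟨hip, hs.2.1.1 q hq'⟩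
          (ha p (h.subset p (by simp [RoutingTree.elems]))).1
    · exact Or.inr hq'
  · have := h.boxAt_eq
    simpa [RoutingTree.boxAt, hip] using this
  · have h1 := h.weight
    have h2 : (2 : ℝ) ^ l.height ≤ 2 ^ max l.height r.height :=
      pow_le_pow_right₀ (by norm_num) (le_max_left _ _)
    simp only [RoutingTree.height, pow_succ] at h1
    unfold share
    nlinarith

lemma Routed.right {W : Window} {M : Finset (Fin n)} {ω : ℝ} {i p : Fin n}
    {l r : RoutingTree n} {w : ℝ} (hω : 0 < ω) (h : Routed x opt W M ω i (.node l p r) w)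
    (hip : itemKey x opt p < itemKey x opt i) (hr : W.Resolved x i p) :
    Routed x opt W M ω i r (share w 1) := by
  have hs := h.sorted
  simp only [RoutingTree.elems, List.pairwise_append, List.pairwise_cons] at hs
  refine ⟨hs.2.1.2, fun q hq => h.subset q (by simp [RoutingTree.elems, hq]), fun q hq ha => ?_,
    ?_, ?_⟩
  · rcases h.outside q hq ha with hq' | hq'
    · simp only [RoutingTree.elems, List.mem_append, List.mem_cons] at hq'
      rcases hq' with hq' | rfl | hq'
      · exact absurd ⟨hs.2.2 q hq' p (by simp), hip⟩
          (ha p (h.subset p (by simp [RoutingTree.elems]))).2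
      · exact Or.inr hr
      · exact Or.inl hq'
    · exact Or.inr hq'
  · have := h.boxAt_eq
    simpa [RoutingTree.boxAt, lt_asymm hip] using this
  · have h1 := h.weight
    have h2 : (2 : ℝ) ^ r.height ≤ 2 ^ max l.height r.height :=
      pow_le_pow_right₀ (by norm_num) (le_max_right _ _)
    simp only [RoutingTree.height, pow_succ] at h1
    unfold share
    nlinarith

lemma Routed.pos {W : Window} {M : Finset (Fin n)} {ω : ℝ} {i : Fin n} {t : RoutingTree n} {w : ℝ}
    (hω : 0 < ω) (h : Routed x opt W M ω i t w) : 0 < w := by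
  have h1 := h.weight
  have h2 : 0 < ω * 2 ^ t.height := by positivity
  linarith

lemma Routed.le_weight {W : Window} {M : Finset (Fin n)} {ω : ℝ} {p : Probe n}
    (hω : 0 < ω) (h : Routed x opt W M ω p.item p.tree p.weight) : ω ≤ p.weight := by
  have h1 := h.weight
  simp only [Probe.tree, RoutingTree.height, pow_succ] at h1
  have h2 : (1 : ℝ) ≤ 2 ^ max p.left.height p.right.height := one_le_pow₀ (by norm_num)
  nlinarith

lemma walk_spec {W : Window} (hW : W.Contains opt) {M : Finset (Fin n)} {ω : ℝ} (hω : 0 < ω)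
    {i : Fin n} (hi : i ∉ M) : ∀ (t : RoutingTree n) (w : ℝ), Routed x opt W M ω i t w →
    (∀ c, (walk x W i t w).val = .inl c → c = boxIndex (itemKey x opt) M i ∧
      (∀ p ∈ M, Adjacent (itemKey x opt) M i p → W.Resolved x i p) ∧ HeadResolved x W i t ∧
      (walk x W i t w).steps ≤ t.height + 1) ∧
    (∀ p, (walk x W i t w).val = .inr p → p.item = i ∧ Routed x opt W M ω i p.tree p.weight ∧
      ¬ W.Resolved x i p.pivot ∧ p.weight ≤ passedWeight x W (i, t, w) ∧
      (walk x W i t w).steps + p.tree.height ≤ t.height + 1) := by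
  intro t
  induction t with
  | leaf c =>
    intro w h
    refine ⟨fun d hd => ?_, fun p hp => ?_⟩
    · simp only [walk, Timed.bind_val, Timed.pure_val, Sum.inl.injEq] at hd
      subst hd
      refine ⟨h.boxAt_eq, fun p hp ha => ?_, trivial, by simp [walk]⟩
      exact (h.outside p hp ha).resolve_left (by simp [RoutingTree.elems])
    · simp [walk] at hp
  | node l q r ihl ihr =>
    intro w h
    by_cases hres : W.Resolved x i q
    · have hqM : q ∈ M := h.subset q (by simp [RoutingTree.elems])
      have hne : i ≠ q := fun h => hi (h ▸ hqM)
      have hpass : passedWeight x W (i, .node l q r, w) = share w 1 := by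
        rw [passedWeight, if_pos (show HeadResolved x W i (.node l q r) from hres), share, mul_one]
      have hle : ∀ a : Fin n × RoutingTree n × ℝ, 0 < a.2.2 → passedWeight x W a ≤ a.2.2 := by
        intro a ha
        unfold passedWeight
        split_ifs <;> linarith
      by_cases hb : W.Before x i q
      · have hw : walk x W i (.node l q r) w = (do tick 1; walk x W i l (share w 1)) := by
          simp [walk, hres, hb]
        have hR := h.left hω ((hW.before_iff hres).1 hb) hres
        obtain ⟨h1, h2⟩ := ihl _ hR
        rw [hw, hpass]
        simp only [Timed.bind_val, Timed.bind_steps, Timed.tick_steps, RoutingTree.height]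
        refine ⟨fun c hc => ?_, fun p hp => ?_⟩
        · obtain ⟨e1, e2, -, e4⟩ := h1 c hc
          exact ⟨e1, e2, hres, by have := le_max_left l.height r.height; omega⟩
        · obtain ⟨e1, e2, e3, e4, e5⟩ := h2 p hp
          exact ⟨e1, e2, e3, e4.trans (hle (i, l, share w 1) (hR.pos hω)),
            by have := le_max_left l.height r.height; omega⟩
      · have hw : walk x W i (.node l q r) w = (do tick 1; walk x W i r (share w 1)) := by
          simp [walk, hres, hb]
        have hlt : itemKey x opt q < itemKey x opt i :=
          lt_of_le_of_ne (not_lt.1 fun h => hb ((hW.before_iff hres).2 h))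
            (itemKey_injective.ne hne.symm)
        have hR := h.right hω hlt hres
        obtain ⟨h1, h2⟩ := ihr _ hR
        rw [hw, hpass]
        simp only [Timed.bind_val, Timed.bind_steps, Timed.tick_steps, RoutingTree.height]
        refine ⟨fun c hc => ?_, fun p hp => ?_⟩
        · obtain ⟨e1, e2, -, e4⟩ := h1 c hc
          exact ⟨e1, e2, hres, by have := le_max_right l.height r.height; omega⟩
        · obtain ⟨e1, e2, e3, e4, e5⟩ := h2 p hp
          exact ⟨e1, e2, e3, e4.trans (hle (i, r, share w 1) (hR.pos hω)),
            by have := le_max_right l.height r.height; omega⟩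
    · have hw : walk x W i (.node l q r) w = (do tick 1; pure (.inr ⟨i, w, l, q, r⟩)) := by
        simp [walk, hres]
      rw [hw]
      refine ⟨fun c hc => by simp at hc, fun p hp => ?_⟩
      simp only [Timed.bind_val, Timed.pure_val, Sum.inr.injEq] at hp
      subst hp
      refine ⟨rfl, h, hres, ?_, ?_⟩
      · rw [passedWeight, if_neg (show ¬ HeadResolved x W i (.node l q r) from hres)]
      · simp [Probe.tree, add_comm]

/-- What routing a list of items does: each of them is settled in its box, or waits at an
unresolved comparison further down its path. -/
lemma walkAll_spec {W : Window} (hW : W.Contains opt) {M : Finset (Fin n)} {ω : ℝ} (hω : 0 < ω) :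
    ∀ todo : List (Fin n × RoutingTree n × ℝ),
    (∀ a ∈ todo, a.1 ∉ M ∧ Routed x opt W M ω a.1 a.2.1 a.2.2) →
    ((walkAll x W todo).val.1.map Probe.item ++ (walkAll x W todo).val.2.map Prod.fst).Perm
      (todo.map Prod.fst) ∧
    (∀ p ∈ (walkAll x W todo).val.1, Routed x opt W M ω p.item p.tree p.weight ∧
      ¬ W.Resolved x p.item p.pivot) ∧
    (∀ s ∈ (walkAll x W todo).val.2, s.2 = boxIndex (itemKey x opt) M s.1 ∧
      ∀ p ∈ M, Adjacent (itemKey x opt) M s.1 p → W.Resolved x s.1 p) ∧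
    ((walkAll x W todo).val.1 = [] → ∀ a ∈ todo, HeadResolved x W a.1 a.2.1) ∧
    ((walkAll x W todo).val.1.map Probe.weight).sum ≤ (todo.map (passedWeight x W)).sum ∧
    (walkAll x W todo).steps + ((walkAll x W todo).val.1.map fun p => p.tree.height).sum
      ≤ (todo.map fun a => a.2.1.height + 2).sum := by
  intro todo
  induction todo with
  | nil =>
    intro _
    simp [walkAll]
  | cons a todo ih =>
    intro h
    obtain ⟨i, t, w⟩ := a
    obtain ⟨h1, h2, h3, h4, h5, h6⟩ := ih fun a ha => h a (List.mem_cons_of_mem _ ha)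
    obtain ⟨hi, hR⟩ := h (i, t, w) List.mem_cons_self
    obtain ⟨hl, hr⟩ := walk_spec hW hω hi t w hR
    have hpass0 : 0 ≤ passedWeight x W (i, t, w) := by
      have := hR.pos hω
      unfold passedWeight
      split_ifs
      · exact (half_pos this).le
      · exact this.le
    cases hv : (walk x W i t w).val with
    | inl c =>
      obtain ⟨e1, e2, e3, e4⟩ := hl c hv
      have hval : (walkAll x W ((i, t, w) :: todo)).val
          = ((walkAll x W todo).val.1, (i, c) :: (walkAll x W todo).val.2) := by
        simp only [walkAll, Timed.bind_val, hv, Timed.pure_val]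
      have hst : (walkAll x W ((i, t, w) :: todo)).steps
          = (walk x W i t w).steps + ((walkAll x W todo).steps + 1) := by
        simp only [walkAll, Timed.bind_steps, hv, Timed.pure_steps, Timed.tick_steps]
      rw [hval, hst]
      refine ⟨?_, h2, ?_, ?_, ?_, ?_⟩
      · simp only [List.map_cons]
        exact List.perm_middle.trans (h1.cons i)
      · intro s hs
        rcases List.mem_cons.1 hs with rfl | hs
        · exact ⟨e1, e2⟩
        · exact h3 s hs
      · intro hnil a ha
        rcases List.mem_cons.1 ha with rfl | ha
        · exact e3
        · exact h4 hnil a ha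
      · simp only [List.map_cons, List.sum_cons]
        linarith
      · replace e4 : (walk x W i t w).steps ≤ t.height + 1 := e4
        simp only [List.map_cons, List.sum_cons]
        omega
    | inr p =>
      obtain ⟨e1, e2, e3, e4, e5⟩ := hr p hv
      have hval : (walkAll x W ((i, t, w) :: todo)).val
          = (p :: (walkAll x W todo).val.1, (walkAll x W todo).val.2) := by
        simp only [walkAll, Timed.bind_val, hv, Timed.pure_val]
      have hst : (walkAll x W ((i, t, w) :: todo)).steps
          = (walk x W i t w).steps + ((walkAll x W todo).steps + 1) := by
        simp only [walkAll, Timed.bind_steps, hv, Timed.pure_steps, Timed.tick_steps]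
      rw [hval, hst]
      refine ⟨?_, ?_, h3, fun hnil => absurd hnil (List.cons_ne_nil _ _), ?_, ?_⟩
      · simp only [List.map_cons, List.cons_append, e1]
        exact h1.cons i
      · intro q hq
        rcases List.mem_cons.1 hq with rfl | hq
        · rw [e1]
          exact ⟨e2, e3⟩
        · exact h2 q hq
      · simp only [List.map_cons, List.sum_cons]
        linarith
      · replace e5 : (walk x W i t w).steps + p.tree.height ≤ t.height + 1 := e5
        simp only [List.map_cons, List.sum_cons]
        omega

end Walk

/-! ### Invariants of the active calls -/

section Invariants

open Finset
open scoped BigOperators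

variable {n : ℕ} (x : Fin n → Item) (opt : ℝ) (mark : Marking n) (Q : ℝ)

/-- The number of unresolved ordered pairs in base cases below the call on `S`, when the optimum is
known to lie in the window `W`. -/
noncomputable def pairsBelow (W : Window) (S : Finset (Fin n)) : ℕ :=
  basePairs (itemKey x opt) (W.Resolved x) (Nat.clog 2 n) mark S

/-- The weight `w` of the initial comparisons of a call on `S` is positive, and so large, compared
to `1 / Q`, that it stays at least `1 / Q` on all paths through the recursion: a call on `m` items
divides the weight by `4 * m ^ 4.5`, which for `m ≥ 2` is less than `m ^ 7`. -/
def HeavyEnough (w : ℝ) (S : Finset (Fin n)) : Prop :=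
  0 < w ∧ ∀ e ∈ S, (pathProduct (itemKey x opt) mark e S : ℝ) ^ 7 ≤ Q * w

/-- A lower bound for the weights of the routing comparisons in a call on `m` items whose initial
comparisons have weight `w`. -/
noncomputable def minRoutingWeight (w m : ℝ) : ℝ := routingWeight w m / √m

/-- Invariant of a base case on the items `S`. -/
structure BaseInv (W : Window) (w : ℝ) (pending : List (Fin n × Fin n)) (S : Finset (Fin n)) :
    Prop where
  nonempty : S.Nonempty
  weight_pos : 0 < w
  weight : 1 ≤ Q * w
  card_lt : S.card < Nat.clog 2 n
  ne_nil : pending ≠ []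
  nodup : pending.Nodup
  of_mem : ∀ p ∈ pending, p.1 ∈ S ∧ p.2 ∈ S ∧ p.1 ≠ p.2 ∧ ¬ W.Resolved x p.1 p.2
  complete : ∀ i ∈ S, ∀ j ∈ S, i ≠ j → W.Resolved x i j ∨ (i, j) ∈ pending ∨ (j, i) ∈ pending

/-- Invariant of a call on the items `S` that is sorting its marked items. -/
structure SortingInv (W : Window) (w : ℝ) (items marked : List (Fin n))
    (pending : List (Fin n × Fin n)) (S : Finset (Fin n)) : Prop where
  items_nodup : items.Nodup
  items_eq : items.toFinset = S
  marked_nodup : marked.Nodup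
  marked_eq : marked.toFinset = (mark S).1
  le_card : Nat.clog 2 n ≤ S.card
  heavy : HeavyEnough x opt mark Q w S
  ne_nil : pending ≠ []
  length_le : pending.length ≤ S.card
  of_mem : ∀ p ∈ pending, ¬ W.Resolved x p.1 p.2
  complete : ∀ i ∈ marked, ∀ j ∈ marked, i ≠ j →
    W.Resolved x i j ∨ (i, j) ∈ pending ∨ (j, i) ∈ pending

/-- Invariant of a call on the items `S` that is routing its unmarked items. -/
structure RoutingInv (W : Window) (w : ℝ) (size numMarked : ℕ) (pending : List (Probe n))
    (settled : List (Fin n × ℕ)) (S : Finset (Fin n)) : Prop where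
  size_eq : size = S.card
  numMarked_eq : numMarked = (mark S).1.card
  le_card : Nat.clog 2 n ≤ S.card
  heavy : HeavyEnough x opt mark Q w S
  marked_resolved : ∀ i ∈ (mark S).1, ∀ j ∈ (mark S).1, i ≠ j → W.Resolved x i j
  ne_nil : pending ≠ []
  nodup : (pending.map Probe.item ++ settled.map Prod.fst).Nodup
  mem_iff : ∀ i, i ∈ pending.map Probe.item ++ settled.map Prod.fst ↔ i ∈ S \ (mark S).1
  of_settled : ∀ s ∈ settled, s.2 = boxIndex (itemKey x opt) (mark S).1 s.1 ∧
    ∀ p ∈ (mark S).1, Adjacent (itemKey x opt) (mark S).1 s.1 p → W.Resolved x s.1 p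
  of_mem : ∀ p ∈ pending,
    Routed x opt W (mark S).1 (minRoutingWeight w S.card) p.item p.tree p.weight ∧
      ¬ W.Resolved x p.item p.pivot

/-- Invariant of an active call on the items `S`. -/
def CallInv (W : Window) : Call n → Finset (Fin n) → Prop
  | .base w pending, S => BaseInv x Q W w pending S
  | .sorting w items marked pending, S => SortingInv x opt mark Q W w items marked pending S
  | .routing w size numMarked pending settled, S =>
    RoutingInv x opt mark Q W w size numMarked pending settled S

open Classical in
/-- The unresolved pairs of base cases that a call will still meet, if the window shrinks to `W`
at once. -/
noncomputable def callPairs (W : Window) : Call n → Finset (Fin n) → ℕ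
  | .base _ pending, _ => (pending.filter fun p => ¬ W.Resolved x p.1 p.2).length
  | .sorting .., S => pairsBelow x opt mark W S
  | .routing .., S => pairsBelow x opt mark W S

/-! ### Potential for the running time -/

/-- Bound for the time spent on a call on `S` and all calls below it, apart from the passes over
the active comparisons in every turn.  The time spent on the call itself is proportional to
`m * log m` for `m` items, and `log m`, summed over the calls on the path of an item, is the
logarithm of the product of their sizes.  The term `Nat.clog 2 n`, counted once for every item, pays
for listing the pairs of a base case, which has fewer than `Nat.clog 2 n` items; the factors `30`
are large enough for the bookkeeping of a call, see `routingCost_le`. -/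
noncomputable def spawnCost (S : Finset (Fin n)) : ℝ :=
  ∑ e ∈ S, (30 + 30 * Real.logb 2 (pathProduct (itemKey x opt) mark e S) + Nat.clog 2 n)

/-- The part of `spawnCost` that is left after the last item has been routed. -/
noncomputable def boxesCost (S : Finset (Fin n)) : ℝ :=
  (∑ c ∈ range ((mark S).1.card + 1), spawnCost x opt mark (boxOf (itemKey x opt) S (mark S).1 c))
    + 2 * S.card + 6 * ((mark S).1.card + 1)

/-- The part of `spawnCost` that is left after the marked items have been sorted. -/
noncomputable def routingCost (S : Finset (Fin n)) : ℝ :=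
  boxesCost x opt mark S + 2 * (mark S).1.card ^ 2 + S.card + 2
    + S.card * (Real.logb 2 S.card + 4)

/-- The part of the potential that belongs to an active call. -/
noncomputable def callCost : Call n → Finset (Fin n) → ℝ
  | .base .., _ => 0
  | .sorting .., S => routingCost x opt mark S
  | .routing _ _ _ pending _, S =>
    boxesCost x opt mark S + ((pending.map fun p => 1 + p.tree.height).sum : ℕ)

variable {x opt mark Q}

lemma one_le_pathProduct {e : Fin n} {S : Finset (Fin n)} (he : e ∈ S) :
    (1 : ℝ) ≤ pathProduct (itemKey x opt) mark e S := by
  exact_mod_cast (card_pos.2 ⟨e, he⟩).trans_le (card_le_pathProduct mark e S he)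

lemma spawnCost_ge (S : Finset (Fin n)) : S.card * (30 + Nat.clog 2 n) ≤ spawnCost x opt mark S := by
  rw [← nsmul_eq_mul, ← sum_const]
  refine sum_le_sum fun e he => ?_
  have := Real.logb_nonneg (b := 2) (by norm_num) (one_le_pathProduct (x := x) (opt := opt)
    (mark := mark) he)
  linarith

lemma spawnCost_nonneg (S : Finset (Fin n)) : 0 ≤ spawnCost x opt mark S :=
  le_trans (by positivity) (spawnCost_ge S)

lemma boxesCost_nonneg (S : Finset (Fin n)) : 0 ≤ boxesCost x opt mark S := by
  have := sum_nonneg fun c (_ : c ∈ range ((mark S).1.card + 1)) =>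
    spawnCost_nonneg (x := x) (opt := opt) (mark := mark) (boxOf (itemKey x opt) S (mark S).1 c)
  unfold boxesCost
  positivity

lemma sq_card_marking_le (S : Finset (Fin n)) : (mark S).1.card ^ 2 ≤ S.card := by
  rw [Marking.card, sq]
  exact Nat.sqrt_le S.card

lemma spawnCost_eq (S : Finset (Fin n)) : spawnCost x opt mark S
    = (∑ c ∈ range ((mark S).1.card + 1),
        spawnCost x opt mark (boxOf (itemKey x opt) S (mark S).1 c))
      + 30 * (S.card * Real.logb 2 S.card) + (mark S).1.card * (30 + Nat.clog 2 n) := by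
  have hsub := Marking.subset mark S
  have h1 : ∑ e ∈ S \ (mark S).1,
      (30 + 30 * Real.logb 2 (pathProduct (itemKey x opt) mark e S) + Nat.clog 2 n)
      = (∑ c ∈ range ((mark S).1.card + 1),
        spawnCost x opt mark (boxOf (itemKey x opt) S (mark S).1 c))
        + (S \ (mark S).1).card * (30 * Real.logb 2 S.card) := by
    rw [← sum_fiberwise_of_maps_to (s := S \ (mark S).1) (t := range ((mark S).1.card + 1))
      (g := boxIndex (itemKey x opt) (mark S).1)
      (fun i _ => by simpa [Nat.lt_succ_iff] using boxIndex_le (mark S).1 i),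
      ← sum_card_box (key := itemKey x opt) (S := S) (M := (mark S).1), Nat.cast_sum, sum_mul,
      ← sum_add_distrib]
    refine sum_congr rfl fun c _ => ?_
    rw [spawnCost, ← nsmul_eq_mul, ← sum_const, ← sum_add_distrib]
    refine sum_congr rfl fun e he => ?_
    have he' : e ∈ boxOf (itemKey x opt) S (mark S).1 c := he
    have heS := box_subset S (mark S).1 c he'
    have hp := one_le_pathProduct (x := x) (opt := opt) (mark := mark) he'
    have hc : (0 : ℝ) < S.card := by exact_mod_cast card_pos.2 ⟨e, heS⟩
    rw [pathProduct_of_mem_box he', Nat.cast_mul, Real.logb_mul hc.ne' (by linarith)]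
    ring
  have h2 : ∑ e ∈ (mark S).1,
      (30 + 30 * Real.logb 2 (pathProduct (itemKey x opt) mark e S) + Nat.clog 2 n)
      = (mark S).1.card * (30 + 30 * Real.logb 2 S.card + Nat.clog 2 n) := by
    rw [← nsmul_eq_mul, ← sum_const]
    refine sum_congr rfl fun e he => ?_
    rw [pathProduct_of_notMem (by simp [he])]
  rw [spawnCost, ← sum_sdiff hsub, h1, h2, cast_card_sdiff hsub]
  ring

/-- The cost of starting a call: selecting and comparing the marked items. -/
lemma routingCost_le {S : Finset (Fin n)} (hS : S.Nonempty) :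
    S.card + 1 + (((mark S).1.card : ℝ) ^ 2 + 1) + routingCost x opt mark S
      ≤ spawnCost x opt mark S + 4 := by
  have hsq : ((mark S).1.card : ℝ) ^ 2 ≤ S.card := by exact_mod_cast sq_card_marking_le S
  have hm : 1 ≤ S.card := hS.card_pos
  have hs : (1 : ℝ) ≤ (mark S).1.card := by
    rw [Marking.card]
    exact_mod_cast Nat.sqrt_pos.2 hm
  rw [spawnCost_eq, routingCost, boxesCost]
  have hL : (0 : ℝ) ≤ (mark S).1.card * (Nat.clog 2 n : ℝ) := by positivity
  rcases hm.eq_or_lt with h1 | h1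
  · have h1' : (S.card : ℝ) = 1 := by exact_mod_cast h1.symm
    have hlog : Real.logb 2 S.card = 0 := by rw [h1', Real.logb_one]
    rw [hlog]
    nlinarith
  · have h2 : (2 : ℝ) ≤ S.card := by exact_mod_cast h1
    have hlog : 1 ≤ Real.logb 2 S.card := by
      rw [Real.le_logb_iff_rpow_le (by norm_num) (by linarith), Real.rpow_one]
      exact h2
    nlinarith

end Invariants

/-! ### Weights along the recursion -/

section Weights

open Finset

variable {n : ℕ} {x : Fin n → Item} {opt : ℝ} {mark : Marking n} {Q : ℝ}

lemma minRoutingWeight_eq (w m : ℝ) : minRoutingWeight w m = w / (2 * m ^ 2 * √m) := by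
  unfold minRoutingWeight routingWeight share
  rw [div_div, div_div]
  ring_nf

lemma minRoutingWeight_pos {w m : ℝ} (hw : 0 < w) (hm : 1 ≤ m) : 0 < minRoutingWeight w m := by
  rw [minRoutingWeight_eq]
  have : 0 < √m := Real.sqrt_pos.2 (by linarith)
  positivity

lemma boxWeight_mul_sq {w m : ℝ} (hm : 1 ≤ m) :
    boxWeight w m * m ^ 2 = minRoutingWeight w m / 2 := by
  have : m ≠ 0 := by linarith
  unfold boxWeight share minRoutingWeight
  field_simp

lemma boxWeight_pos {w m : ℝ} (hw : 0 < w) (hm : 1 ≤ m) : 0 < boxWeight w m := by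
  have h1 := boxWeight_mul_sq (w := w) hm
  have h2 := minRoutingWeight_pos hw hm
  by_contra h
  nlinarith [sq_nonneg m, mul_nonneg (neg_nonneg.2 (not_lt.1 h)) (sq_nonneg m)]

lemma mul_routingWeight_le {w m : ℝ} (hw : 0 < w) (hm : 1 ≤ m) : m * routingWeight w m ≤ w / 2 := by
  have : m * routingWeight w m = w / (2 * m) := by
    unfold routingWeight share
    field_simp
  rw [this]
  exact div_le_div_of_nonneg_left hw.le (by norm_num) (by linarith)

lemma minRoutingWeight_le {w m : ℝ} (hw : 0 < w) (hm : 1 ≤ m) : minRoutingWeight w m ≤ w := by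
  rw [minRoutingWeight_eq]
  refine div_le_self hw.le ?_
  have : 1 ≤ √m := Real.one_le_sqrt.2 hm
  nlinarith

lemma HeavyEnough.card_pow_le {w : ℝ} {S : Finset (Fin n)} (h : HeavyEnough x opt mark Q w S)
    (hS : S.Nonempty) : (S.card : ℝ) ^ 7 ≤ Q * w := by
  obtain ⟨e, he⟩ := hS
  refine le_trans ?_ (h.2 e he)
  have : (S.card : ℝ) ≤ pathProduct (itemKey x opt) mark e S := by
    exact_mod_cast card_le_pathProduct mark e S he
  gcongr

lemma HeavyEnough.one_le_mul_minRoutingWeight {w : ℝ} {S : Finset (Fin n)}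
    (h : HeavyEnough x opt mark Q w S) (hS : 2 ≤ S.card) :
    1 ≤ Q * minRoutingWeight w S.card := by
  have h1 := h.card_pow_le (card_pos.1 (by omega))
  have hm : (2 : ℝ) ≤ S.card := by exact_mod_cast hS
  generalize (S.card : ℝ) = m at h1 hm
  have hs : 0 < √m := Real.sqrt_pos.2 (by linarith)
  have hs' : √m ≤ m := (Real.sqrt_le_left (by linarith)).2 (by nlinarith)
  rw [minRoutingWeight_eq, ← mul_div_assoc, one_le_div (by positivity)]
  refine le_trans ?_ h1
  calc 2 * m ^ 2 * √m ≤ m * m ^ 2 * m := by gcongr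
    _ = m ^ 4 := by ring
    _ ≤ m ^ 7 := pow_le_pow_right₀ (by linarith) (by norm_num)

lemma two_le_card_of_mem_sdiff {S : Finset (Fin n)} {e : Fin n} (he : e ∈ S \ (mark S).1) :
    2 ≤ S.card := by
  have h1 := card_sdiff_add_card_eq_card (Marking.subset mark S)
  have h2 := card_pos.2 ⟨e, he⟩
  have h3 : 0 < (mark S).1.card := by
    rw [Marking.card]
    exact Nat.sqrt_pos.2 (card_pos.2 ⟨e, (mem_sdiff.1 he).1⟩)
  omega

lemma HeavyEnough.box {w : ℝ} {S : Finset (Fin n)} (h : HeavyEnough x opt mark Q w S)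
    (hS : S.Nonempty) (c : ℕ) :
    HeavyEnough x opt mark Q (boxWeight w S.card) (boxOf (itemKey x opt) S (mark S).1 c) := by
  have hm1 : (1 : ℝ) ≤ S.card := by exact_mod_cast hS.card_pos
  refine ⟨boxWeight_pos h.1 hm1, fun e he => ?_⟩
  have hS2 : 2 ≤ S.card := two_le_card_of_mem_sdiff (mark := mark) (e := e) (by
    rw [mem_sdiff]
    exact ⟨(mem_boxOf.1 he).1, (mem_boxOf.1 he).2.1⟩)
  have h1 := h.2 e (box_subset _ _ _ he)
  rw [pathProduct_of_mem_box he, Nat.cast_mul, mul_pow] at h1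
  have h0 : (0 : ℝ) ≤ (pathProduct (itemKey x opt) mark e
    (boxOf (itemKey x opt) S (mark S).1 c) : ℝ) ^ 7 := by positivity
  generalize (pathProduct (itemKey x opt) mark e
    (boxOf (itemKey x opt) S (mark S).1 c) : ℝ) ^ 7 = z at h0 h1 ⊢
  have hm : (2 : ℝ) ≤ S.card := by exact_mod_cast hS2
  have hbw := boxWeight_mul_sq (w := w) hm1
  rw [minRoutingWeight_eq] at hbw
  generalize (S.card : ℝ) = m at h1 hm hbw ⊢
  have hs : 0 < √m := Real.sqrt_pos.2 (by linarith)
  have hs' : √m ≤ m := (Real.sqrt_le_left (by linarith)).2 (by nlinarith)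
  have hb : boxWeight w m = w / (4 * m ^ 4 * √m) := by
    rw [eq_div_iff (by positivity)]
    rw [div_div, eq_div_iff (by positivity)] at hbw
    linarith
  rw [hb, ← mul_div_assoc, le_div_iff₀ (by positivity)]
  refine le_trans ?_ h1
  calc z * (4 * m ^ 4 * √m) ≤ z * ((m * m) * m ^ 4 * m) := by
        have : (4 : ℝ) ≤ m * m := by nlinarith
        gcongr
    _ = m ^ 7 * z := by ring

end Weights

/-! ### Lists of calls with their invariants and budgets -/

section Produces

open Finset

variable {n : ℕ} (x : Fin n → Item) (opt : ℝ) (mark : Marking n) (Q : ℝ)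

/-- The total weight of the active comparisons of a call. -/
noncomputable def activeWeight (call : Call n) : ℝ := ((call.active x).map Prod.snd).sum

/-- The calls of a list satisfy the invariants for suitable sets of items, and these sets, the
unresolved pairs of base cases in the future, the active weight and the potential stay within the
given budgets. If `conflict` holds, then one of the sets has two items that cannot be told apart, so
that the list is not empty. -/
def Produces (W : Window) (calls : List (Call n)) (size : ℕ) (pairs : Window → ℕ)
    (weight cost : ℝ) (conflict : Prop) : Prop :=
  ∃ tagged : List (Call n × Finset (Fin n)), tagged.map Prod.fst = calls ∧
    (∀ t ∈ tagged, CallInv x opt mark Q W t.1 t.2) ∧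
    (tagged.map fun t => t.2.card).sum ≤ size ∧
    (∀ V : Window, V.Within W →
      (tagged.map fun t => callPairs x opt mark V t.1 t.2).sum ≤ pairs V) ∧
    (tagged.map fun t => activeWeight x t.1).sum ≤ weight ∧
    (tagged.map fun t => callCost x opt mark t.1 t.2).sum ≤ cost ∧
    (conflict → ∃ t ∈ tagged, Conflict x opt t.2)

variable {x opt mark Q} {W : Window}

lemma CallInv.nonempty (hn : 2 ≤ n) {call : Call n} {S : Finset (Fin n)}
    (h : CallInv x opt mark Q W call S) : S.Nonempty := by
  have hL : 0 < Nat.clog 2 n := Nat.clog_pos (by norm_num) hn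
  cases call with
  | base w pending => exact BaseInv.nonempty h
  | sorting w items marked pending => exact card_pos.1 (hL.trans_le (SortingInv.le_card h))
  | routing w size numMarked pending settled =>
    exact card_pos.1 (hL.trans_le (RoutingInv.le_card h))

lemma Produces.mono {calls : List (Call n)} {size size' : ℕ} {pairs pairs' : Window → ℕ}
    {weight weight' cost cost' : ℝ} {cf cf' : Prop}
    (h : Produces x opt mark Q W calls size pairs weight cost cf) (h1 : size ≤ size')
    (h2 : ∀ V : Window, V.Within W → pairs V ≤ pairs' V) (h3 : weight ≤ weight')
    (h4 : cost ≤ cost') (h5 : cf' → cf) :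
    Produces x opt mark Q W calls size' pairs' weight' cost' cf' := by
  obtain ⟨t, a0, a1, a2, a3, a4, a5, a6⟩ := h
  exact ⟨t, a0, a1, a2.trans h1, fun V hV => (a3 V hV).trans (h2 V hV), a4.trans h3, a5.trans h4,
    fun h => a6 (h5 h)⟩

lemma Produces.nil {size : ℕ} {pairs : Window → ℕ} {weight cost : ℝ} {cf : Prop} (h1 : 0 ≤ weight)
    (h2 : 0 ≤ cost) (h3 : ¬ cf) : Produces x opt mark Q W [] size pairs weight cost cf :=
  ⟨[], rfl, by simp, by simp, by simp, by simpa using h1, by simpa using h2, fun h => absurd h h3⟩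

lemma Produces.single {call : Call n} {S : Finset (Fin n)} {size : ℕ} {pairs : Window → ℕ}
    {weight cost : ℝ} {cf : Prop} (h : CallInv x opt mark Q W call S) (h1 : S.card ≤ size)
    (h2 : ∀ V : Window, V.Within W → callPairs x opt mark V call S ≤ pairs V)
    (h3 : activeWeight x call ≤ weight) (h4 : callCost x opt mark call S ≤ cost)
    (h5 : cf → Conflict x opt S) :
    Produces x opt mark Q W [call] size pairs weight cost cf :=
  ⟨[(call, S)], rfl, by simpa using h, by simpa using h1, by simpa using h2, by simpa using h3,
    by simpa using h4, by simpa using h5⟩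

lemma Produces.append {calls calls' : List (Call n)} {size size' : ℕ} {pairs pairs' : Window → ℕ}
    {weight weight' cost cost' : ℝ} {cf cf' : Prop}
    (h : Produces x opt mark Q W calls size pairs weight cost cf)
    (h' : Produces x opt mark Q W calls' size' pairs' weight' cost' cf') :
    Produces x opt mark Q W (calls ++ calls') (size + size') (fun V => pairs V + pairs' V)
      (weight + weight') (cost + cost') (cf ∨ cf') := by
  obtain ⟨t, a0, a1, a2, a3, a4, a5, a6⟩ := h
  obtain ⟨t', b0, b1, b2, b3, b4, b5, b6⟩ := h'
  refine ⟨t ++ t', by rw [List.map_append, a0, b0], ?_, ?_, fun V hV => ?_, ?_, ?_, ?_⟩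
  · intro s hs
    exact (List.mem_append.1 hs).elim (a1 s) (b1 s)
  · rw [List.map_append, List.sum_append]
    exact add_le_add a2 b2
  · rw [List.map_append, List.sum_append]
    exact add_le_add (a3 V hV) (b3 V hV)
  · rw [List.map_append, List.sum_append]
    exact add_le_add a4 b4
  · rw [List.map_append, List.sum_append]
    exact add_le_add a5 b5
  · rintro (h | h)
    · obtain ⟨s, hs, hc⟩ := a6 h
      exact ⟨s, List.mem_append_left _ hs, hc⟩
    · obtain ⟨s, hs, hc⟩ := b6 h
      exact ⟨s, List.mem_append_right _ hs, hc⟩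

lemma length_le_sum_card (hn : 2 ≤ n) {tagged : List (Call n × Finset (Fin n))}
    (h : ∀ t ∈ tagged, CallInv x opt mark Q W t.1 t.2) :
    tagged.length ≤ (tagged.map fun t => t.2.card).sum := by
  induction tagged with
  | nil => simp
  | cons t l ih =>
    have h1 := ih fun s hs => h s (List.mem_cons_of_mem _ hs)
    have h2 := (CallInv.nonempty hn (h t List.mem_cons_self)).card_pos
    simp only [List.length_cons, List.map_cons, List.sum_cons]
    omega

lemma Produces.length_le (hn : 2 ≤ n) {calls : List (Call n)} {size : ℕ} {pairs : Window → ℕ}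
    {weight cost : ℝ} {cf : Prop} (h : Produces x opt mark Q W calls size pairs weight cost cf) :
    calls.length ≤ size := by
  obtain ⟨t, a0, a1, a2, -⟩ := h
  rw [← a0, List.length_map]
  exact (length_le_sum_card hn a1).trans a2

lemma collect_produces (hn : 2 ≤ n) {α τ : Type} (f : α → Timed (List (Call n))) (g : τ → α)
    (size : τ → ℕ) (pairs : τ → Window → ℕ) (weight cost : τ → ℝ) (cf : τ → Prop) (l : List τ)
    (h : ∀ t ∈ l, Produces x opt mark Q W (f (g t)).val (size t) (pairs t) (weight t)
      (cost t - (f (g t)).steps) (cf t)) :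
    Produces x opt mark Q W (collect f (l.map g)).val (l.map size).sum
      (fun V => (l.map fun t => pairs t V).sum) (l.map weight).sum
      ((l.map fun t => cost t + size t + 1).sum - (collect f (l.map g)).steps)
      (∃ t ∈ l, cf t) := by
  induction l with
  | nil => exact Produces.nil (by simp) (by simp [collect]) (by simp)
  | cons t l ih =>
    have h1 := h t List.mem_cons_self
    have h2 := ih fun s hs => h s (List.mem_cons_of_mem _ hs)
    have hlen : ((f (g t)).val.length : ℝ) ≤ size t := by exact_mod_cast h1.length_le hn
    have hval : (collect f ((t :: l).map g)).val
        = (f (g t)).val ++ (collect f (l.map g)).val := by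
      simp only [List.map_cons, collect, Timed.bind_val, Timed.pure_val]
    have hst : (collect f ((t :: l).map g)).steps
        = (f (g t)).steps + (collect f (l.map g)).steps + ((f (g t)).val.length + 1) := by
      simp only [List.map_cons, collect, Timed.bind_steps, Timed.pure_steps, Timed.tick_steps]
      omega
    rw [hval]
    refine (h1.append h2).mono (by simp) (by simp) (by simp) ?_ (by simp)
    rw [hst]
    push_cast
    simp only [List.map_cons, List.sum_cons]
    linarith

end Produces

/-! ### One call of boxsort -/

section OneCall

open Finset

variable {n : ℕ} {x : Fin n → Item} {opt : ℝ} {mark : Marking n} {Q : ℝ} {W : Window}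

lemma list_sum_range_eq {α : Type} [AddCommMonoid α] (f : ℕ → α) (k : ℕ) :
    ((List.range k).map f).sum = ∑ i ∈ range k, f i := by
  induction k with
  | zero => simp
  | succ k ih => rw [List.range_succ, List.map_append, List.sum_append, ih, sum_range_succ]; simp

lemma lt_logb_iff_lt_clog (hn : 2 ≤ n) (m : ℕ) : (m : ℝ) < Real.logb 2 n ↔ m < Nat.clog 2 n := by
  rw [Real.lt_logb_iff_rpow_lt (by norm_num) (by exact_mod_cast (by omega : 0 < n)),
    Real.rpow_natCast, Nat.lt_clog_iff_pow_lt (by norm_num)]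
  exact_mod_cast Iff.rfl

lemma RoutingDone.mono {W' : Window} (hW : W'.Within W) {S M : Finset (Fin n)}
    (h : RoutingDone (itemKey x opt) (W.Resolved x) S M) :
    RoutingDone (itemKey x opt) (W'.Resolved x) S M :=
  ⟨fun p hp q hq hpq => (h.1 p hp q hq hpq).mono hW, fun i hi p hp ha => (h.2 i hi p hp ha).mono hW⟩

/-- What a function that starts the calls on the boxes has to satisfy in a call on `S` with initial
weight `w`. -/
def RecursesWell (x : Fin n → Item) (opt : ℝ) (mark : Marking n) (Q : ℝ) (W : Window)
    (recurse : ℝ → List (Fin n) → Timed (List (Call n))) (size : ℕ) : Prop :=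
  ∀ (w : ℝ) (items : List (Fin n)), items.Nodup → items.length < size →
    HeavyEnough x opt mark Q w items.toFinset →
    Produces x opt mark Q W (recurse w items).val items.toFinset.card
      (fun V => pairsBelow x opt mark V items.toFinset) (w * items.toFinset.card ^ 2)
      (spawnCost x opt mark items.toFinset + 4 - (recurse w items).steps)
      (Conflict x opt items.toFinset)

lemma route_produces (hn : 2 ≤ n) (hW : W.Contains opt) {S : Finset (Fin n)} (hS : S.Nonempty)
    (hL : Nat.clog 2 n ≤ S.card) {w : ℝ} (hw : HeavyEnough x opt mark Q w S)
    (hmarked : ∀ i ∈ (mark S).1, ∀ j ∈ (mark S).1, i ≠ j → W.Resolved x i j)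
    {todo : List (Fin n × RoutingTree n × ℝ)} {settled : List (Fin n × ℕ)}
    (htodo : ∀ a ∈ todo,
      Routed x opt W (mark S).1 (minRoutingWeight w S.card) a.1 a.2.1 a.2.2)
    (hnodup : (todo.map Prod.fst ++ settled.map Prod.fst).Nodup)
    (hmem : ∀ i, i ∈ todo.map Prod.fst ++ settled.map Prod.fst ↔ i ∈ S \ (mark S).1)
    (hsettled : ∀ s ∈ settled, s.2 = boxIndex (itemKey x opt) (mark S).1 s.1 ∧
      ∀ p ∈ (mark S).1, Adjacent (itemKey x opt) (mark S).1 s.1 p → W.Resolved x s.1 p)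
    {recurse : ℝ → List (Fin n) → Timed (List (Call n))}
    (hrec : RecursesWell x opt mark Q W recurse S.card) {weight : ℝ}
    (hpass : (todo.map (passedWeight x W)).sum ≤ weight)
    (hfin : (∀ a ∈ todo, HeadResolved x W a.1 a.2.1) → minRoutingWeight w S.card / 2 ≤ weight) :
    Produces x opt mark Q W (route x W recurse w S.card (mark S).1.card todo settled).val S.card
      (fun V => pairsBelow x opt mark V S) weight
      (1 + boxesCost x opt mark S + ((todo.map fun a => a.2.1.height + 3).sum : ℕ)
        - (route x W recurse w S.card (mark S).1.card todo settled).steps)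
      (Conflict x opt S) := by
  have hm1 : (1 : ℝ) ≤ S.card := by exact_mod_cast hS.card_pos
  have hω := minRoutingWeight_pos hw.1 hm1
  obtain ⟨h1, h2, h3, h4, h5, h6⟩ := walkAll_spec hW hω todo fun a ha =>
    ⟨(mem_sdiff.1 ((hmem a.1).1 (List.mem_append_left _ (List.mem_map_of_mem ha)))).2, htodo a ha⟩
  have hlen : (walkAll x W todo).val.1.length + (walkAll x W todo).val.2.length = todo.length := by
    simpa using h1.length_eq
  have hsum3 : (todo.map fun a => a.2.1.height + 3).sum
      = (todo.map fun a => a.2.1.height + 2).sum + todo.length := by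
    clear * -
    induction todo with
    | nil => simp
    | cons a l ih =>
      simp only [List.map_cons, List.sum_cons, ih, List.length_cons]
      ring
  have hsettled' : ∀ s ∈ (walkAll x W todo).val.2 ++ settled,
      s.2 = boxIndex (itemKey x opt) (mark S).1 s.1 ∧
      ∀ p ∈ (mark S).1, Adjacent (itemKey x opt) (mark S).1 s.1 p → W.Resolved x s.1 p :=
    fun s hs => (List.mem_append.1 hs).elim (h3 s) (hsettled s)
  have hperm : ((walkAll x W todo).val.1.map Probe.item
      ++ ((walkAll x W todo).val.2 ++ settled).map Prod.fst).Perm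
      (todo.map Prod.fst ++ settled.map Prod.fst) := by
    rw [List.map_append, ← List.append_assoc]
    exact h1.append_right _
  by_cases hnil : (walkAll x W todo).val.1 = []
  · -- all items are settled
    set all := (walkAll x W todo).val.2 ++ settled with hall
    rw [hnil, List.map_nil, List.nil_append] at hperm
    have hnodup' : (all.map Prod.fst).Nodup := hperm.nodup_iff.2 hnodup
    have hmem' : ∀ i, i ∈ all.map Prod.fst ↔ i ∈ S \ (mark S).1 := fun i =>
      hperm.mem_iff.trans (hmem i)
    set boxes := (List.range ((mark S).1.card + 1)).map fun c =>
      (all.filter fun s => s.2 = c).map Prod.fst with hboxes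
    have hval : (route x W recurse w S.card (mark S).1.card todo settled).val
        = (collect (recurse (boxWeight w S.card)) boxes).val := by
      simp only [route, Timed.bind_val, hnil, List.isEmpty_nil, if_true]
      rfl
    have hst : (route x W recurse w S.card (mark S).1.card todo settled).steps
        = 1 + ((walkAll x W todo).steps + ((walkAll x W todo).val.2.length
          + (S.card + (mark S).1.card + 1
            + (collect (recurse (boxWeight w S.card)) boxes).steps))) := by
      simp only [route, Timed.bind_steps, Timed.tick_steps, hnil, List.isEmpty_nil, if_true]
      rfl
    have hbox : ∀ c, ((all.filter fun s => s.2 = c).map Prod.fst).toFinset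
        = boxOf (itemKey x opt) S (mark S).1 c := by
      intro c
      ext i
      rw [List.mem_toFinset, List.mem_map, mem_boxOf]
      constructor
      · rintro ⟨s, hs, rfl⟩
        rw [List.mem_filter] at hs
        have hi := mem_sdiff.1 ((hmem' s.1).1 (List.mem_map_of_mem hs.1))
        exact ⟨hi.1, hi.2, by rw [← (hsettled' s hs.1).1]; simpa using hs.2⟩
      · rintro ⟨hi, hiM, hc⟩
        obtain ⟨s, hs, rfl⟩ := List.mem_map.1 ((hmem' i).2 (mem_sdiff.2 ⟨hi, hiM⟩))
        exact ⟨s, List.mem_filter.2 ⟨hs, by simp [(hsettled' s hs).1, hc]⟩, rfl⟩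
    have hboxnd : ∀ c, ((all.filter fun s => s.2 = c).map Prod.fst).Nodup := fun c =>
      hnodup'.sublist (List.filter_sublist.map _)
    have hdone : RoutingDone (itemKey x opt) (W.Resolved x) S (mark S).1 := by
      refine ⟨hmarked, fun i hi p hp ha => ?_⟩
      obtain ⟨s, hs, rfl⟩ := List.mem_map.1 ((hmem' i).2 hi)
      exact (hsettled' s hs).2 p hp ha
    have hcoll := collect_produces (x := x) (opt := opt) (mark := mark) (Q := Q) (W := W) hn
      (recurse (boxWeight w S.card)) (fun c => (all.filter fun s => s.2 = c).map Prod.fst)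
      (fun c => (boxOf (itemKey x opt) S (mark S).1 c).card)
      (fun c V => pairsBelow x opt mark V (boxOf (itemKey x opt) S (mark S).1 c))
      (fun c => boxWeight w S.card * (boxOf (itemKey x opt) S (mark S).1 c).card ^ 2)
      (fun c => spawnCost x opt mark (boxOf (itemKey x opt) S (mark S).1 c) + 4)
      (fun c => Conflict x opt (boxOf (itemKey x opt) S (mark S).1 c))
      (List.range ((mark S).1.card + 1)) (fun c _ => by
        have hb := hbox c
        have := hrec (boxWeight w S.card) ((all.filter fun s => s.2 = c).map Prod.fst) (hboxnd c)
          (by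
            rw [← List.toFinset_card_of_nodup (hboxnd c), hb]
            exact card_box_marking_lt mark hS c)
          (by rw [hb]; exact hw.box hS c)
        rw [hb] at this
        exact this)
    rw [hval]
    have hsz := card_sdiff_add_card_eq_card (Marking.subset mark S)
    refine hcoll.mono ?_ (fun V hV => ?_) ?_ ?_ ?_
    · rw [list_sum_range_eq]
      exact sum_card_box_le mark S
    · rw [list_sum_range_eq]
      unfold pairsBelow
      rw [basePairs_of_routingDone hL hS (hdone.mono hV)]
    · refine le_trans ?_ (hfin (h4 hnil))
      rw [list_sum_range_eq, ← mul_sum, ← boxWeight_mul_sq hm1]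
      refine mul_le_mul_of_nonneg_left ?_ (boxWeight_pos hw.1 hm1).le
      have hle := sum_card_box_le (key := itemKey x opt) mark S
      calc ∑ c ∈ range ((mark S).1.card + 1),
            ((boxOf (itemKey x opt) S (mark S).1 c).card : ℝ) ^ 2
          ≤ ∑ c ∈ range ((mark S).1.card + 1),
            ((boxOf (itemKey x opt) S (mark S).1 c).card : ℝ) * S.card := by
            refine sum_le_sum fun c _ => ?_
            rw [sq]
            gcongr
            exact box_subset _ _ _
        _ = ((∑ c ∈ range ((mark S).1.card + 1),
            (boxOf (itemKey x opt) S (mark S).1 c).card : ℕ) : ℝ) * S.card := by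
            rw [← sum_mul, Nat.cast_sum]
        _ ≤ S.card * S.card := by gcongr
        _ = (S.card : ℝ) ^ 2 := (sq _).symm
    · rw [list_sum_range_eq, hst, hsum3]
      simp only [sum_add_distrib, sum_const, card_range, nsmul_eq_mul]
      have e1 : (∑ c ∈ range ((mark S).1.card + 1),
          ((boxOf (itemKey x opt) S (mark S).1 c).card : ℝ)) + (mark S).1.card = S.card := by
        rw [← Nat.cast_sum, sum_card_box]
        exact_mod_cast hsz
      have e2 : ((walkAll x W todo).steps : ℝ) ≤ ((todo.map fun a => a.2.1.height + 2).sum : ℕ) := by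
        have : (walkAll x W todo).steps ≤ (todo.map fun a => a.2.1.height + 2).sum := by omega
        exact_mod_cast this
      have e3 : ((walkAll x W todo).val.2.length : ℝ) = todo.length := by
        rw [hnil, List.length_nil, zero_add] at hlen
        exact_mod_cast hlen
      unfold boxesCost
      push_cast
      rw [e3]
      push_cast at e2
      linarith
    · intro hc
      obtain ⟨c, hc1, hc2⟩ := hc.exists_box hW hdone
      exact ⟨c, List.mem_range.2 hc1, hc2⟩
  · have hne : (walkAll x W todo).val.1.isEmpty = false := by
      simpa using hnil
    have hval : (route x W recurse w S.card (mark S).1.card todo settled).val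
        = [.routing w S.card (mark S).1.card (walkAll x W todo).val.1
          ((walkAll x W todo).val.2 ++ settled)] := by
      simp only [route, Timed.bind_val, hne, Bool.false_eq_true, if_false, Timed.pure_val]
    have hst : (route x W recurse w S.card (mark S).1.card todo settled).steps
        = 1 + ((walkAll x W todo).steps + (walkAll x W todo).val.2.length) := by
      simp only [route, Timed.bind_steps, Timed.tick_steps, hne, Bool.false_eq_true, if_false,
        Timed.pure_steps, add_zero]
    rw [hval]
    refine Produces.single (S := S) ?_ le_rfl (fun V _ => le_rfl) ?_ ?_ id
    · exact ⟨rfl, rfl, hL, hw, hmarked, hnil, hperm.nodup_iff.2 hnodup,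
        fun i => hperm.mem_iff.trans (hmem i), hsettled', h2⟩
    · refine le_trans (le_of_eq ?_) (h5.trans hpass)
      simp only [activeWeight, Call.active, List.map_map]
      rfl
    · rw [hst]
      have e1 : ((walkAll x W todo).val.1.map fun p => 1 + p.tree.height).sum
          = (walkAll x W todo).val.1.length
            + ((walkAll x W todo).val.1.map fun p => p.tree.height).sum := by
        clear * -
        induction (walkAll x W todo).val.1 with
        | nil => simp
        | cons a l ih =>
          simp only [List.map_cons, List.sum_cons, ih, List.length_cons]
          ring
      have e2 : (1 + ((walkAll x W todo).steps + (walkAll x W todo).val.2.length))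
          + ((walkAll x W todo).val.1.map fun p => 1 + p.tree.height).sum
          ≤ 1 + (todo.map fun a => a.2.1.height + 3).sum := by omega
      have e3 : ((1 + ((walkAll x W todo).steps + (walkAll x W todo).val.2.length) : ℕ) : ℝ)
          + (((walkAll x W todo).val.1.map fun p => 1 + p.tree.height).sum : ℕ)
          ≤ 1 + ((todo.map fun a => a.2.1.height + 3).sum : ℕ) := by exact_mod_cast e2
      simp only [callCost]
      linarith

end OneCall

section OneCall

open Finset

variable {n : ℕ} {x : Fin n → Item} {opt : ℝ} {mark : Marking n} {Q : ℝ} {W : Window}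

lemma startRouting_produces (hn : 2 ≤ n) (hW : W.Contains opt) {items marked : List (Fin n)}
    (hitems : items.Nodup) (hS : items.toFinset.Nonempty)
    (hL : Nat.clog 2 n ≤ items.toFinset.card) {w : ℝ}
    (hw : HeavyEnough x opt mark Q w items.toFinset)
    (hmarked : marked.Nodup) (hmarked' : marked.toFinset = (mark items.toFinset).1)
    (hres : ∀ i ∈ marked, ∀ j ∈ marked, i ≠ j → W.Resolved x i j)
    {recurse : ℝ → List (Fin n) → Timed (List (Call n))}
    (hrec : RecursesWell x opt mark Q W recurse items.toFinset.card) :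
    Produces x opt mark Q W (startRouting x W recurse w items marked).val items.toFinset.card
      (fun V => pairsBelow x opt mark V items.toFinset) (w / 2)
      (routingCost x opt mark items.toFinset - (startRouting x W recurse w items marked).steps)
      (Conflict x opt items.toFinset) := by
  classical
  have hm1 : (1 : ℝ) ≤ items.toFinset.card := by exact_mod_cast hS.card_pos
  have hlen : items.length = items.toFinset.card := (List.toFinset_card_of_nodup hitems).symm
  have hlen' : marked.length = (mark items.toFinset).1.card := by
    rw [← hmarked', List.toFinset_card_of_nodup hmarked]
  have hmemM : ∀ i, i ∈ marked ↔ i ∈ (mark items.toFinset).1 := fun i => by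
    rw [← hmarked', List.mem_toFinset]
  have hpos : 0 < (mark items.toFinset).1.card := by
    rw [Marking.card]
    exact Nat.sqrt_pos.2 hS.card_pos
  set S := items.toFinset with hSdef
  set sorted := marked.insertionSort (W.Before x) with hsorted
  set tree := balancedTree 0 sorted with htree
  set todo := (items.filter fun i => i ∉ marked).map fun i =>
    (i, tree, routingWeight w S.card) with htodo
  have hmemS : ∀ i, i ∈ sorted ↔ i ∈ (mark S).1 := fun i => by
    rw [hsorted, List.mem_insertionSort, hmemM]
  have hsl : sorted.length = (mark S).1.card := by
    rw [hsorted, List.length_insertionSort, hlen']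
  have hsnd : sorted.Nodup := (List.perm_insertionSort _ _).nodup_iff.2 hmarked
  have hpair : sorted.Pairwise fun a b => itemKey x opt a < itemKey x opt b :=
    pairwise_insertionSort_of_agree itemKey_injective _ hmarked fun a ha b hb hab =>
      hW.before_iff (hres a ha b hb hab)
  obtain ⟨t1, t2, t3⟩ := balancedTree_spec (key := itemKey x opt) sorted 0
  have hne : sorted ≠ [] := fun h => by
    rw [h, List.length_nil] at hsl
    omega
  have hheight := t2 hne
  rw [hsl] at hheight
  have hst : (startRouting x W recurse w items marked).steps
      = 2 * (mark S).1.card ^ 2 + S.card + 1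
        + (route x W recurse w S.card (mark S).1.card todo []).steps := by
    simp only [startRouting, Timed.bind_steps, Timed.tick_steps, hlen, hlen']
    rfl
  have hval : (startRouting x W recurse w items marked).val
      = (route x W recurse w S.card (mark S).1.card todo []).val := by
    simp only [startRouting, Timed.bind_val, hlen, hlen']
    rfl
  have hfst : todo.map Prod.fst = items.filter fun i => i ∉ marked := by
    rw [htodo, List.map_map]
    exact List.map_id _
  have htl : todo.length ≤ S.card := by
    rw [htodo, List.length_map, ← hlen]
    exact List.length_filter_le _ _
  have hrw : 0 < routingWeight w S.card := by
    unfold routingWeight share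
    have := hw.1
    positivity
  have hpass : (todo.map (passedWeight x W)).sum ≤ w / 2 := by
    refine le_trans (List.sum_le_card_nsmul _ (routingWeight w S.card) ?_) ?_
    · intro a ha
      obtain ⟨b, hb, rfl⟩ := List.mem_map.1 ha
      obtain ⟨i, -, rfl⟩ := List.mem_map.1 hb
      unfold passedWeight
      split_ifs
      · exact (half_lt_self hrw).le
      · exact le_rfl
    · rw [List.length_map, nsmul_eq_mul]
      refine le_trans ?_ (mul_routingWeight_le hw.1 hm1)
      gcongr
  have hroute := route_produces (x := x) (opt := opt) (mark := mark) (Q := Q) (W := W) hn hW hS hL hw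
    (fun i hi j hj => hres i ((hmemM i).2 hi) j ((hmemM j).2 hj)) (todo := todo) (settled := [])
    (fun a ha => by
      obtain ⟨i, hi, rfl⟩ := List.mem_map.1 ha
      rw [List.mem_filter] at hi
      have hi' : i ∉ marked := by simpa using hi.2
      refine ⟨by rw [htree, t1]; exact hpair, fun p hp => ?_, fun p hp _ => Or.inl ?_, ?_, ?_⟩
      · rw [htree, t1] at hp
        exact (hmemS p).1 hp
      · rw [htree, t1]
        exact (hmemS p).2 hp
      · rw [htree, t3 hpair i (fun h => hi' ((hmemM i).2 ((hmemS i).1 h))) itemKey_injective,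
          zero_add, boxIndex, ← List.toFinset_card_of_nodup (hsnd.filter _), List.toFinset_filter]
        congr 1
        ext p
        simp only [mem_filter, List.mem_toFinset, hmemS, decide_eq_true_eq]
      · have hs : ((mark S).1.card : ℝ) ≤ √S.card := by
          refine Real.le_sqrt_of_sq_le ?_
          exact_mod_cast sq_card_marking_le S
        have hs0 : 0 < √(S.card : ℝ) := Real.sqrt_pos.2 (by linarith)
        have hh : (2 : ℝ) ^ tree.height ≤ 2 * √S.card := by
          refine le_trans (b := 2 * ((mark S).1.card : ℝ)) ?_ (by linarith)
          exact_mod_cast hheight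
        unfold minRoutingWeight
        rw [div_mul_eq_mul_div, div_le_iff₀ hs0]
        nlinarith)
    (by
      rw [hfst]
      simpa using hitems.filter _)
    (fun i => by
      rw [hfst]
      simp [hSdef, hmemM])
    (by simp) hrec hpass (fun _ => by
      have := minRoutingWeight_le hw.1 hm1
      linarith)
  rw [hval]
  refine hroute.mono le_rfl (fun _ _ => le_rfl) le_rfl ?_ id
  have hlog : (tree.height : ℝ) ≤ Real.logb 2 S.card + 1 := by
    have h0 : (0 : ℝ) < S.card := by linarith
    have h1 : (2 : ℝ) ^ tree.height ≤ S.card * 2 := by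
      have h2 : (mark S).1.card ≤ S.card := card_le_card (Marking.subset mark S)
      exact_mod_cast hheight.trans (by omega)
    have h3 := Real.logb_le_logb_of_le (b := 2) (by norm_num) (by positivity) h1
    rw [Real.logb_mul h0.ne' (by norm_num), Real.logb_self_eq_one (by norm_num),
      ← Real.rpow_natCast, Real.logb_rpow (by norm_num) (by norm_num)] at h3
    exact h3
  have hsum : ((todo.map fun a => a.2.1.height + 3).sum : ℕ) = todo.length * (tree.height + 3) := by
    rw [htodo, List.map_map]
    simp [Function.comp_def]
  rw [hst, hsum, routingCost]
  push_cast
  have : (todo.length : ℝ) * (tree.height + 3) ≤ S.card * (Real.logb 2 S.card + 4) := by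
    have h1 : (todo.length : ℝ) ≤ S.card := by exact_mod_cast htl
    have h2 : (0 : ℝ) ≤ tree.height := by positivity
    exact mul_le_mul h1 (by linarith) (by positivity) (by positivity)
  linarith

/-- Pending comparisons of a list of pairs, after the resolved ones have been dropped. -/
lemma unresolved_val (ps : List (Fin n × Fin n)) : (unresolved x W ps).val
    = ps.filter (fun p => @decide (¬ W.Resolved x p.1 p.2) (Classical.propDecidable _)) := by
  simp only [unresolved, Timed.bind_val, Timed.pure_val]
  congr!

lemma unresolved_steps (ps : List (Fin n × Fin n)) :
    (unresolved x W ps).steps = ps.length + 1 := by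
  simp [unresolved]

lemma mem_unresolved {ps : List (Fin n × Fin n)} {p : Fin n × Fin n} :
    p ∈ (unresolved x W ps).val ↔ p ∈ ps ∧ ¬ W.Resolved x p.1 p.2 := by
  rw [unresolved_val]
  simp

/-- The unresolved ones among the pending comparisons of a base case are counted by the number of
unresolved pairs. -/
lemma length_unresolved_le_pairsBelow {S : Finset (Fin n)} (hS : S.card < Nat.clog 2 n)
    {ps : List (Fin n × Fin n)} (hps : ps.Nodup) (h : ∀ p ∈ ps, p.1 ∈ S ∧ p.2 ∈ S ∧ p.1 ≠ p.2) :
    (unresolved x W ps).val.length ≤ pairsBelow x opt mark W S := by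
  rw [pairsBelow, basePairs_of_base hS, ← List.toFinset_card_of_nodup]
  · refine card_le_card fun p hp => ?_
    rw [List.mem_toFinset, mem_unresolved] at hp
    obtain ⟨h1, h2, h3⟩ := h p hp.1
    simp [unrelatedPairs, h1, h2, h3, hp.2]
  · rw [unresolved_val]
    exact hps.filter _

lemma callPairs_base (w : ℝ) (ps : List (Fin n × Fin n)) (S : Finset (Fin n)) :
    callPairs x opt mark W (.base w ps) S = (unresolved x W ps).val.length := by
  rw [unresolved_val, callPairs]
  congr!

lemma activeWeight_base (w : ℝ) (ps : List (Fin n × Fin n)) :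
    activeWeight x (.base w ps) = ps.length * w := by
  simp [activeWeight, Call.active, Function.comp_def]

lemma activeWeight_sorting (w : ℝ) (items marked : List (Fin n)) (ps : List (Fin n × Fin n)) :
    activeWeight x (.sorting w items marked ps) = ps.length * w := by
  simp [activeWeight, Call.active, Function.comp_def]

/-- The invariants of the calls that a new call on `items` starts. -/
lemma spawn_produces (hn : 2 ≤ n) (hW : W.Contains opt) (f : ℕ) (w : ℝ) (items : List (Fin n))
    (hf : items.length ≤ f) (hitems : items.Nodup)
    (hw : HeavyEnough x opt mark Q w items.toFinset) :
    Produces x opt mark Q W (spawn x mark W f w items).val items.toFinset.card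
      (fun V => pairsBelow x opt mark V items.toFinset) (w * items.toFinset.card ^ 2)
      (spawnCost x opt mark items.toFinset + 4 - (spawn x mark W f w items).steps)
      (Conflict x opt items.toFinset) := by
  classical
  induction f generalizing w items with
  | zero =>
    have : items = [] := List.length_eq_zero_iff.1 (by omega)
    subst this
    refine Produces.nil (by simp) ?_ ?_
    · have := spawnCost_nonneg (x := x) (opt := opt) (mark := mark) ([] : List (Fin n)).toFinset
      simp only [spawn, Timed.bind_steps, Timed.tick_steps, Timed.pure_steps]
      norm_num at this ⊢
      linarith
    · rintro ⟨i, hi, -⟩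
      simp at hi
  | succ f ih =>
    have hlen : items.length = items.toFinset.card := (List.toFinset_card_of_nodup hitems).symm
    have hmem : ∀ i, i ∈ items ↔ i ∈ items.toFinset := fun i => List.mem_toFinset.symm
    by_cases hbase : items.length < Nat.clog 2 n
    · have hcond := (lt_logb_iff_lt_clog hn items.length).2 hbase
      set pending := (unresolved x W (allPairs items)).val with hpending
      have hst : (spawn x mark W (f + 1) w items).steps
          = items.length + 1 + ((allPairs items).length + 1) := by
        simp only [spawn, hcond, if_true, Timed.bind_steps, Timed.tick_steps, unresolved_steps]
        split_ifs <;> simp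
      have hcost : (0 : ℝ) ≤ spawnCost x opt mark items.toFinset + 4
          - (spawn x mark W (f + 1) w items).steps := by
        have h1 := spawnCost_ge (x := x) (opt := opt) (mark := mark) items.toFinset
        have h2 : ((allPairs items).length : ℝ) ≤ (items.length : ℝ) * items.length := by
          rw [← sq]
          exact_mod_cast length_allPairs_le items
        have h3 : (items.length : ℝ) ≤ Nat.clog 2 n := by exact_mod_cast hbase.le
        have h4 : (0 : ℝ) ≤ items.length := by positivity
        rw [hst]
        rw [← hlen] at h1
        push_cast
        nlinarith
      by_cases hnil : pending = []
      · have hval : (spawn x mark W (f + 1) w items).val = [] := by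
          simp only [spawn, hcond, if_true, Timed.bind_val, ← hpending, hnil, List.isEmpty_nil,
            Timed.pure_val]
        rw [hval]
        refine Produces.nil (by have := hw.1; positivity) hcost ?_
        rintro ⟨i, hi, j, hj, hs, he⟩
        have hij : i ≠ j := fun h => hs (by rw [h])
        have hun := hW.not_resolved hs he
        rcases mem_allPairs_or ((hmem i).2 hi) ((hmem j).2 hj) hij with h | h
        · have : (i, j) ∈ pending := mem_unresolved.2 ⟨h, hun⟩
          simp [hnil] at this
        · have : (j, i) ∈ pending := mem_unresolved.2 ⟨h, fun h => hun h.symm⟩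
          simp [hnil] at this
      · have hval : (spawn x mark W (f + 1) w items).val = [.base w pending] := by
          have : pending.isEmpty = false := by simpa using hnil
          simp only [spawn, hcond, if_true, Timed.bind_val, ← hpending, this, Bool.false_eq_true,
            if_false, Timed.pure_val]
        have hpm : ∀ p ∈ pending, p.1 ∈ items.toFinset ∧ p.2 ∈ items.toFinset ∧ p.1 ≠ p.2 ∧
            ¬ W.Resolved x p.1 p.2 := by
          intro p hp
          have hp' := mem_unresolved.1 hp
          have := mem_of_mem_allPairs hp'.1
          exact ⟨(hmem _).1 this.1, (hmem _).1 this.2, ne_of_mem_allPairs hitems hp'.1, hp'.2⟩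
        have hS : items.toFinset.Nonempty := by
          obtain ⟨p, hp⟩ := List.exists_mem_of_ne_nil _ hnil
          exact ⟨p.1, (hpm p hp).1⟩
        have hm1 : (1 : ℝ) ≤ items.toFinset.card := by exact_mod_cast hS.card_pos
        have hnd : pending.Nodup := by
          rw [hpending, unresolved_val]
          exact (nodup_allPairs hitems).filter _
        rw [hval]
        refine Produces.single (S := items.toFinset) ?_ le_rfl (fun V hV => ?_) ?_ hcost id
        · refine ⟨hS, hw.1, ?_, hlen ▸ hbase, hnil, hnd, hpm, fun i hi j hj hij => ?_⟩
          · exact (one_le_pow₀ hm1).trans (hw.card_pow_le hS)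
          · by_cases hr : W.Resolved x i j
            · exact Or.inl hr
            · refine Or.inr ((mem_allPairs_or ((hmem i).2 hi) ((hmem j).2 hj) hij).imp ?_ ?_)
              · exact fun h => mem_unresolved.2 ⟨h, hr⟩
              · exact fun h => mem_unresolved.2 ⟨h, fun h => hr h.symm⟩
        · rw [callPairs_base]
          exact length_unresolved_le_pairsBelow (hlen ▸ hbase) hnd fun p hp =>
            ⟨(hpm p hp).1, (hpm p hp).2.1, (hpm p hp).2.2.1⟩
        · rw [activeWeight_base, mul_comm]
          refine mul_le_mul_of_nonneg_left ?_ hw.1.le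
          rw [← hlen]
          have : pending.length ≤ items.length ^ 2 := by
            rw [hpending, unresolved_val]
            exact (List.length_filter_le _ _).trans (length_allPairs_le items)
          exact_mod_cast this
    · have hcond : ¬ (items.length : ℝ) < Real.logb 2 n := fun h =>
        hbase ((lt_logb_iff_lt_clog hn items.length).1 h)
      have hL : Nat.clog 2 n ≤ items.toFinset.card := hlen ▸ not_lt.1 hbase
      have hS : items.toFinset.Nonempty :=
        card_pos.1 ((Nat.clog_pos (by norm_num) hn).trans_le hL)
      have hm1 : (1 : ℝ) ≤ items.toFinset.card := by exact_mod_cast hS.card_pos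
      set marked := items.filter fun i => i ∈ (mark items.toFinset).1 with hmarked
      set pending := (unresolved x W (allPairs marked)).val with hpending
      have hmnd : marked.Nodup := hitems.filter _
      have hmarked' : marked.toFinset = (mark items.toFinset).1 := by
        ext i
        have := @Marking.subset n mark items.toFinset i
        rw [List.mem_toFinset] at this
        simpa [hmarked] using this
      have hml : marked.length = (mark items.toFinset).1.card := by
        rw [← hmarked', List.toFinset_card_of_nodup hmnd]
      have hrest := routingCost_le (x := x) (opt := opt) (mark := mark) hS
      have hpairs : ((allPairs marked).length : ℝ) ≤ ((mark items.toFinset).1.card : ℝ) ^ 2 := by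
        rw [← hml]
        exact_mod_cast length_allPairs_le marked
      have hcomplete : ∀ i ∈ marked, ∀ j ∈ marked, i ≠ j →
          W.Resolved x i j ∨ (i, j) ∈ pending ∨ (j, i) ∈ pending := by
        intro i hi j hj hij
        by_cases hr : W.Resolved x i j
        · exact Or.inl hr
        · refine Or.inr ((mem_allPairs_or hi hj hij).imp ?_ ?_)
          · exact fun h => mem_unresolved.2 ⟨h, hr⟩
          · exact fun h => mem_unresolved.2 ⟨h, fun h => hr h.symm⟩
      by_cases hnil : pending = []
      · have hval : (spawn x mark W (f + 1) w items).val
            = (startRouting x W (spawn x mark W f) w items marked).val := by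
          simp only [spawn, hcond, if_false, Timed.bind_val, ← hmarked, ← hpending, hnil,
            List.isEmpty_nil, if_true]
        have hst : (spawn x mark W (f + 1) w items).steps = items.length + 1
            + ((allPairs marked).length + 1
              + (startRouting x W (spawn x mark W f) w items marked).steps) := by
          simp only [spawn, hcond, if_false, Timed.bind_steps, Timed.tick_steps, unresolved_steps,
            ← hmarked, ← hpending, hnil, List.isEmpty_nil, if_true]
        have := startRouting_produces (x := x) (opt := opt) (mark := mark) (Q := Q) hn hW hitems hS hL
          hw hmnd hmarked' (fun i hi j hj hij => by simpa [hnil] using hcomplete i hi j hj hij)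
          (recurse := spawn x mark W f)
          (fun w' items' hnd hlt hw' => ih w' items' (by omega) hnd hw')
        rw [hval]
        refine this.mono le_rfl (fun _ _ => le_rfl) ?_ ?_ id
        · have h1 : (1 : ℝ) ≤ (items.toFinset.card : ℝ) ^ 2 := one_le_pow₀ hm1
          nlinarith [hw.1]
        · rw [hst, hlen]
          push_cast
          linarith
      · have hne : pending.isEmpty = false := by simpa using hnil
        have hval : (spawn x mark W (f + 1) w items).val = [.sorting w items marked pending] := by
          simp only [spawn, hcond, if_false, Timed.bind_val, ← hmarked, ← hpending, hne,
            Bool.false_eq_true, Timed.pure_val]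
        have hst : (spawn x mark W (f + 1) w items).steps = items.length + 1
            + ((allPairs marked).length + 1) := by
          simp only [spawn, hcond, if_false, Timed.bind_steps, Timed.tick_steps, unresolved_steps,
            ← hmarked, ← hpending, hne, Bool.false_eq_true, Timed.pure_steps, add_zero]
        have hpl : pending.length ≤ items.toFinset.card := by
          refine le_trans ?_ (sq_card_marking_le (mark := mark) items.toFinset)
          rw [hpending, unresolved_val, ← hml]
          exact (List.length_filter_le _ _).trans (length_allPairs_le marked)
        rw [hval]
        refine Produces.single (S := items.toFinset) ?_ le_rfl (fun V hV => le_rfl) ?_ ?_ id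
        · exact ⟨hitems, rfl, hmnd, hmarked', hL, hw, hnil, hpl,
            fun p hp => (mem_unresolved.1 hp).2, hcomplete⟩
        · rw [activeWeight_sorting, mul_comm]
          refine mul_le_mul_of_nonneg_left ?_ hw.1.le
          refine le_trans (b := (items.toFinset.card : ℝ)) (by exact_mod_cast hpl) ?_
          nlinarith
        · rw [hst, hlen]
          push_cast
          simp only [callCost]
          linarith

end OneCall

/-! ### One turn of a call -/

section Advance

open Finset

variable {n : ℕ} {x : Fin n → Item} {opt : ℝ} {mark : Marking n} {Q : ℝ} {W : Window}

/-- A root that the window `V` separates from the optimum. -/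
def Window.Excludes (V : Window) (r : ℝ) : Prop := (r : EReal) ≤ V.lo ∨ V.hi ≤ (r : EReal)

lemma resolved_iff_excludes {V : Window} {i j : Fin n} (h : ¬ W.Resolved x i j) :
    V.Resolved x i j ↔ V.Excludes ((x i).root (x j)) :=
  ⟨fun hV => hV.resolve_left fun hs => h (Or.inl hs), Or.inr⟩

open Classical in
lemma length_unresolved_mul {V : Window} (w : ℝ) (ps : List (Fin n × Fin n))
    (h : ∀ p ∈ ps, ¬ W.Resolved x p.1 p.2) :
    ((unresolved x V ps).val.length : ℝ) * w
      = ps.length * w - weightOf V.Excludes (ps.map fun p => ((x p.1).root (x p.2), w)) := by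
  rw [unresolved_val]
  induction ps with
  | nil => simp [weightOf]
  | cons p ps ih =>
    have ih := ih fun q hq => h q (List.mem_cons_of_mem _ hq)
    have hp := resolved_iff_excludes (V := V) (h p List.mem_cons_self)
    rw [List.map_cons, weightOf_cons]
    by_cases hV : V.Resolved x p.1 p.2
    · rw [List.filter_cons_of_neg (by simpa using hV), ih, if_pos (hp.1 hV), List.length_cons]
      push_cast
      ring
    · rw [List.filter_cons_of_pos (by simpa using hV), List.length_cons, List.length_cons,
        if_neg (fun h => hV (hp.2 h))]
      push_cast
      linarith

open Classical in
lemma sum_passedWeight {V : Window} (ps : List (Probe n))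
    (h : ∀ p ∈ ps, ¬ W.Resolved x p.item p.pivot) :
    ((ps.map fun p => (p.item, p.tree, p.weight)).map (passedWeight x V)).sum
      = (ps.map Probe.weight).sum
        - weightOf V.Excludes (ps.map fun p => ((x p.item).root (x p.pivot), p.weight)) / 2 := by
  induction ps with
  | nil => simp [weightOf]
  | cons p ps ih =>
    have ih := ih fun q hq => h q (List.mem_cons_of_mem _ hq)
    have hp := resolved_iff_excludes (V := V) (h p List.mem_cons_self)
    simp only [List.map_cons, List.sum_cons, weightOf_cons]
    rw [ih]
    have hiff : HeadResolved x V p.item p.tree ↔ V.Excludes ((x p.item).root (x p.pivot)) := hp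
    unfold passedWeight
    simp only [hiff]
    split_ifs <;> ring

lemma length_active_le {call : Call n} {S : Finset (Fin n)} (h : CallInv x opt mark Q W call S) :
    (call.active x).length ≤ S.card + callPairs x opt mark W call S := by
  cases call with
  | base w pending =>
    have h : BaseInv x Q W w pending S := h
    have : (unresolved x W pending).val = pending := by
      rw [unresolved_val, List.filter_eq_self]
      intro p hp
      simpa using (h.of_mem p hp).2.2.2
    rw [callPairs_base, this]
    simp [Call.active]
  | sorting w items marked pending =>
    have h : SortingInv x opt mark Q W w items marked pending S := h
    have := h.length_le
    simp only [Call.active, List.length_map]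
    omega
  | routing w size numMarked pending settled =>
    have h : RoutingInv x opt mark Q W w size numMarked pending settled S := h
    have h1 := List.toFinset_card_of_nodup h.nodup
    have h2 : (pending.map Probe.item ++ settled.map Prod.fst).toFinset = S \ (mark S).1 := by
      ext i
      rw [List.mem_toFinset, h.mem_iff]
    have h3 : (S \ (mark S).1).card ≤ S.card := card_le_card sdiff_subset
    rw [← h2, h1, List.length_append, List.length_map] at h3
    simp only [Call.active, List.length_map]
    omega

/-- Every active comparison is unresolved and has weight at least `1 / Q`. -/
lemma CallInv.active_spec (hn : 2 ≤ n) {call : Call n} {S : Finset (Fin n)}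
    (h : CallInv x opt mark Q W call S) :
    call.active x ≠ [] ∧ ∀ a ∈ call.active x, 0 < a.2 ∧ 1 ≤ Q * a.2 ∧
      ∃ i j, a.1 = (x i).root (x j) ∧ ¬ W.Resolved x i j := by
  have hS := CallInv.nonempty hn h
  have hm1 : (1 : ℝ) ≤ S.card := by exact_mod_cast hS.card_pos
  cases call with
  | base w pending =>
    have h : BaseInv x Q W w pending S := h
    refine ⟨by simpa [Call.active] using h.ne_nil, fun a ha => ?_⟩
    obtain ⟨p, hp, rfl⟩ := List.mem_map.1 ha
    exact ⟨h.weight_pos, h.weight, p.1, p.2, rfl, (h.of_mem p hp).2.2.2⟩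
  | sorting w items marked pending =>
    have h : SortingInv x opt mark Q W w items marked pending S := h
    refine ⟨by simpa [Call.active] using h.ne_nil, fun a ha => ?_⟩
    obtain ⟨p, hp, rfl⟩ := List.mem_map.1 ha
    exact ⟨h.heavy.1, (one_le_pow₀ hm1).trans (h.heavy.card_pow_le hS), p.1, p.2, rfl,
      h.of_mem p hp⟩
  | routing w size numMarked pending settled =>
    have h : RoutingInv x opt mark Q W w size numMarked pending settled S := h
    refine ⟨by simpa [Call.active] using h.ne_nil, fun a ha => ?_⟩
    obtain ⟨p, hp, rfl⟩ := List.mem_map.1 ha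
    have hω := minRoutingWeight_pos h.heavy.1 hm1
    have hR := (h.of_mem p hp).1
    have h2 : 2 ≤ S.card := two_le_card_of_mem_sdiff
      ((h.mem_iff p.item).1 (List.mem_append_left _ (List.mem_map_of_mem hp)))
    have hQ := h.heavy.one_le_mul_minRoutingWeight h2
    refine ⟨hR.pos hω, hQ.trans ?_, p.item, p.pivot, rfl, (h.of_mem p hp).2⟩
    refine mul_le_mul_of_nonneg_left (hR.le_weight hω) ?_
    by_contra hneg
    nlinarith

open Classical in
/-- One turn of a call: half of the weight of the comparisons that become resolved is lost, and the
time spent is covered by the potential up to a constant for every active comparison. -/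
lemma advance_produces (hn : 2 ≤ n) {V : Window} (hVW : V.Within W) (hV : V.Contains opt)
    {call : Call n} {S : Finset (Fin n)} (h : CallInv x opt mark Q W call S) :
    Produces x opt mark Q V (Call.advance x mark V call).val S.card
      (fun V' => callPairs x opt mark V' call S)
      (activeWeight x call - weightOf V.Excludes (call.active x) / 2)
      (callCost x opt mark call S + 2 * (call.active x).length + 1
        - (Call.advance x mark V call).steps)
      (Conflict x opt S) := by
  have hS := CallInv.nonempty hn h
  have hm1 : (1 : ℝ) ≤ S.card := by exact_mod_cast hS.card_pos
  cases call with
  | base w pending =>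
    have h : BaseInv x Q W w pending S := h
    have hmul := length_unresolved_mul (V := V) w pending fun p hp => (h.of_mem p hp).2.2.2
    have hle : weightOf V.Excludes ((Call.base w pending).active x) ≤ pending.length * w := by
      have : (0 : ℝ) ≤ (unresolved x V pending).val.length * w :=
        mul_nonneg (by positivity) h.weight_pos.le
      simp only [Call.active]
      linarith
    have h0 : 0 ≤ weightOf V.Excludes ((Call.base w pending).active x) := by
      have : ((unresolved x V pending).val.length : ℝ) ≤ pending.length := by
        rw [unresolved_val]
        exact_mod_cast List.length_filter_le _ _
      have := mul_le_mul_of_nonneg_right this h.weight_pos.le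
      simp only [Call.active]
      linarith
    have hst : (Call.advance x mark V (.base w pending)).steps = pending.length + 1 := by
      simp only [Call.advance, Timed.bind_steps, unresolved_steps]
      split_ifs <;> simp
    have hlen : ((Call.base w pending).active x).length = pending.length := by
      simp [Call.active]
    rw [activeWeight_base, hst, hlen]
    have hp0 : (0 : ℝ) ≤ pending.length := by positivity
    by_cases hnil : (unresolved x V pending).val = []
    · have hval : (Call.advance x mark V (.base w pending)).val = [] := by
        simp only [Call.advance, Timed.bind_val, hnil, List.isEmpty_nil, if_true, Timed.pure_val]
      rw [hval]
      refine Produces.nil (by linarith) ?_ ?_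
      · simp only [callCost]
        push_cast
        linarith
      · rintro ⟨i, hi, j, hj, hs, he⟩
        have hij : i ≠ j := fun h => hs (by rw [h])
        have hun := hV.not_resolved hs he
        rcases h.complete i hi j hj hij with hr | hr | hr
        · exact hun (hr.mono hVW)
        · have : (i, j) ∈ (unresolved x V pending).val := mem_unresolved.2 ⟨hr, hun⟩
          simp [hnil] at this
        · have : (j, i) ∈ (unresolved x V pending).val :=
            mem_unresolved.2 ⟨hr, fun h => hun h.symm⟩
          simp [hnil] at this
    · have hval : (Call.advance x mark V (.base w pending)).val
          = [.base w (unresolved x V pending).val] := by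
        have : (unresolved x V pending).val.isEmpty = false := by simpa using hnil
        simp only [Call.advance, Timed.bind_val, this, Bool.false_eq_true, if_false,
          Timed.pure_val]
      rw [hval]
      refine Produces.single (S := S) ?_ le_rfl (fun V' _ => ?_) ?_ ?_ id
      · refine ⟨hS, h.weight_pos, h.weight, h.card_lt, hnil, ?_, fun p hp => ?_,
          fun i hi j hj hij => ?_⟩
        · rw [unresolved_val]
          exact h.nodup.filter _
        · have hp := mem_unresolved.1 hp
          have h' := h.of_mem p hp.1
          exact ⟨h'.1, h'.2.1, h'.2.2.1, hp.2⟩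
        · by_cases hr : V.Resolved x i j
          · exact Or.inl hr
          · refine Or.inr (((h.complete i hi j hj hij).resolve_left
              fun h => hr (h.mono hVW)).imp ?_ ?_)
            · exact fun h => mem_unresolved.2 ⟨h, hr⟩
            · exact fun h => mem_unresolved.2 ⟨h, fun h => hr h.symm⟩
      · rw [callPairs_base, callPairs_base, unresolved_val, unresolved_val, unresolved_val]
        exact (List.filter_sublist.filter _).length_le
      · rw [activeWeight_base, hmul]
        simp only [Call.active] at h0 ⊢
        linarith
      · simp only [callCost]
        push_cast
        linarith
  | sorting w items marked pending =>
    have h : SortingInv x opt mark Q W w items marked pending S := h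
    have hw := h.heavy.1
    have hmul := length_unresolved_mul (V := V) w pending h.of_mem
    have hlen : ((Call.sorting w items marked pending).active x).length = pending.length := by
      simp [Call.active]
    have h0 : 0 ≤ weightOf V.Excludes ((Call.sorting w items marked pending).active x) := by
      have : ((unresolved x V pending).val.length : ℝ) ≤ pending.length := by
        rw [unresolved_val]
        exact_mod_cast List.length_filter_le _ _
      have := mul_le_mul_of_nonneg_right this hw.le
      simp only [Call.active]
      linarith
    have hp0 : (1 : ℝ) ≤ pending.length := by
      exact_mod_cast List.length_pos_iff.2 h.ne_nil
    have hcomplete : ∀ i ∈ marked, ∀ j ∈ marked, i ≠ j → V.Resolved x i j ∨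
        (i, j) ∈ (unresolved x V pending).val ∨ (j, i) ∈ (unresolved x V pending).val := by
      intro i hi j hj hij
      by_cases hr : V.Resolved x i j
      · exact Or.inl hr
      · refine Or.inr (((h.complete i hi j hj hij).resolve_left
          fun h => hr (h.mono hVW)).imp ?_ ?_)
        · exact fun h => mem_unresolved.2 ⟨h, hr⟩
        · exact fun h => mem_unresolved.2 ⟨h, fun h => hr h.symm⟩
    rw [activeWeight_sorting, hlen]
    by_cases hnil : (unresolved x V pending).val = []
    · have hval : (Call.advance x mark V (.sorting w items marked pending)).val
          = (startRouting x V (spawn x mark V items.length) w items marked).val := by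
        simp only [Call.advance, Timed.bind_val, hnil, List.isEmpty_nil, if_true]
      have hst : (Call.advance x mark V (.sorting w items marked pending)).steps
          = pending.length + 1
            + (startRouting x V (spawn x mark V items.length) w items marked).steps := by
        simp only [Call.advance, Timed.bind_steps, unresolved_steps, hnil, List.isEmpty_nil,
          if_true]
      obtain rfl := h.items_eq
      have := startRouting_produces (x := x) (opt := opt) (mark := mark) (Q := Q) hn hV
        h.items_nodup hS h.le_card h.heavy h.marked_nodup h.marked_eq
        (fun i hi j hj hij => by simpa [hnil] using hcomplete i hi j hj hij)
        (recurse := spawn x mark V items.length)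
        (fun w' items' hnd hlt hw' => spawn_produces hn hV _ _ _
          (hlt.le.trans (List.toFinset_card_le _)) hnd hw')
      rw [hval]
      refine this.mono le_rfl (fun _ _ => le_rfl) ?_ ?_ id
      · rw [hnil, List.length_nil, Nat.cast_zero, zero_mul] at hmul
        simp only [Call.active]
        nlinarith
      · rw [hst]
        simp only [callCost]
        push_cast
        linarith
    · have hne : (unresolved x V pending).val.isEmpty = false := by simpa using hnil
      have hval : (Call.advance x mark V (.sorting w items marked pending)).val
          = [.sorting w items marked (unresolved x V pending).val] := by
        simp only [Call.advance, Timed.bind_val, hne, Bool.false_eq_true, if_false,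
          Timed.pure_val]
      have hst : (Call.advance x mark V (.sorting w items marked pending)).steps
          = pending.length + 1 := by
        simp only [Call.advance, Timed.bind_steps, unresolved_steps, hne, Bool.false_eq_true,
          if_false, Timed.pure_steps, add_zero]
      rw [hval]
      refine Produces.single (S := S) ?_ le_rfl (fun V' _ => le_rfl) ?_ ?_ id
      · refine ⟨h.items_nodup, h.items_eq, h.marked_nodup, h.marked_eq, h.le_card, h.heavy, hnil,
          ?_, fun p hp => (mem_unresolved.1 hp).2, hcomplete⟩
        refine le_trans ?_ h.length_le
        rw [unresolved_val]
        exact List.length_filter_le _ _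
      · rw [activeWeight_sorting, hmul]
        simp only [Call.active] at h0 ⊢
        linarith
      · rw [hst]
        simp only [callCost]
        push_cast
        linarith
  | routing w size numMarked pending settled =>
    have h : RoutingInv x opt mark Q W w size numMarked pending settled S := h
    obtain rfl := h.size_eq
    obtain rfl := h.numMarked_eq
    have hω := minRoutingWeight_pos h.heavy.1 hm1
    have hpassed := sum_passedWeight (V := V) pending fun p hp => (h.of_mem p hp).2
    have haw : activeWeight x (.routing w S.card (mark S).1.card pending settled)
        = (pending.map Probe.weight).sum := by
      simp only [activeWeight, Call.active, List.map_map]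
      rfl
    have hfst : (pending.map fun p => (p.item, p.tree, p.weight)).map Prod.fst
        = pending.map Probe.item := by
      rw [List.map_map]
      rfl
    have := route_produces (x := x) (opt := opt) (mark := mark) (Q := Q) (W := V) hn hV hS h.le_card
      h.heavy (fun i hi j hj hij => (h.marked_resolved i hi j hj hij).mono hVW)
      (todo := pending.map fun p => (p.item, p.tree, p.weight)) (settled := settled)
      (fun a ha => by
        obtain ⟨p, hp, rfl⟩ := List.mem_map.1 ha
        exact (h.of_mem p hp).1.mono hVW)
      (by rw [hfst]; exact h.nodup) (by rw [hfst]; exact h.mem_iff)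
      (fun s hs => ⟨(h.of_settled s hs).1, fun p hp ha => ((h.of_settled s hs).2 p hp ha).mono hVW⟩)
      (recurse := spawn x mark V S.card)
      (fun w' items' hnd hlt hw' => spawn_produces hn hV _ _ _ hlt.le hnd hw')
      le_rfl
      (fun hall => by
        -- all heads are resolved, so that half of every weight is passed on
        obtain ⟨p, hp⟩ := List.exists_mem_of_ne_nil _ h.ne_nil
        have hpos : ∀ y ∈ (pending.map fun p => (p.item, p.tree, p.weight)).map
            (passedWeight x V), 0 ≤ y := by
          intro y hy
          obtain ⟨a, ha, rfl⟩ := List.mem_map.1 hy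
          obtain ⟨q, hq, rfl⟩ := List.mem_map.1 ha
          have := (h.of_mem q hq).1.pos hω
          unfold passedWeight
          split_ifs
          · exact (half_pos this).le
          · exact this.le
        have hmem : (p.item, p.tree, p.weight) ∈ pending.map fun p => (p.item, p.tree, p.weight) :=
          List.mem_map_of_mem hp
        refine le_trans ?_ (List.single_le_sum hpos _ (List.mem_map_of_mem hmem))
        rw [passedWeight, if_pos (hall _ hmem)]
        have := (h.of_mem p hp).1.le_weight hω
        linarith)
    refine this.mono le_rfl (fun _ _ => le_rfl) ?_ ?_ id
    · rw [hpassed, haw]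
      rfl
    · have hst : (Call.advance x mark V
          (.routing w S.card (mark S).1.card pending settled)).steps
          = (route x V (spawn x mark V S.card) w S.card (mark S).1.card
            (pending.map fun p => (p.item, p.tree, p.weight)) settled).steps := rfl
      have hlen : ((Call.routing w S.card (mark S).1.card pending settled).active x).length
          = pending.length := by
        simp [Call.active]
      have hsum : ((pending.map fun p => (p.item, p.tree, p.weight)).map
          fun a => a.2.1.height + 3).sum
          = (pending.map fun p => 1 + p.tree.height).sum + 2 * pending.length := by
        clear * -
        induction pending with
        | nil => simp
        | cons p l ih =>
          simp only [List.map_cons, List.sum_cons, ih, List.length_cons]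
          ring
      rw [hst, hlen, hsum]
      simp only [callCost]
      push_cast
      linarith

end Advance

/-! ### The turns of the search -/

section Turns

open Finset

variable {n : ℕ} {x : Fin n → Item} {opt : ℝ} {mark : Marking n} {Q : ℝ} {W : Window}

/-- The windows that can occur in a search: their endpoints are roots or infinite. -/
noncomputable def rootWindow (x : Fin n → Item)
    (a : Option (Fin n × Fin n) × Option (Fin n × Fin n)) : Window where
  lo := a.1.elim ⊥ fun p => (((x p.1).root (x p.2) : ℝ) : EReal)
  hi := a.2.elim ⊤ fun p => (((x p.1).root (x p.2) : ℝ) : EReal)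

lemma weightOf_le_weightOf {P R : ℝ → Prop} [DecidablePred P] [DecidablePred R] {l : List (ℝ × ℝ)}
    (h0 : ∀ a ∈ l, 0 ≤ a.2) (h : ∀ a ∈ l, P a.1 → R a.1) : weightOf P l ≤ weightOf R l := by
  induction l with
  | nil => simp [weightOf]
  | cons a l ih =>
    have ih := ih (fun b hb => h0 b (List.mem_cons_of_mem _ hb))
      fun b hb => h b (List.mem_cons_of_mem _ hb)
    have h1 := h0 a List.mem_cons_self
    have h2 := h a List.mem_cons_self
    rw [weightOf_cons, weightOf_cons]
    split_ifs with h3 h4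
    · linarith
    · exact absurd (h2 h3) h4
    · linarith
    · linarith

lemma weightOf_flatMap {α : Type} (P : ℝ → Prop) [DecidablePred P] (f : α → List (ℝ × ℝ))
    (l : List α) : weightOf P (l.flatMap f) = (l.map fun a => weightOf P (f a)).sum := by
  induction l with
  | nil => simp [weightOf]
  | cons a l ih =>
    rw [List.flatMap_cons, List.map_cons, List.sum_cons, ← ih]
    simp [weightOf]

lemma sum_weight_flatMap {α : Type} (f : α → List (ℝ × ℝ)) (l : List α) :
    ((l.flatMap f).map Prod.snd).sum = (l.map fun a => ((f a).map Prod.snd).sum).sum := by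
  induction l with
  | nil => simp
  | cons a l ih =>
    rw [List.flatMap_cons, List.map_append, List.sum_append, List.map_cons, List.sum_cons, ← ih]

lemma callCost_nonneg (call : Call n) (S : Finset (Fin n)) : 0 ≤ callCost x opt mark call S := by
  have hlog : 0 ≤ Real.logb 2 (S.card : ℝ) := by
    rcases Nat.eq_zero_or_pos S.card with h | h
    · simp [h]
    · exact Real.logb_nonneg (by norm_num) (by exact_mod_cast h)
  have h := boxesCost_nonneg (x := x) (opt := opt) (mark := mark) S
  cases call with
  | base w pending => exact le_rfl
  | sorting w items marked pending =>
    simp only [callCost, routingCost]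
    positivity
  | routing w size numMarked pending settled =>
    simp only [callCost]
    positivity

/-- In a turn at least half of the active weight is resolved, and half of that is lost. -/
lemma collect_advance_produces (hn : 2 ≤ n) {V : Window} (hVW : V.Within W) (hV : V.Contains opt)
    {tagged : List (Call n × Finset (Fin n))}
    (hinv : ∀ t ∈ tagged, CallInv x opt mark Q W t.1 t.2)
    (hsize : (tagged.map fun t => t.2.card).sum ≤ n) {pairs : Window → ℕ}
    (hpairs : ∀ V : Window, V.Within W →
      (tagged.map fun t => callPairs x opt mark V t.1 t.2).sum ≤ pairs V)
    {cost : ℝ} (hcost : (tagged.map fun t => callCost x opt mark t.1 t.2).sum ≤ cost)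
    (hconflict : ∃ t ∈ tagged, Conflict x opt t.2) {act : List (ℝ × ℝ)}
    (hact : act = (tagged.map Prod.fst).flatMap (Call.active x))
    (hhalf : ∃ _ : DecidablePred V.Excludes, (act.map Prod.snd).sum / 2 ≤ weightOf V.Excludes act) :
    Produces x opt mark Q V (collect (Call.advance x mark V) (tagged.map Prod.fst)).val n pairs
      (3 / 4 * (act.map Prod.snd).sum)
      (cost + 2 * act.length + 3 * n
        - (collect (Call.advance x mark V) (tagged.map Prod.fst)).steps) True := by
  classical
  have h := collect_produces (x := x) (opt := opt) (mark := mark) (Q := Q) (W := V) hn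
    (Call.advance x mark V) Prod.fst (fun t => t.2.card)
    (fun t V' => callPairs x opt mark V' t.1 t.2)
    (fun t => activeWeight x t.1 - weightOf V.Excludes (t.1.active x) / 2)
    (fun t => callCost x opt mark t.1 t.2 + 2 * (t.1.active x).length + 1)
    (fun t => Conflict x opt t.2) tagged
    (fun t ht => by
      convert advance_produces hn hVW hV (hinv t ht) using 3)
  have hactW : (tagged.map fun t => activeWeight x t.1 - weightOf V.Excludes (t.1.active x) / 2).sum
      = (act.map Prod.snd).sum - weightOf V.Excludes act / 2 := by
    rw [hact, sum_weight_flatMap, weightOf_flatMap]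
    unfold activeWeight
    clear * -
    induction tagged with
    | nil => simp
    | cons t l ih =>
      simp only [List.map_cons, List.sum_cons, ih]
      ring
  have hcosts : (tagged.map fun t =>
      callCost x opt mark t.1 t.2 + 2 * ((t.1.active x).length : ℝ) + 1 + (t.2.card : ℝ) + 1).sum
      = (tagged.map fun t => callCost x opt mark t.1 t.2).sum + 2 * act.length
        + 2 * tagged.length + ((tagged.map fun t => t.2.card).sum : ℕ) := by
    rw [hact]
    clear * -
    induction tagged with
    | nil => simp
    | cons t l ih =>
      simp only [List.map_cons, List.sum_cons, ih, List.flatMap_cons, List.length_append,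
        List.length_cons]
      push_cast
      ring
  have hlen := length_le_sum_card hn hinv
  refine h.mono hsize (fun V' hV' => hpairs V' (hV'.trans hVW)) ?_ ?_ fun _ => hconflict
  · rw [hactW]
    have hP' : (act.map Prod.snd).sum / 2 ≤ weightOf V.Excludes act := by
      obtain ⟨P, hP⟩ := hhalf
      convert hP
    linarith
  · rw [hcosts]
    have h1 : (tagged.length : ℝ) ≤ n := by exact_mod_cast hlen.trans hsize
    have h2 : (((tagged.map fun t => t.2.card).sum : ℕ) : ℝ) ≤ n := by exact_mod_cast hsize
    linarith

/-- A pair of items that becomes resolved makes the number of unresolved pairs drop. -/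
lemma card_unrelatedPairs_lt {V : Window} (hVW : V.Within W) {i j : Fin n}
    (h : ¬ W.Resolved x i j) (h' : V.Resolved x i j) :
    (unrelatedPairs (V.Resolved x) univ).card < (unrelatedPairs (W.Resolved x) univ).card := by
  classical
  refine card_lt_card (Finset.ssubset_iff_of_subset ?_ |>.2 ⟨(i, j), ?_, ?_⟩)
  · intro p hp
    simp only [unrelatedPairs, mem_filter, mem_product, mem_univ, true_and, and_self] at hp ⊢
    exact ⟨hp.1, fun hr => hp.2 (hr.mono hVW)⟩
  · have : i ≠ j := fun hij => h (Or.inl (by rw [hij]))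
    simp [unrelatedPairs, this, h]
  · simp [unrelatedPairs, h']

/-- The search finds the optimum.  Its number of queries is logarithmic in the initial active weight
times `Q`, since the weight drops by a quarter in every turn and the last active comparison has
weight at least `1 / Q`; its time is bounded by the potential and by the passes over the active
comparisons, of which there are at most `n + N`; the selection of the median takes at most `12545`
steps for each of them, the other passes make up the rest of the constant. -/
lemma turns_spec (hn : 2 ≤ n) {decideAt : ℝ → Timed Ordering} {c : ℕ}
    (hdec : IsDecisionAlgorithm decideAt opt c) {N : ℕ}
    (hN : ∀ a, pairsBelow x opt mark (rootWindow x a) univ ≤ N) (f : ℕ) :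
    ∀ (a : Option (Fin n × Fin n) × Option (Fin n × Fin n)) (calls : List (Call n))
      (weight cost : ℝ), (rootWindow x a).Contains opt →
    (unrelatedPairs ((rootWindow x a).Resolved x) univ).card ≤ f →
    Produces x opt mark Q (rootWindow x a) calls n (fun V => pairsBelow x opt mark V univ) weight
      cost True →
    (turns x decideAt mark f (rootWindow x a) calls).val.answer = some opt ∧
    (4 / 3 : ℝ) ^ (turns x decideAt mark f (rootWindow x a) calls).val.queries
      ≤ 4 / 3 * (weight * Q) ∧
    ((turns x decideAt mark f (rootWindow x a) calls).steps : ℝ)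
      ≤ cost + (turns x decideAt mark f (rootWindow x a) calls).val.queries
        * (c + 12553 * (n + N)) := by
  induction f with
  | zero =>
    rintro a calls weight cost hW hf ⟨tagged, -, hinv, -, -, -, -, hconf⟩
    obtain ⟨t, ht, -⟩ := hconf trivial
    obtain ⟨hne, hact⟩ := CallInv.active_spec hn (hinv t ht)
    obtain ⟨b, hb⟩ := List.exists_mem_of_ne_nil _ hne
    obtain ⟨-, -, i, j, -, hij⟩ := hact b hb
    have : (i, j) ∈ unrelatedPairs ((rootWindow x a).Resolved x) univ := by
      have : i ≠ j := fun h => hij (Or.inl (by rw [h]))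
      simp [unrelatedPairs, this, hij]
    rw [card_eq_zero.1 (Nat.le_zero.1 hf)] at this
    simp at this
  | succ f ih =>
    rintro a calls weight cost hW hf ⟨tagged, rfl, hinv, hsize, hpairs, hweight, hcost, hconf⟩
    have hconf := hconf trivial
    set W := rootWindow x a with hWdef
    set calls := tagged.map Prod.fst with hcalls
    set act := calls.flatMap (Call.active x) with hact
    have hspec : ∀ b ∈ act, 0 < b.2 ∧ 1 ≤ Q * b.2 ∧
        ∃ i j, b.1 = (x i).root (x j) ∧ ¬ W.Resolved x i j := by
      intro b hb
      obtain ⟨call, hc, hb⟩ := List.mem_flatMap.1 hb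
      obtain ⟨t, ht, rfl⟩ := List.mem_map.1 hc
      exact (CallInv.active_spec hn (hinv t ht)).2 b hb
    have hne : act ≠ [] := by
      obtain ⟨t, ht, -⟩ := hconf
      obtain ⟨b, hb⟩ := List.exists_mem_of_ne_nil _ (CallInv.active_spec hn (hinv t ht)).1
      exact List.ne_nil_of_mem (List.mem_flatMap.2 ⟨t.1, List.mem_map_of_mem ht, hb⟩)
    have hempty : act.isEmpty = false := by simpa using hne
    have hactsum : (act.map Prod.snd).sum ≤ weight := by
      rw [hact, sum_weight_flatMap, hcalls, List.map_map]
      exact hweight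
    obtain ⟨⟨b, hb, hbr⟩, hlow, hhigh, hmst⟩ := weightedMedian_spec hne fun b hb => (hspec b hb).1
    set r := (weightedMedian act).val with hr
    obtain ⟨hb0, hQb, i, j, hij, hun⟩ := hspec b hb
    have hrij : r = (x i).root (x j) := hbr.symm.trans hij
    have hQ : 0 < Q := by
      by_contra h
      nlinarith
    have hone : 1 ≤ weight * Q := by
      have h1 : b.2 ≤ (act.map Prod.snd).sum := List.single_le_sum (by
        intro y hy
        obtain ⟨d, hd, rfl⟩ := List.mem_map.1 hy
        exact (hspec d hd).1.le) _ (List.mem_map_of_mem hb)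
      nlinarith
    have hlen : (act.length : ℝ) ≤ n + N := by
      have h1 : act.length ≤ (tagged.map fun t => t.2.card).sum
          + (tagged.map fun t => callPairs x opt mark W t.1 t.2).sum := by
        rw [hact, hcalls]
        clear * - hinv
        induction tagged with
        | nil => simp
        | cons t l ih =>
          have h1 := ih fun s hs => hinv s (List.mem_cons_of_mem _ hs)
          have h2 := length_active_le (hinv t List.mem_cons_self)
          simp only [List.map_cons, List.sum_cons, List.flatMap_cons, List.length_append]
          omega
      have h2 := (hpairs W (Window.Within.refl W)).trans (hN a)
      exact_mod_cast h1.trans (add_le_add hsize h2)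
    have hcl : (calls.length : ℝ) ≤ n := by
      have h1 := (length_le_sum_card hn hinv).trans hsize
      rw [hcalls, List.length_map]
      exact_mod_cast h1
    have hn1 : (1 : ℝ) ≤ n := by exact_mod_cast (by omega : 1 ≤ n)
    have hmst' : ((weightedMedian act).steps : ℝ) ≤ 12545 * act.length := by exact_mod_cast hmst
    have hdt : ((decideAt r).steps : ℝ) ≤ c := by exact_mod_cast hdec.time_le r
    have hcost0 : 0 ≤ cost := by
      refine le_trans (List.sum_nonneg ?_) hcost
      intro y hy
      obtain ⟨t, -, rfl⟩ := List.mem_map.1 hy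
      exact callCost_nonneg _ _
    have hlo : W.lo < (r : EReal) := by
      rw [hrij]
      exact not_le.1 fun h => hun (Or.inr (Or.inl h))
    have hhi : (r : EReal) < W.hi := by
      rw [hrij]
      exact not_le.1 fun h => hun (Or.inr (Or.inr h))
    -- both outcomes of the query are treated alike
    have hturn : ∀ a' : Option (Fin n × Fin n) × Option (Fin n × Fin n),
        (rootWindow x a').Within W → (rootWindow x a').Contains opt →
        (rootWindow x a').Excludes r →
        (∃ _ : DecidablePred (rootWindow x a').Excludes,
          (act.map Prod.snd).sum / 2 ≤ weightOf (rootWindow x a').Excludes act) →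
        (turns x decideAt mark (f + 1) W calls).val.answer
          = (turns x decideAt mark f (rootWindow x a')
            (collect (Call.advance x mark (rootWindow x a')) calls).val).val.answer →
        (turns x decideAt mark (f + 1) W calls).val.queries
          = (turns x decideAt mark f (rootWindow x a')
            (collect (Call.advance x mark (rootWindow x a')) calls).val).val.queries + 1 →
        (turns x decideAt mark (f + 1) W calls).steps
          = calls.length + act.length + 1 + ((weightedMedian act).steps + ((decideAt r).steps
            + ((collect (Call.advance x mark (rootWindow x a')) calls).steps
              + (turns x decideAt mark f (rootWindow x a')
              (collect (Call.advance x mark (rootWindow x a')) calls).val).steps))) →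
        (turns x decideAt mark (f + 1) W calls).val.answer = some opt ∧
        (4 / 3 : ℝ) ^ (turns x decideAt mark (f + 1) W calls).val.queries
          ≤ 4 / 3 * (weight * Q) ∧
        ((turns x decideAt mark (f + 1) W calls).steps : ℝ)
          ≤ cost + (turns x decideAt mark (f + 1) W calls).val.queries
            * (c + 12553 * (n + N)) := by
      intro a' hin hcont hex hhalf hans hq hst
      have hprod := collect_advance_produces (x := x) (opt := opt) (mark := mark) (Q := Q) hn hin
        hcont hinv hsize hpairs hcost hconf hact hhalf
      have hfuel := card_unrelatedPairs_lt (x := x) hin hun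
        ((resolved_iff_excludes hun).2 (hrij ▸ hex))
      obtain ⟨i1, i2, i3⟩ := ih a' _ _ _ hcont (by omega) hprod
      refine ⟨hans.trans i1, ?_, ?_⟩
      · rw [hq, pow_succ]
        have := mul_le_mul_of_nonneg_right hactsum hQ.le
        linarith
      · rw [hst, hq]
        push_cast
        linarith
    cases hcmp : cmp r opt with
    | lt =>
      have hlt : r < opt := cmp_eq_lt_iff _ _ |>.1 hcmp
      have hval := hdec.correct r
      rw [hcmp] at hval
      have hwin : rootWindow x (some (i, j), a.2) = ⟨(r : EReal), W.hi⟩ := by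
        rw [hrij]
        rfl
      refine hturn (some (i, j), a.2) ?_ ?_ ?_ ?_ ?_ ?_ ?_
      · rw [hwin]
        exact ⟨hlo.le, le_rfl⟩
      · rw [hwin]
        exact ⟨EReal.coe_lt_coe_iff.2 hlt, hW.2⟩
      · rw [hwin]
        exact Or.inl le_rfl
      · classical
        refine ⟨inferInstance, hlow.trans (weightOf_le_weightOf (fun b hb => (hspec b hb).1.le) ?_)⟩
        intro b _ hb
        rw [hwin]
        exact Or.inl (EReal.coe_le_coe_iff.2 hb)
      all_goals
        rw [hwin]
        simp only [turns, Timed.bind_val, Timed.bind_steps, Timed.tick_steps, ← hact, hempty,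
          Bool.false_eq_true, if_false, ← hr, hval, Timed.pure_val, Timed.pure_steps, add_zero]
    | gt =>
      have hlt : opt < r := cmp_eq_gt_iff _ _ |>.1 hcmp
      have hval := hdec.correct r
      rw [hcmp] at hval
      have hwin : rootWindow x (a.1, some (i, j)) = ⟨W.lo, (r : EReal)⟩ := by
        rw [hrij]
        rfl
      refine hturn (a.1, some (i, j)) ?_ ?_ ?_ ?_ ?_ ?_ ?_
      · rw [hwin]
        exact ⟨le_rfl, hhi.le⟩
      · rw [hwin]
        exact ⟨hW.1, EReal.coe_lt_coe_iff.2 hlt⟩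
      · rw [hwin]
        exact Or.inr le_rfl
      · classical
        refine ⟨inferInstance, hhigh.trans (weightOf_le_weightOf (fun b hb => (hspec b hb).1.le) ?_)⟩
        intro b _ hb
        rw [hwin]
        exact Or.inr (EReal.coe_le_coe_iff.2 hb)
      all_goals
        rw [hwin]
        simp only [turns, Timed.bind_val, Timed.bind_steps, Timed.tick_steps, ← hact, hempty,
          Bool.false_eq_true, if_false, ← hr, hval, Timed.pure_val, Timed.pure_steps, add_zero]
    | eq =>
      have heq : r = opt := cmp_eq_eq_iff _ _ |>.1 hcmp
      have hval := hdec.correct r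
      rw [hcmp] at hval
      have hout : (turns x decideAt mark (f + 1) W calls).val = ⟨some r, 1⟩ := by
        simp only [turns, Timed.bind_val, ← hact, hempty, Bool.false_eq_true, if_false, ← hr, hval,
          Timed.pure_val]
      have hst : (turns x decideAt mark (f + 1) W calls).steps
          = calls.length + act.length + 1 + ((weightedMedian act).steps + (decideAt r).steps) := by
        simp only [turns, Timed.bind_steps, Timed.tick_steps, ← hact, hempty, Bool.false_eq_true,
          if_false, ← hr, hval, Timed.pure_steps, add_zero]
      rw [hout, hst]
      refine ⟨by rw [heq], ?_, ?_⟩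
      · rw [pow_one]
        linarith
      · push_cast
        linarith

end Turns

/-! ### The whole search -/

section Search

open Finset

variable {n : ℕ} {x : Fin n → Item} {opt : ℝ} {mark : Marking n} {Q : ℝ}

lemma parametricSearch_spec (hn : 2 ≤ n) {B : ℝ → Prop} (hB : IsSortingProblem x B opt)
    {decideAt : ℝ → Timed Ordering} {c : ℕ} (hdec : IsDecisionAlgorithm decideAt opt c) {N : ℕ}
    (hN : ∀ a, pairsBelow x opt mark (rootWindow x a) univ ≤ N)
    (hQ : ∀ e, (pathProduct (itemKey x opt) mark e univ : ℝ) ^ 7 ≤ Q) :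
    (parametricSearch x decideAt mark).val.answer = some opt ∧
    (4 / 3 : ℝ) ^ (parametricSearch x decideAt mark).val.queries ≤ 4 / 3 * (n ^ 2 * Q) ∧
    ((parametricSearch x decideAt mark).steps : ℝ) ≤ n + 5 + spawnCost x opt mark univ
      + (parametricSearch x decideAt mark).val.queries * (c + 12553 * (n + N)) := by
  have hW : (rootWindow x (none, none)).Contains opt :=
    ⟨EReal.bot_lt_coe opt, EReal.coe_lt_top opt⟩
  have hfin : (List.finRange n).toFinset = univ := by
    ext i
    simp
  have hspawn := spawn_produces (x := x) (mark := mark) (Q := Q) hn hW n 1 (List.finRange n)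
    (by simp) (List.nodup_finRange n) (by
      rw [hfin]
      exact ⟨one_pos, fun e _ => by simpa using hQ e⟩)
  rw [hfin, card_univ, Fintype.card_fin, one_mul] at hspawn
  obtain ⟨h1, h2, h3⟩ := turns_spec hn hdec hN (n * n) (none, none) _ _ _ hW (by
    refine (card_unrelatedPairs_le _ _).trans ?_
    rw [card_univ, Fintype.card_fin, sq])
    (hspawn.mono le_rfl (fun _ _ => le_rfl) le_rfl le_rfl fun _ => hB.conflict_univ)
  have hval : (parametricSearch x decideAt mark).val = (turns x decideAt mark (n * n)
      (rootWindow x (none, none)) (spawn x mark (rootWindow x (none, none)) n 1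
        (List.finRange n)).val).val := rfl
  have hst : (parametricSearch x decideAt mark).steps = n + 1
      + ((spawn x mark (rootWindow x (none, none)) n 1 (List.finRange n)).steps
        + (turns x decideAt mark (n * n) (rootWindow x (none, none))
          (spawn x mark (rootWindow x (none, none)) n 1 (List.finRange n)).val).steps) := rfl
  rw [hval, hst]
  refine ⟨h1, h2, ?_⟩
  push_cast
  linarith

end Search

theorem mainTheorem1 :
    ∃ K : ℝ, 0 < K ∧ ∃ b : ℝ, 0 < b ∧
      ∀ (n : ℕ), 2 ≤ n → ∀ (x : Fin n → Item) (B : ℝ → Prop) (opt : ℝ)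
        (decideAt : ℝ → Timed Ordering) (c : ℕ),
        IsSortingProblem x B opt → IsDecisionAlgorithm decideAt opt c →
          (∀ mark : Marking n, (parametricSearch x decideAt mark).val.answer = some opt) ∧
          1 - Real.exp (-(Real.log n) ^ b) ≤
            markingProb n fun mark =>
              ((parametricSearch x decideAt mark).val.queries : ℝ) ≤ K * Real.log n ∧
              ((parametricSearch x decideAt mark).steps : ℝ) ≤
                K * (n * Real.log n + Real.log n * c) := by
  obtain ⟨C, K, hCK⟩ := exists_whp_bounds
  have hlog : 0 < Real.log (4 / 3) := Real.log_pos (by norm_num)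
  -- queries are at most `K₁ * log n`
  set K₁ : ℝ := (7 * C + 3) / Real.log (4 / 3) with hK₁
  have hK₁0 : 0 ≤ K₁ := by positivity
  refine ⟨K₁ * (1 + 12553 * (1 + K)) + 72 + 60 * C, by positivity, 1, one_pos, ?_⟩
  intro n hn x B opt decideAt c hB hdec
  have hn2 : (2 : ℝ) ≤ n := by exact_mod_cast hn
  constructor
  · intro mark
    refine (parametricSearch_spec (N := n ^ 2)
      (Q := ∑ e : Fin n, (pathProduct (itemKey x opt) mark e Finset.univ : ℝ) ^ 7) hn hB hdec
      (fun a => ?_) fun e => ?_).1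
    · have := basePairs_le_sq (key := itemKey x opt) (res := (rootWindow x a).Resolved x)
        (L := Nat.clog 2 n) mark Finset.univ
      rwa [Finset.card_univ, Fintype.card_fin] at this
    · exact Finset.single_le_sum (f := fun e : Fin n =>
        (pathProduct (itemKey x opt) mark e Finset.univ : ℝ) ^ 7) (fun _ _ => by positivity)
        (Finset.mem_univ e)
  · have hprob := hCK n hn (key := itemKey x opt) itemKey_injective
      (Finset.univ : Finset (Option (Fin n × Fin n) × Option (Fin n × Fin n)))
      (fun a => (rootWindow x a).Resolved x) (fun a i j h => h.symm) (by
        simp only [Finset.card_univ, Fintype.card_prod, Fintype.card_option, Fintype.card_fin]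
        have h1 : n * n + 1 ≤ 2 * (n * n) := by nlinarith
        calc (n * n + 1) * (n * n + 1) ≤ (2 * (n * n)) * (2 * (n * n)) := Nat.mul_le_mul h1 h1
          _ = 4 * n ^ 4 := by ring)
    have hexp : Real.exp (-(Real.log n) ^ (1 : ℝ)) = 1 / n := by
      rw [Real.rpow_one, Real.exp_neg, Real.exp_log (by linarith), one_div]
    rw [hexp]
    refine hprob.trans (markingProb_mono fun mark hmark => ?_)
    obtain ⟨hpath, hpairs⟩ := hmark
    obtain ⟨-, hq, hst⟩ := parametricSearch_spec (mark := mark) (N := K * n)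
      (Q := (n : ℝ) ^ (7 * C)) hn hB hdec (fun a => hpairs a (Finset.mem_univ a)) fun e => by
        rw [mul_comm 7 C, pow_mul]
        have : (pathProduct (itemKey x opt) mark e Finset.univ : ℝ) ≤ (n : ℝ) ^ C := by
          exact_mod_cast hpath e
        gcongr
    set q := (parametricSearch x decideAt mark).val.queries with hqdef
    set ℓ := Real.log n with hℓ
    have hlog2 : (1 : ℝ) / 2 ≤ Real.log 2 := by linarith [Real.log_two_gt_d9]
    have hℓ2 : 1 ≤ 2 * ℓ := by
      have := Real.log_le_log (by norm_num) hn2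
      linarith
    have hq' : (q : ℝ) ≤ K₁ * ℓ := by
      have h1 : (4 / 3 : ℝ) ^ q ≤ (n : ℝ) ^ (7 * C + 3) := by
        refine hq.trans ?_
        rw [pow_add, pow_succ (n : ℝ) 2]
        have : (0 : ℝ) ≤ (n : ℝ) ^ 2 * (n : ℝ) ^ (7 * C) := by positivity
        nlinarith
      have h2 := Real.log_le_log (by positivity) h1
      rw [Real.log_pow, Real.log_pow] at h2
      push_cast at h2
      rw [hK₁, div_mul_eq_mul_div, le_div_iff₀ hlog]
      exact h2
    have hlogb : Real.logb 2 n ≤ 2 * ℓ := by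
      rw [Real.logb, div_le_iff₀ (by linarith)]
      nlinarith
    have hclog : (Nat.clog 2 n : ℝ) ≤ 4 * ℓ := by linarith [clog_two_le hn]
    have hspawn : spawnCost x opt mark Finset.univ ≤ n * (30 + 60 * C * ℓ + 4 * ℓ) := by
      have h : ∀ e ∈ (Finset.univ : Finset (Fin n)),
          30 + 30 * Real.logb 2 (pathProduct (itemKey x opt) mark e Finset.univ) + Nat.clog 2 n
            ≤ 30 + 60 * C * ℓ + 4 * ℓ := by
        intro e he
        have h1 := one_le_pathProduct (x := x) (opt := opt) (mark := mark) he
        have h2 : (pathProduct (itemKey x opt) mark e Finset.univ : ℝ) ≤ (n : ℝ) ^ C := by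
          exact_mod_cast hpath e
        have h3 := Real.logb_le_logb_of_le (b := 2) (by norm_num) (by linarith) h2
        rw [Real.logb_pow] at h3
        have h4 := mul_le_mul_of_nonneg_left hlogb (Nat.cast_nonneg (α := ℝ) C)
        linarith
      have := Finset.sum_le_card_nsmul _ _ _ h
      rwa [Finset.card_univ, Fintype.card_fin, nsmul_eq_mul] at this
    have hC0 : (0 : ℝ) ≤ C := Nat.cast_nonneg C
    have hK0 : (0 : ℝ) ≤ K := Nat.cast_nonneg K
    have hc0 : (0 : ℝ) ≤ c := Nat.cast_nonneg c
    have hℓ0 : 0 ≤ ℓ := by linarith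
    have hn0 : (0 : ℝ) ≤ n := by linarith
    constructor
    · refine hq'.trans (mul_le_mul_of_nonneg_right ?_ hℓ0)
      have : 0 ≤ K₁ * (12553 * (1 + K)) := by positivity
      linarith
    · refine hst.trans ?_
      push_cast
      have e1 : (q : ℝ) * (c + 12553 * (n + K * n)) ≤ K₁ * ℓ * (c + 12553 * (n + K * n)) :=
        mul_le_mul_of_nonneg_right hq' (by positivity)
      have e2 : (n : ℝ) + 5 + n * 30 ≤ 68 * (n * ℓ) := by nlinarith
      have e3 : 0 ≤ (K₁ * (12553 * (1 + K)) + 72 + 60 * C) * (ℓ * c) := by positivity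
      have e4 : 0 ≤ K₁ * (n * ℓ) := by positivity
      linarith
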